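/- **Setting.** An imprecise terrain is a finite undirected (possibly non-planar) graph whose nodes are distinct points of $\mathbb R^2$, with an elevation interval $[\mathrm{low}(v),\mathrm{high}(v)]$ for every node $v$. A realization $R$ assigns to every node $v$ an elevation $\mathrm{elev}(R,v)\in[\mathrm{low}(v),\mathrm{high}(v)]$. The steepness of an edge $(p,q)$ in $R$ is $(\mathrm{elev}(R,p)-\mathrm{elev}(R,q))/|pq|$, where $|pq|$ is the distance in the plane; $q$ is a steepest descent neighbor of $p$ if the steepness of $(p,q)$ is non-negative and maximal over all neighbors of $p$. Water flows from a node to all its steepest descent neighbors, except that inside a local minimum (a connected set of nodes of one common elevation, strictly lower than all neighbors of the set) it flows only to the neighbors within this set. Write $p\to_R q$ if water from $p$ reaches $q$ in $R$, with $p\to_R p$ always. For a set $Q$ of nodes let $WS(R,Q)=\{p: p\to_R q \text{ for some } q\in Q\}$ and $PoWS(Q)=\bigcup_R WS(R,Q)$, the union over all realizations. The canonical realization of $PoWS(Q)$ is the realization in which each $v\notin PoWS(Q)$ has elevation $\mathrm{high}(v)$ and each $v\in PoWS(Q)$ has elevation $\min\{\mathrm{elev}(R,v): v\in WS(R,Q)\}$.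 For a node $q'$ and an elevation $z'$ let $\mathrm{Expand}(q',z')$ be the set of all pairs $(p,z)$ such that $p$ is a neighbor of $q'$ and $z$ is the minimum of $\mathrm{elev}(R,p)$ over the (nonempty) set of realizations $R$ with $\mathrm{elev}(R,q')\in[z',\mathrm{high}(q')]$ and $p\to_R q'$. The algorithm $\mathrm{PotentialWS}(Q)$ starts with a queue that contains $(q,\mathrm{low}(q))$ for all $q\in Q$. While the queue is not empty, it dequeues a pair $(q',z')$ with minimum $z'$ and, if $q'$ has not been output before, outputs $q'$ with elevation $z'$ and enqueues all members of $\mathrm{Expand}(q',z')$. **Theorem.** 1. For every imprecise terrain with $n$ edges and every set $Q$ of its nodes, the canonical realization $\overline R$ of $PoWS(Q)$ exists and satisfies $WS(\overline R,Q)=PoWS(Q)$. The algorithm $\mathrm{PotentialWS}(Q)$ has a complete run, no run makes more than $|Q|+2n$ iterations, and every complete run outputs exactly the nodes of $PoWS(Q)$, each exactly once and with its elevation in $\overline R$. 2. $\mathrm{PotentialWS}$ can be implemented on a real RAM (unit-cost $+,-,\cdot,/,\sqrt{\ }$ and comparisons on real numbers, without rounding) in time $O(n\log n)$ after a precomputation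 in $O(n\log n)$ time and $O(n)$ space. Precisely: there are two fixed programs and a constant $C$ such that for every imprecise terrain with $n$ edges and without isolated nodes, given by the coordinates and elevation bounds of its nodes and by adjacency lists, the first program halts within $C(n\log n+1)$ steps; and for every set $Q$ of nodes, supplied after that as a list, the second program, started on the memory that the first one left, halts within $C(n\log n+1)$ steps, having written out the output sequence of a complete run of $\mathrm{PotentialWS}(Q)$ and the elevations of all nodes in the canonical realization of $PoWS(Q)$. In both computations all integers and all array indices are at most $C(n+1)$, in a fixed number of arrays; thus both use $O(n)$ space. -/

import Mathlib

/-! ### Imprecise terrains and water flow in the network model -/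

/-- An imprecise terrain on the node set `V`: a (possibly non-planar) undirected geometric graph
whose nodes are distinct points of the Euclidean plane, and an elevation interval
`[low v, high v]` for every node `v`. -/
structure ImpreciseTerrain (V : Type) where
  graph : SimpleGraph V
  pos : V → EuclideanSpace ℝ (Fin 2)
  pos_injective : Function.Injective pos
  low : V → ℝ
  high : V → ℝ
  low_le_high : ∀ v, low v ≤ high v

namespace ImpreciseTerrain

variable {V : Type}

/-- The assignment `R` of elevations to the nodes is a realization of the terrain. -/
def IsRealization (T : ImpreciseTerrain V) (R : V → ℝ) : Prop :=
  ∀ v, T.low v ≤ R v ∧ R v ≤ T.high v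

/-- Steepness of descent from `p` to `q`. -/
noncomputable def steep (T : ImpreciseTerrain V) (R : V → ℝ) (p q : V) : ℝ :=
  (R p - R q) / dist (T.pos p) (T.pos q)

/-- `q` is a steepest descent neighbor of `p`: the steepness of `(p, q)` is non-negative and
maximal over all neighbors of `p`. -/
def IsSteepestDescentNeighbor (T : ImpreciseTerrain V) (R : V → ℝ) (p q : V) : Prop :=
  T.graph.Adj p q ∧ 0 ≤ T.steep R p q ∧ ∀ r, T.graph.Adj p r → T.steep R p r ≤ T.steep R p q

/-- The neighborhood `N(P)` of a set of nodes. -/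
def neighborhood (T : ImpreciseTerrain V) (P : Set V) : Set V :=
  {s | s ∉ P ∧ ∃ t ∈ P, T.graph.Adj s t}

/-- `P` is a local minimum of `R`: a (nonempty) connected set of nodes at one common elevation,
strictly lower than all nodes of `N(P)`. -/
def IsLocalMinimum (T : ImpreciseTerrain V) (R : V → ℝ) (P : Set V) : Prop :=
  (T.graph.induce P).Connected ∧
    ∃ h : ℝ, (∀ v ∈ P, R v = h) ∧ ∀ s ∈ T.neighborhood P, h < R s

/-- Water at `p` flows on to `q` along one edge: to each steepest descent neighbor of `p` if `p`
is in no local minimum, and to the neighbors of `p` in `P` if `p` lies in a local minimum `P`. -/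
def WaterStep (T : ImpreciseTerrain V) (R : V → ℝ) (p q : V) : Prop :=
  ((¬ ∃ P, T.IsLocalMinimum R P ∧ p ∈ P) ∧ T.IsSteepestDescentNeighbor R p q) ∨
    ∃ P, T.IsLocalMinimum R P ∧ p ∈ P ∧ q ∈ P ∧ T.graph.Adj p q

/-- `p` flows to `q` in `R` (every node flows to itself). -/
def FlowsTo (T : ImpreciseTerrain V) (R : V → ℝ) (p q : V) : Prop :=
  Relation.ReflTransGen (T.WaterStep R) p q

/-- The watershed `WS(R, q)` of a node. -/
def nodeWatershed (T : ImpreciseTerrain V) (R : V → ℝ) (q : V) : Set V :=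
  {p | T.FlowsTo R p q}

/-- The watershed `WS(R, Q)` of a set of nodes. -/
def watershed (T : ImpreciseTerrain V) (R : V → ℝ) (Q : Set V) : Set V :=
  ⋃ q ∈ Q, T.nodeWatershed R q

/-- The potential watershed `PoWS(Q)`. -/
def potentialWatershed (T : ImpreciseTerrain V) (Q : Set V) : Set V :=
  ⋃ R ∈ {R | T.IsRealization R}, ⋃ q ∈ Q, T.nodeWatershed R q

/-- `Rbar` is the watershed-overlay of the watersheds `WS(R, q)`, `(R, q) ∈ F`: a realization in
which every node outside all these watersheds has its highest elevation and every other node `v`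
has elevation `min R v`, taken over all `(R, q) ∈ F` with `v ∈ WS(R, q)` (a true minimum). -/
def IsWatershedOverlay (T : ImpreciseTerrain V) (F : Set ((V → ℝ) × V)) (Rbar : V → ℝ) : Prop :=
  T.IsRealization Rbar ∧
    ∀ v, (v ∉ (⋃ x ∈ F, T.nodeWatershed x.1 x.2) → Rbar v = T.high v) ∧
      (v ∈ (⋃ x ∈ F, T.nodeWatershed x.1 x.2) →
        IsLeast {z : ℝ | ∃ x ∈ F, v ∈ T.nodeWatershed x.1 x.2 ∧ x.1 v = z} (Rbar v))

/-- `Rbar` is the canonical realization of `PoWS(Q)`: the overlay of the watersheds of the elements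
of `Q` in all realizations of the terrain. -/
def IsCanonicalRealization (T : ImpreciseTerrain V) (Q : Set V) (Rbar : V → ℝ) : Prop :=
  T.IsWatershedOverlay {x | T.IsRealization x.1 ∧ x.2 ∈ Q} Rbar

/-! ### The algorithm `PotentialWS` -/

/-- `Expand(q', z')`: all pairs `(p, z)` such that `p` is a neighbor of `q'` and `z` is the minimum
elevation of `p` over all realizations `R` in which `q'` has elevation at least `z'` and `p`
flows to `q'` (there being such a realization). -/
def expand (T : ImpreciseTerrain V) (q' : V) (z' : ℝ) : Set (V × ℝ) :=
  {x | x.1 ∈ T.neighborhood {q'} ∧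
    IsLeast {z : ℝ | ∃ R, T.IsRealization R ∧ R q' ∈ Set.Icc z' (T.high q') ∧
      T.FlowsTo R x.1 q' ∧ R x.1 = z} x.2}

/-- `T.PWSRun Q k S L`: after `k` iterations of the main loop, `PotentialWS(Q)` can have queue
contents `S` (pairs of a node and an elevation, keyed by the elevation) and output sequence `L`.
Initially all `(q, low q)`, `q ∈ Q`, are enqueued. Each iteration dequeues a pair `(q', z')`
of minimum key; if `q'` has not been output before, it is output with elevation `z'` and all
members of `Expand(q', z')` are enqueued. -/
inductive PWSRun (T : ImpreciseTerrain V) (Q : Finset V) :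
    ℕ → Multiset (V × ℝ) → List (V × ℝ) → Prop
  | init : PWSRun T Q 0 (Q.val.map fun q => (q, T.low q)) []
  | discard {k : ℕ} {S : Multiset (V × ℝ)} {L : List (V × ℝ)} (q' : V) (z' : ℝ) :
      PWSRun T Q k ((q', z') ::ₘ S) L → (∀ x ∈ S, z' ≤ x.2) → q' ∈ L.map Prod.fst →
      PWSRun T Q (k + 1) S L
  | output {k : ℕ} {S : Multiset (V × ℝ)} {L : List (V × ℝ)} (q' : V) (z' : ℝ)
      (E : Finset (V × ℝ)) :
      PWSRun T Q k ((q', z') ::ₘ S) L → (∀ x ∈ S, z' ≤ x.2) → q' ∉ L.map Prod.fst →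
      (E : Set (V × ℝ)) = T.expand q' z' →
      PWSRun T Q (k + 1) (S + E.val) (L ++ [(q', z')])

/-- `L` is the output sequence of a complete run of `PotentialWS(Q)`, that is, one that has
emptied the queue. -/
def PotentialWSOutputs (T : ImpreciseTerrain V) (Q : Finset V) (L : List (V × ℝ)) : Prop :=
  ∃ k, T.PWSRun Q k 0 L

/-- The number of edges of the terrain. -/
noncomputable def numEdges (T : ImpreciseTerrain V) : ℕ := T.graph.edgeSet.ncard

end ImpreciseTerrain

/-! ### A real RAM

Memory consists of registers and arrays, each holding either integers or real numbers; a program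
mentions finitely many of them. Integers are words: in a computation with word bound `B`, all
integers (in particular all array indices) that occur have to be at most `B`, so every array
occupies at most `B + 1` cells. Real numbers are exact; they can be combined by `+`, `-`, `*`, `/`
and `√`, and compared, but not rounded or converted to integers. Every operation and every memory
access costs one step. -/

namespace RealRAM

structure Store where
  ireg : ℕ → ℕ
  rreg : ℕ → ℝ
  iarr : ℕ → ℕ → ℕ
  rarr : ℕ → ℕ → ℝ

inductive IExp where
  | const (c : ℕ)
  | reg (x : ℕ)
  | read (a : ℕ) (i : IExp)
  | add (e f : IExp)
  | sub (e f : IExp)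
  | mul (e f : IExp)
  | div (e f : IExp)

inductive RExp where
  | const (c : ℚ)
  | reg (x : ℕ)
  | read (a : ℕ) (i : IExp)
  | add (e f : RExp)
  | sub (e f : RExp)
  | mul (e f : RExp)
  | div (e f : RExp)
  | sqrt (e : RExp)

inductive BExp where
  | ilt (e f : IExp)
  | ieq (e f : IExp)
  | rlt (e f : RExp)
  | not (b : BExp)
  | and (b c : BExp)

inductive Cmd where
  | skip
  | iset (x : ℕ) (e : IExp)
  | rset (x : ℕ) (e : RExp)
  | iwrite (a : ℕ) (i e : IExp)
  | rwrite (a : ℕ) (i : IExp) (e : RExp)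
  | seq (c d : Cmd)
  | ite (b : BExp) (c d : Cmd)
  | loop (b : BExp) (c : Cmd)

/-- Value of an integer expression (subtraction is truncated, division rounds down). -/
def IExp.eval (s : Store) : IExp → ℕ
  | .const c => c
  | .reg x => s.ireg x
  | .read a i => s.iarr a (i.eval s)
  | .add e f => e.eval s + f.eval s
  | .sub e f => e.eval s - f.eval s
  | .mul e f => e.eval s * f.eval s
  | .div e f => e.eval s / f.eval s

/-- Legal evaluation: no value exceeds the word bound, no division by zero. -/
def IExp.Ok (B : ℕ) (s : Store) : IExp → Prop
  | .const c => c ≤ B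
  | .reg x => s.ireg x ≤ B
  | .read a i => i.Ok B s ∧ s.iarr a (i.eval s) ≤ B
  | .add e f => e.Ok B s ∧ f.Ok B s ∧ e.eval s + f.eval s ≤ B
  | .sub e f => e.Ok B s ∧ f.Ok B s
  | .mul e f => e.Ok B s ∧ f.Ok B s ∧ e.eval s * f.eval s ≤ B
  | .div e f => e.Ok B s ∧ f.Ok B s ∧ f.eval s ≠ 0

def IExp.cost : IExp → ℕ
  | .const _ => 1
  | .reg _ => 1
  | .read _ i => i.cost + 1
  | .add e f => e.cost + f.cost + 1
  | .sub e f => e.cost + f.cost + 1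
  | .mul e f => e.cost + f.cost + 1
  | .div e f => e.cost + f.cost + 1

noncomputable def RExp.eval (s : Store) : RExp → ℝ
  | .const c => c
  | .reg x => s.rreg x
  | .read a i => s.rarr a (i.eval s)
  | .add e f => e.eval s + f.eval s
  | .sub e f => e.eval s - f.eval s
  | .mul e f => e.eval s * f.eval s
  | .div e f => e.eval s / f.eval s
  | .sqrt e => Real.sqrt (e.eval s)

/-- Legal evaluation: legal indices, no division by zero, no root of a negative number. -/
def RExp.Ok (B : ℕ) (s : Store) : RExp → Prop
  | .const _ => True
  | .reg _ => True
  | .read _ i => i.Ok B s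
  | .add e f => e.Ok B s ∧ f.Ok B s
  | .sub e f => e.Ok B s ∧ f.Ok B s
  | .mul e f => e.Ok B s ∧ f.Ok B s
  | .div e f => e.Ok B s ∧ f.Ok B s ∧ f.eval s ≠ 0
  | .sqrt e => e.Ok B s ∧ 0 ≤ e.eval s

def RExp.cost : RExp → ℕ
  | .const _ => 1
  | .reg _ => 1
  | .read _ i => i.cost + 1
  | .add e f => e.cost + f.cost + 1
  | .sub e f => e.cost + f.cost + 1
  | .mul e f => e.cost + f.cost + 1
  | .div e f => e.cost + f.cost + 1
  | .sqrt e => e.cost + 1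

def BExp.Holds (s : Store) : BExp → Prop
  | .ilt e f => e.eval s < f.eval s
  | .ieq e f => e.eval s = f.eval s
  | .rlt e f => e.eval s < f.eval s
  | .not b => ¬ b.Holds s
  | .and b c => b.Holds s ∧ c.Holds s

def BExp.Ok (B : ℕ) (s : Store) : BExp → Prop
  | .ilt e f => e.Ok B s ∧ f.Ok B s
  | .ieq e f => e.Ok B s ∧ f.Ok B s
  | .rlt e f => e.Ok B s ∧ f.Ok B s
  | .not b => b.Ok B s
  | .and b c => b.Ok B s ∧ c.Ok B s

def BExp.cost : BExp → ℕ
  | .ilt e f => e.cost + f.cost + 1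
  | .ieq e f => e.cost + f.cost + 1
  | .rlt e f => e.cost + f.cost + 1
  | .not b => b.cost + 1
  | .and b c => b.cost + c.cost + 1

/-- `Exec B c s t s'`: with word bound `B`, the program `c` started in the store `s` halts after
`t` steps in the store `s'`, without any illegal operation. -/
inductive Exec (B : ℕ) : Cmd → Store → ℕ → Store → Prop
  | skip (s : Store) : Exec B .skip s 1 s
  | iset (s : Store) (x : ℕ) (e : IExp) : e.Ok B s →
      Exec B (.iset x e) s (e.cost + 1)
        { s with ireg := Function.update s.ireg x (e.eval s) }
  | rset (s : Store) (x : ℕ) (e : RExp) : e.Ok B s →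
      Exec B (.rset x e) s (e.cost + 1)
        { s with rreg := Function.update s.rreg x (e.eval s) }
  | iwrite (s : Store) (a : ℕ) (i e : IExp) : i.Ok B s → e.Ok B s →
      Exec B (.iwrite a i e) s (i.cost + e.cost + 1)
        { s with iarr :=
            Function.update s.iarr a (Function.update (s.iarr a) (i.eval s) (e.eval s)) }
  | rwrite (s : Store) (a : ℕ) (i : IExp) (e : RExp) : i.Ok B s → e.Ok B s →
      Exec B (.rwrite a i e) s (i.cost + e.cost + 1)
        { s with rarr :=
            Function.update s.rarr a (Function.update (s.rarr a) (i.eval s) (e.eval s)) }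
  | seq {c d : Cmd} {s s' s'' : Store} {t t' : ℕ} :
      Exec B c s t s' → Exec B d s' t' s'' → Exec B (.seq c d) s (t + t') s''
  | ite_true {b : BExp} {c d : Cmd} {s s' : Store} {t : ℕ} :
      b.Ok B s → b.Holds s → Exec B c s t s' → Exec B (.ite b c d) s (b.cost + t + 1) s'
  | ite_false {b : BExp} {c d : Cmd} {s s' : Store} {t : ℕ} :
      b.Ok B s → ¬ b.Holds s → Exec B d s t s' → Exec B (.ite b c d) s (b.cost + t + 1) s'
  | loop_false {b : BExp} {c : Cmd} {s : Store} :
      b.Ok B s → ¬ b.Holds s → Exec B (.loop b c) s (b.cost + 1) s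
  | loop_true {b : BExp} {c : Cmd} {s s' s'' : Store} {t t' : ℕ} :
      b.Ok B s → b.Holds s → Exec B c s t s' → Exec B (.loop b c) s' t' s'' →
      Exec B (.loop b c) s (b.cost + t + t' + 1) s''

/-! ### Input and output conventions -/

/-- `adj` lists the neighbors of every node, each once, in any order. -/
def IsAdjacencyLists {m : ℕ} (T : ImpreciseTerrain (Fin m)) (adj : Fin m → List (Fin m)) : Prop :=
  ∀ v, (adj v).Nodup ∧ ∀ w, w ∈ adj v ↔ T.graph.Adj v w

/-- The initial memory for a terrain with `m` nodes. Integer register 0 holds `m`; real arrays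
0, 1, 2, 3 hold the `x`-coordinates, the `y`-coordinates, the lower and the upper elevation
bounds of the nodes; integer array 1 holds the concatenation of the adjacency lists, and integer
array 0 the position where the list of each node starts (and, at index `m`, the position where
the last one ends). Everything else is zero. -/
noncomputable def inputStore {m : ℕ} (T : ImpreciseTerrain (Fin m)) (adj : Fin m → List (Fin m)) :
    Store where
  ireg := fun x => if x = 0 then m else 0
  rreg := fun _ => 0
  iarr := fun a i =>
    if a = 0 then (if i ≤ m then ∑ v : Fin m, (if v.val < i then (adj v).length else 0) else 0)
    else if a = 1 then (((List.ofFn adj).flatten).map Fin.val).getD i 0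
    else 0
  rarr := fun a i =>
    if h : i < m then
      (if a = 0 then T.pos ⟨i, h⟩ 0
       else if a = 1 then T.pos ⟨i, h⟩ 1
       else if a = 2 then T.low ⟨i, h⟩
       else if a = 3 then T.high ⟨i, h⟩
       else 0)
    else 0

/-- Supply a query set, given as a list of nodes: its length goes to integer register 1 and its
members to the first cells of integer array 2. The rest of the memory is left as it is. -/
def loadQuery {m : ℕ} (l : List (Fin m)) (s : Store) : Store :=
  { s with
    ireg := Function.update s.ireg 1 l.length
    iarr := Function.update s.iarr 2 fun i => (l.map Fin.val).getD i (s.iarr 2 i) }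

/-- The output sequence of nodes with elevations: integer register 0 holds its length, integer
array 3 the nodes, real array 4 the elevations. -/
def outputSequence (s : Store) : List (ℕ × ℝ) :=
  (List.range (s.ireg 0)).map fun i => (s.iarr 3 i, s.rarr 4 i)

/-- The output realization: real array 5 holds an elevation for each of the `m` nodes. -/
def outputRealization (m : ℕ) (s : Store) : Fin m → ℝ := fun v => s.rarr 5 v.val

end RealRAM

/-! ### Water flow as steepest descent. -/

namespace ImpreciseTerrain

variable {V : Type} {T : ImpreciseTerrain V} {R : V → ℝ} {p q : V} {Q : Set V}

/-! Correctness. Inside a local minimum the special flow rule agrees with steepest descent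
(`waterStep_iff`), so flow is a closed condition on the compact box of realizations, and every
minimum that occurs is attained. Suppose that a node keeps its elevation while the neighbor it flows
to is not raised and the nodes outside some set are not lowered. Then that neighbor stays at least
as steep as everything outside, and water can leave the set only through `Q`. The one remaining
danger, water circling on a plateau, is excluded by a rank that decreases on level steps
(`exists_flowsTo_of_progress`). Applied to the canonical realization this gives
`IsCanonicalRealization.watershed_eq`. Applied to an overlay with a second watershed it gives
`IsCanonicalRealization.mem_and_le_of_flowsTo`: water arriving at a node of the potential watershed,
no lower than the canonical elevation there, may go on to `Q`.

The algorithm is then Dijkstra's. Queue elements never undershoot canonical elevations, by the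
second application. Water in the canonical realization never rises, so as long as a node is missing,
the queue offers a missing node at most as high. Hence the minimum of the queue, if new, has its
canonical elevation (`PWSRun.inv`). Each node is expanded once and yields at most one pair per
neighbor, which bounds the iterations.

Implementation. The program keeps one key per node and considers only flow along a single edge
(`edgeExpand`). At the moment of output the key is the canonical elevation, and this forces the
corresponding pair into the queue of the algorithm, so the program follows a genuine run
(`SearchInv.step`). For one edge the best case puts all other neighbors at their highest elevations.
The elevation sought is the first point where a line of slope `1 / |pq|` reaches the upper envelope
of the lines of these neighbors. The lines depend on `p` only, so the precomputation stores one
envelope per node. A tournament tree delivers all adjacency entries by decreasing distance, that is,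
by increasing slope, and every entry is put on the stack of its owner. A query combines a tournament
tree as priority queue with binary search on the envelopes. Every edge thus costs logarithmic time.
-/

theorem dist_pos_of_adj (h : T.graph.Adj p q) : 0 < dist (T.pos p) (T.pos q) :=
  dist_pos.2 fun e => h.ne (T.pos_injective e)

theorem steep_nonneg_iff (h : T.graph.Adj p q) : 0 ≤ T.steep R p q ↔ R q ≤ R p := by
  rw [steep, le_div_iff₀ (dist_pos_of_adj h), zero_mul, sub_nonneg]

/-- Inside a local minimum the steepest descent neighbors are exactly the neighbors in it. -/
theorem waterStep_iff : T.WaterStep R p q ↔ T.IsSteepestDescentNeighbor R p q := by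
  constructor
  · rintro (⟨-, h⟩ | ⟨P, ⟨-, h, hP, hN⟩, hp, hq, hadj⟩)
    · exact h
    · have h0 : T.steep R p q = 0 := by rw [steep, hP p hp, hP q hq, sub_self, zero_div]
      refine ⟨hadj, h0.ge, fun r hr => ?_⟩
      rw [h0, steep, div_le_iff₀ (dist_pos_of_adj hr), zero_mul, sub_nonpos, hP p hp]
      by_cases hrP : r ∈ P
      · exact (hP r hrP).ge
      · exact (hN r ⟨hrP, p, hp, hr.symm⟩).le
  · intro h
    by_cases hex : ∃ P, T.IsLocalMinimum R P ∧ p ∈ P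
    · obtain ⟨P, hP, hp⟩ := hex
      -- A steepest descent neighbor is not higher than `p`, so it cannot lie in the strictly higher
      -- neighborhood of `P`.
      refine Or.inr ⟨P, hP, hp, ?_, h.1⟩
      by_contra hq
      obtain ⟨-, e, hPe, hN⟩ := hP
      have h1 := hN q ⟨hq, p, hp, h.1.symm⟩
      have h2 := (steep_nonneg_iff h.1).1 h.2.1
      rw [hPe p hp] at h2
      linarith
    · exact Or.inl ⟨hex, h⟩

theorem WaterStep.adj (h : T.WaterStep R p q) : T.graph.Adj p q := (waterStep_iff.1 h).1

theorem WaterStep.le (h : T.WaterStep R p q) : R q ≤ R p :=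
  (steep_nonneg_iff h.adj).1 (waterStep_iff.1 h).2.1

theorem WaterStep.steep_le (h : T.WaterStep R p q) {r : V} (hr : T.graph.Adj p r) :
    T.steep R p r ≤ T.steep R p q := (waterStep_iff.1 h).2.2 r hr

/-- Used in all overlay arguments, in both directions: a node that flows on keeps its elevation, its
target is lowered and the competitors are raised. -/
theorem steep_mono {R R' : V → ℝ} (h : T.graph.Adj p q) (hp : R p = R' p) (hq : R' q ≤ R q) :
    T.steep R p q ≤ T.steep R' p q := by
  unfold steep
  have := dist_pos_of_adj h
  gcongr
  exact hp.le

/-- `p` can flow to `Q` in exactly `n` steps. -/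
def Reach (T : ImpreciseTerrain V) (R : V → ℝ) (Q : Set V) : ℕ → V → Prop
  | 0, p => p ∈ Q
  | n + 1, p => ∃ w, T.WaterStep R p w ∧ Reach T R Q n w

theorem mem_watershed : p ∈ T.watershed R Q ↔ ∃ q ∈ Q, T.FlowsTo R p q := by
  simp [watershed, nodeWatershed]

theorem Reach.mem_watershed {n : ℕ} (h : T.Reach R Q n p) : p ∈ T.watershed R Q := by
  induction n generalizing p with
  | zero => exact ImpreciseTerrain.mem_watershed.2 ⟨p, h, .refl⟩
  | succ n ih =>
    obtain ⟨w, hw, h⟩ := h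
    obtain ⟨q, hq, h⟩ := ImpreciseTerrain.mem_watershed.1 (ih h)
    exact ImpreciseTerrain.mem_watershed.2 ⟨q, hq, .head hw h⟩

theorem exists_reach (h : p ∈ T.watershed R Q) : ∃ n, T.Reach R Q n p := by
  obtain ⟨q, hq, hf⟩ := mem_watershed.1 h
  clear h
  induction hf using Relation.ReflTransGen.head_induction_on with
  | refl => exact ⟨0, hq⟩
  | head h _ ih => obtain ⟨n, hn⟩ := ih; exact ⟨n + 1, _, h, hn⟩

theorem mem_potentialWatershed :
    p ∈ T.potentialWatershed Q ↔ ∃ R, T.IsRealization R ∧ p ∈ T.watershed R Q := by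
  simp [potentialWatershed, watershed, nodeWatershed]

/-- A set of nodes flows to `Q` if each of its nodes has a neighbor in it that is not higher, is
at least as steep as every neighbor outside, and makes progress. -/
theorem exists_flowsTo_of_progress [Finite V] {U : Set V} (rank : V → ℕ)
    (h : ∀ v ∈ U, v ∉ Q → ∃ w ∈ U, T.graph.Adj v w ∧ R w ≤ R v ∧
      (∀ u, u ∉ U → T.graph.Adj v u → T.steep R v u ≤ T.steep R v w) ∧
      (R w = R v → rank w < rank v)) :
    ∀ v ∈ U, v ∈ T.watershed R Q := by
  -- Water goes strictly down, or stays level and decreases the rank. On a finite type this order is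
  -- well founded, so no path circles on a plateau.
  let r : V → V → Prop := fun a b => R a < R b ∨ R a = R b ∧ rank a < rank b
  have : IsTrans V r := ⟨fun a b c hab hbc => by
    rcases hab with hab | hab <;> rcases hbc with hbc | hbc
    · exact Or.inl (hab.trans hbc)
    · exact Or.inl (hbc.1 ▸ hab)
    · exact Or.inl (hab.1 ▸ hbc)
    · exact Or.inr ⟨hab.1.trans hbc.1, hab.2.trans hbc.2⟩⟩
  have : Std.Irrefl r := ⟨fun a h => by
    rcases h with h | h
    · exact lt_irrefl _ h
    · exact lt_irrefl _ h.2⟩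
  have wf : WellFounded r := Finite.wellFounded_of_trans_of_irrefl r
  intro v
  induction v using wf.induction with
  | _ v ih =>
  intro hv
  by_cases hvQ : v ∈ Q
  · exact mem_watershed.2 ⟨v, hvQ, .refl⟩
  suffices ∃ u ∈ U, T.WaterStep R v u ∧ r u v by
    obtain ⟨u, hu, hs, hr⟩ := this
    obtain ⟨q, hq, hf⟩ := mem_watershed.1 (ih u hr hu)
    exact mem_watershed.2 ⟨q, hq, .head hs hf⟩
  obtain ⟨w, hw, hadj, hle, hout, hrank⟩ := h v hv hvQ
  obtain ⟨u, hu, hmax⟩ := Set.exists_max_image {u | T.graph.Adj v u} (T.steep R v)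
    (Set.toFinite _) ⟨w, hadj⟩
  have hw0 : 0 ≤ T.steep R v w := (steep_nonneg_iff hadj).2 hle
  -- If `w` is not steepest, a steepest neighbor `u` beats it. Then `u` cannot be outside `U`, and
  -- having positive steepness it is strictly lower than `v`, so its rank does not matter.
  by_cases hwmax : T.steep R v u ≤ T.steep R v w
  · refine ⟨w, hw, waterStep_iff.2 ⟨hadj, hw0, fun x hx => (hmax x hx).trans hwmax⟩, ?_⟩
    rcases hle.lt_or_eq with h | h
    · exact Or.inl h
    · exact Or.inr ⟨h, hrank h⟩
  · push Not at hwmax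
    refine ⟨u, by_contra fun h => (hout u h hu).not_gt hwmax,
      waterStep_iff.2 ⟨hu, (hw0.trans_lt hwmax).le, hmax⟩, Or.inl ?_⟩
    have := hw0.trans_lt hwmax
    rw [steep, lt_div_iff₀ (dist_pos_of_adj hu), zero_mul, sub_pos] at this
    exact this

/-! ### The canonical realization -/

theorem isCompact_setOf_isRealization [Finite V] : IsCompact {R | T.IsRealization R} := by
  have : {R | T.IsRealization R} = Set.pi Set.univ fun v => Set.Icc (T.low v) (T.high v) := by
    ext R; simp [IsRealization, Pi.le_def, forall_and]
  rw [this]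
  exact isCompact_univ_pi fun v => isCompact_Icc

/-- Once `waterStep_iff` has removed the local minima, whose definition contains a strict
inequality, only non-strict inequalities between continuous functions of `R` remain. -/
theorem isClosed_setOf_waterStep (p q : V) : IsClosed {R | T.WaterStep R p q} := by
  have : {R | T.WaterStep R p q} = {R | T.graph.Adj p q} ∩ ({R | 0 ≤ T.steep R p q} ∩
      ⋂ r, ⋂ (_ : T.graph.Adj p r), {R | T.steep R p r ≤ T.steep R p q}) := by
    ext R; simp [waterStep_iff, IsSteepestDescentNeighbor]
  have hc : ∀ r, Continuous fun R => T.steep R p r := fun r => by unfold steep; fun_prop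
  rw [this]
  refine (isClosed_const).inter ((isClosed_le continuous_const (hc q)).inter ?_)
  exact isClosed_iInter fun r => isClosed_iInter fun _ => isClosed_le (hc r) (hc q)

/-- Group the realizations by a relation `E` that connects `p` to `q` and consists of water steps.
For fixed `E` the condition is closed, and there are only finitely many `E`. -/
theorem isClosed_setOf_flowsTo [Finite V] (p q : V) : IsClosed {R | T.FlowsTo R p q} := by
  have : {R | T.FlowsTo R p q} = ⋃ E ∈ {E : V → V → Prop | Relation.ReflTransGen E p q},
      ⋂ a, ⋂ b, ⋂ (_ : E a b), {R | T.WaterStep R a b} := by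
    ext R
    simp only [Set.mem_ofPred_eq, Set.mem_iUnion, Set.mem_iInter, exists_prop]
    constructor
    · intro h; exact ⟨T.WaterStep R, h, fun _ _ h => h⟩
    · rintro ⟨E, hE, h⟩; exact Relation.ReflTransGen.mono (fun a b => h a b) _ _ hE
  rw [this]
  refine (Set.toFinite _).isClosed_biUnion fun E _ => ?_
  exact isClosed_iInter fun a => isClosed_iInter fun b => isClosed_iInter fun _ =>
    isClosed_setOf_waterStep a b

theorem isClosed_setOf_mem_watershed [Finite V] (p : V) (Q : Set V) :
    IsClosed {R | p ∈ T.watershed R Q} := by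
  have : {R | p ∈ T.watershed R Q} = ⋃ q ∈ Q, {R | T.FlowsTo R p q} := by
    ext R; simp [mem_watershed]
  rw [this]
  exact (Set.toFinite _).isClosed_biUnion fun q _ => isClosed_setOf_flowsTo p q

/-- Compactness makes the minima in the definitions of the canonical realization and of `expand`
attained; `K` stands for the respective flow condition. -/
theorem exists_isLeast_elevation [Finite V] {K : Set (V → ℝ)} (hK : IsClosed K)
    (hne : ∃ R ∈ K, T.IsRealization R) (p : V) :
    ∃ z, IsLeast {z | ∃ R, T.IsRealization R ∧ R ∈ K ∧ R p = z} z := by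
  have : {z | ∃ R, T.IsRealization R ∧ R ∈ K ∧ R p = z} =
      (fun R : V → ℝ => R p) '' ({R | T.IsRealization R} ∩ K) := by
    ext z; simp [and_assoc]
  rw [this]
  obtain ⟨R, hRK, hR⟩ := hne
  exact ((isCompact_setOf_isRealization.inter_right hK).image (continuous_apply p)).exists_isLeast
    ⟨_, R, ⟨hR, hRK⟩, rfl⟩

theorem isCanonicalRealization_iff {Rbar : V → ℝ} : T.IsCanonicalRealization Q Rbar ↔
    T.IsRealization Rbar ∧ (∀ v, v ∉ T.potentialWatershed Q → Rbar v = T.high v) ∧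
      ∀ v ∈ T.potentialWatershed Q,
        IsLeast {z | ∃ R, T.IsRealization R ∧ v ∈ T.watershed R Q ∧ R v = z} (Rbar v) := by
  have h1 : (⋃ x ∈ {x : (V → ℝ) × V | T.IsRealization x.1 ∧ x.2 ∈ Q}, T.nodeWatershed x.1 x.2) =
      T.potentialWatershed Q := by
    ext v
    simp only [Set.mem_iUnion, potentialWatershed, Set.mem_ofPred_eq, exists_prop, Prod.exists]
    exact ⟨fun ⟨R, q, ⟨h, h'⟩, h''⟩ => ⟨R, h, q, h', h''⟩,
      fun ⟨R, h, q, h', h''⟩ => ⟨R, q, ⟨h, h'⟩, h''⟩⟩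
  have h2 : ∀ v, {z | ∃ x ∈ {x : (V → ℝ) × V | T.IsRealization x.1 ∧ x.2 ∈ Q},
      v ∈ T.nodeWatershed x.1 x.2 ∧ x.1 v = z} =
      {z | ∃ R, T.IsRealization R ∧ v ∈ T.watershed R Q ∧ R v = z} := by
    intro v
    ext z
    simp only [Set.mem_ofPred_eq, Prod.exists, mem_watershed, nodeWatershed]
    exact ⟨fun ⟨R, q, ⟨h, h'⟩, h'', e⟩ => ⟨R, h, ⟨q, h', h''⟩, e⟩,
      fun ⟨R, h, ⟨q, h', h''⟩, e⟩ => ⟨R, q, ⟨h, h'⟩, h'', e⟩⟩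
  simp only [IsCanonicalRealization, IsWatershedOverlay, h1, h2]
  exact ⟨fun ⟨h, h'⟩ => ⟨h, fun v => (h' v).1, fun v => (h' v).2⟩,
    fun ⟨h, h', h''⟩ => ⟨h, fun v => ⟨h' v, h'' v⟩⟩⟩

theorem exists_isCanonicalRealization [Finite V] (T : ImpreciseTerrain V) (Q : Set V) :
    ∃ Rbar, T.IsCanonicalRealization Q Rbar := by
  have h : ∀ v, ∃ z, (v ∉ T.potentialWatershed Q → z = T.high v) ∧ (v ∈ T.potentialWatershed Q →
      IsLeast {z | ∃ R, T.IsRealization R ∧ v ∈ T.watershed R Q ∧ R v = z} z) := by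
    intro v
    by_cases hv : v ∈ T.potentialWatershed Q
    · obtain ⟨R, hR, hv'⟩ := mem_potentialWatershed.1 hv
      obtain ⟨z, hz⟩ := exists_isLeast_elevation (T := T) (isClosed_setOf_mem_watershed v Q)
        ⟨R, hv', hR⟩ v
      exact ⟨z, fun h => absurd hv h, fun _ => hz⟩
    · exact ⟨T.high v, fun _ => rfl, fun h => absurd h hv⟩
  choose Rbar h1 h2 using h
  refine ⟨Rbar, isCanonicalRealization_iff.2 ⟨fun v => ?_, h1, h2⟩⟩
  by_cases hv : v ∈ T.potentialWatershed Q
  · obtain ⟨R, hR, -, e⟩ := (h2 v hv).1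
    rw [← e]; exact hR v
  · rw [h1 v hv]; exact ⟨T.low_le_high v, le_rfl⟩

namespace IsCanonicalRealization

variable {Rbar : V → ℝ}

theorem isRealization (h : T.IsCanonicalRealization Q Rbar) : T.IsRealization Rbar :=
  (isCanonicalRealization_iff.1 h).1

theorem eq_high (h : T.IsCanonicalRealization Q Rbar) (hp : p ∉ T.potentialWatershed Q) :
    Rbar p = T.high p :=
  (isCanonicalRealization_iff.1 h).2.1 p hp

theorem le (h : T.IsCanonicalRealization Q Rbar) (hR : T.IsRealization R)
    (hp : p ∈ T.watershed R Q) : Rbar p ≤ R p :=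
  ((isCanonicalRealization_iff.1 h).2.2 p (mem_potentialWatershed.2 ⟨R, hR, hp⟩)).2
    ⟨R, hR, hp, rfl⟩

theorem exists_eq (h : T.IsCanonicalRealization Q Rbar) (hp : p ∈ T.potentialWatershed Q) :
    ∃ R, T.IsRealization R ∧ p ∈ T.watershed R Q ∧ R p = Rbar p :=
  ((isCanonicalRealization_iff.1 h).2.2 p hp).1

theorem eq_low (h : T.IsCanonicalRealization Q Rbar) (hq : q ∈ Q) : Rbar q = T.low q :=
  le_antisymm (h.le (R := T.low) (fun v => ⟨le_rfl, T.low_le_high v⟩)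
    (mem_watershed.2 ⟨q, hq, .refl⟩)) (h.isRealization q).1

/-- Take a realization `R` that attains the canonical elevation of `v`, and the node `w` that
follows `v` on a path to `Q` in `R`. Passing to `Rbar` does not raise `w`, for `R` also competes in
the minimum for `w`, and it does not lower any node outside the potential watershed, these being at
`high`. So `w` still beats all outside nodes. -/
theorem watershed_eq [Finite V] (h : T.IsCanonicalRealization Q Rbar) :
    T.watershed Rbar Q = T.potentialWatershed Q := by
  refine Set.Subset.antisymm (fun v hv => mem_potentialWatershed.2 ⟨_, h.isRealization, hv⟩) ?_
  -- The rank is the least number of steps to `Q` in a realization that is optimal for `v`. If `w`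
  -- is level with `v` in `Rbar`, the same realization is optimal for `w`, with one step fewer.
  let N : V → Set ℕ := fun v => {n | ∃ R, T.IsRealization R ∧ R v = Rbar v ∧ T.Reach R Q n v}
  refine exists_flowsTo_of_progress (fun v => sInf (N v)) fun v hv hvQ => ?_
  have hne : (N v).Nonempty := by
    obtain ⟨R, hR, hvR, e⟩ := h.exists_eq hv
    obtain ⟨n, hn⟩ := exists_reach hvR
    exact ⟨n, R, hR, e, hn⟩
  obtain ⟨R, hR, e, hn⟩ := Nat.sInf_mem hne
  generalize hm : sInf (N v) = n at hn
  cases n with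
  | zero => exact absurd hn hvQ
  | succ n =>
    obtain ⟨w, hs, hw⟩ := hn
    have hwR := h.le hR hw.mem_watershed
    refine ⟨w, mem_potentialWatershed.2 ⟨R, hR, hw.mem_watershed⟩, hs.adj,
      hwR.trans (hs.le.trans e.le), fun u hu hvu => ?_, fun e' => ?_⟩
    · refine (steep_mono hvu e.symm ?_).trans ((hs.steep_le hvu).trans (steep_mono hs.adj e hwR))
      rw [h.eq_high hu]; exact (hR u).2
    · have hwN : n ∈ N w := ⟨R, hR, ?_, hw⟩
      · exact (Nat.sInf_le hwN).trans_lt (by omega)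
      exact le_antisymm (hs.le.trans (e.trans e'.symm).le) hwR

/-- Water that reaches a node of the potential watershed from a node `p`, at no lower elevation
than the canonical one, may reach `Q`: `p` lies in the potential watershed. -/
theorem mem_and_le_of_flowsTo [Finite V] (h : T.IsCanonicalRealization Q Rbar)
    (hq : q ∈ T.potentialWatershed Q) (hR : T.IsRealization R) (hqR : Rbar q ≤ R q)
    (hpq : T.FlowsTo R p q) : p ∈ T.potentialWatershed Q ∧ Rbar p ≤ R p := by
  classical
  let W := T.watershed R {q}
  -- The overlay of the canonical realization with the part of `R` that drains to `q`.
  let R₂ : V → ℝ := fun v => if v ∈ W then min (Rbar v) (R v) else Rbar v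
  have hR₂ : ∀ v, R₂ v ≤ Rbar v := fun v => by
    simp only [R₂]; split_ifs
    exacts [min_le_left _ _, le_rfl]
  have hR₂W : ∀ v ∈ W, R₂ v ≤ R v := fun v hv => by
    simp only [R₂, if_pos hv]; exact min_le_right _ _
  have hreal : T.IsRealization R₂ := fun v => by
    have h1 := hR v
    have h2 := h.isRealization v
    simp only [R₂]; split_ifs
    · exact ⟨le_min h2.1 h1.1, (min_le_left _ _).trans h2.2⟩
    · exact h2
  let r₁ : V → ℕ := fun v => sInf {n | T.Reach Rbar Q n v}
  let r₂ : V → ℕ := fun v => sInf {n | T.Reach R {q} n v}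
  obtain ⟨M, hM⟩ := (Set.finite_range r₁).bddAbove
  -- Nodes at their canonical elevation follow `Rbar` towards `Q`; the others follow `R` towards `q`
  -- and rank above all of the former, since `M` bounds `r₁`. On a plateau a path may switch from
  -- `R` to `Rbar`, but not back.
  let rank : V → ℕ := fun v =>
    if v ∈ T.potentialWatershed Q ∧ R₂ v = Rbar v then r₁ v else M + 1 + r₂ v
  have key := exists_flowsTo_of_progress (T := T) (R := R₂) (Q := Q)
    (U := T.potentialWatershed Q ∪ W) rank fun v hv hvQ => by
    by_cases hc : v ∈ T.potentialWatershed Q ∧ R₂ v = Rbar v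
    · have hn : T.Reach Rbar Q (r₁ v) v := Nat.sInf_mem (exists_reach (h.watershed_eq ▸ hc.1))
      have hrv : rank v = r₁ v := if_pos hc
      cases hm : r₁ v with
      | zero => rw [hm] at hn; exact absurd hn hvQ
      | succ n =>
        rw [hm] at hn
        obtain ⟨w, hs, hw⟩ := hn
        have hwU : w ∈ T.potentialWatershed Q := h.watershed_eq ▸ hw.mem_watershed
        refine ⟨w, Or.inl hwU, hs.adj, (hR₂ w).trans (hs.le.trans hc.2.ge), fun u hu hvu => ?_,
          fun e => ?_⟩
        · refine (steep_mono hvu hc.2 ?_).trans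
            ((hs.steep_le hvu).trans (steep_mono hs.adj hc.2.symm (hR₂ w)))
          simp only [R₂]
          rw [if_neg fun h => hu (Or.inr h)]
        · have : R₂ w = Rbar w := le_antisymm (hR₂ w) (hs.le.trans (hc.2.symm.trans e.symm).le)
          have hrw : rank w = r₁ w := if_pos ⟨hwU, this⟩
          have : r₁ w ≤ n := Nat.sInf_le hw
          omega
    · have hvW : v ∈ W := by
        by_contra hvW
        exact hc ⟨hv.resolve_right hvW, if_neg hvW⟩
      -- If `Rbar v` were the smaller of the two, `v` would be at its canonical elevation inside the
      -- potential watershed, or `R v` would exceed `high v` outside it.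
      have e : R₂ v = R v := by
        simp only [R₂, if_pos hvW]
        refine min_eq_right ?_
        by_contra hlt
        push Not at hlt
        by_cases hvP : v ∈ T.potentialWatershed Q
        · refine hc ⟨hvP, ?_⟩
          simp only [R₂, if_pos hvW]
          exact min_eq_left hlt.le
        · rw [h.eq_high hvP] at hlt
          exact hlt.not_ge (hR v).2
      have hn : T.Reach R {q} (r₂ v) v := Nat.sInf_mem (exists_reach hvW)
      have hrv : rank v = M + 1 + r₂ v := if_neg hc
      cases hm : r₂ v with
      | zero =>
        rw [hm] at hn
        -- The path along `R` ends at `q`; there `Rbar q ≤ R q` makes `q` a node at its canonical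
        -- elevation, which is the other case.
        have hvq : v = q := hn
        refine (hc ⟨hvq ▸ hq, le_antisymm (hR₂ v) ?_⟩).elim
        rw [e, hvq]
        exact hqR
      | succ n =>
        rw [hm] at hn
        obtain ⟨w, hs, hw⟩ := hn
        have hwW : w ∈ W := hw.mem_watershed
        refine ⟨w, Or.inr hwW, hs.adj, (hR₂W w hwW).trans (hs.le.trans e.ge), fun u hu hvu => ?_,
          fun _ => ?_⟩
        · refine (steep_mono hvu e ?_).trans
            ((hs.steep_le hvu).trans (steep_mono hs.adj e.symm (hR₂W w hwW)))
          simp only [R₂]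
          rw [if_neg fun h => hu (Or.inr h), h.eq_high fun h => hu (Or.inl h)]
          exact (hR u).2
        · have h1 : r₂ w ≤ n := Nat.sInf_le hw
          have h2 : r₁ w ≤ M := hM ⟨w, rfl⟩
          have : rank w ≤ M + 1 + n := by
            simp only [rank]; split_ifs <;> omega
          omega
  have hpW : p ∈ W := mem_watershed.2 ⟨q, rfl, hpq⟩
  have hp := key p (Or.inr hpW)
  exact ⟨mem_potentialWatershed.2 ⟨R₂, hreal, hp⟩, (h.le hreal hp).trans (hR₂W p hpW)⟩

end IsCanonicalRealization

end ImpreciseTerrain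

namespace ImpreciseTerrain

variable {V : Type} {T : ImpreciseTerrain V} {R : V → ℝ} {p q : V}

/-! ### Runs of the algorithm -/

theorem mem_neighborhood_singleton : p ∈ T.neighborhood {q} ↔ T.graph.Adj p q := by
  simp only [neighborhood, Set.mem_ofPred_eq, Set.mem_singleton_iff, exists_eq_left]
  exact ⟨fun h => h.2, fun h => ⟨h.ne, h⟩⟩

/-- Turns a step in a concrete realization into a queue element that is at least as good. The
minimum exists because the flow condition and the bound on `R q` are both closed. -/
theorem exists_mem_expand [Finite V] {z : ℝ} (h : T.WaterStep R p q) (hR : T.IsRealization R)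
    (hz : z ≤ R q) : ∃ y, (p, y) ∈ T.expand q z ∧ y ≤ R p := by
  have hc : IsClosed ({R | R q ∈ Set.Icc z (T.high q)} ∩ {R | T.FlowsTo R p q}) :=
    (isClosed_Icc.preimage (continuous_apply q)).inter (isClosed_setOf_flowsTo p q)
  have hf : T.FlowsTo R p q := .single h
  obtain ⟨y, hy⟩ := exists_isLeast_elevation (T := T) hc ⟨R, ⟨⟨hz, (hR q).2⟩, hf⟩, hR⟩ p
  have : {y | ∃ R, T.IsRealization R ∧
      R ∈ {R : V → ℝ | R q ∈ Set.Icc z (T.high q)} ∩ {R | T.FlowsTo R p q} ∧ R p = y} =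
      {y | ∃ R, T.IsRealization R ∧ R q ∈ Set.Icc z (T.high q) ∧ T.FlowsTo R p q ∧ R p = y} := by
    ext y; simp only [Set.mem_inter_iff, Set.mem_ofPred_eq, and_assoc]
  rw [this] at hy
  exact ⟨y, ⟨mem_neighborhood_singleton.2 h.adj, hy⟩, hy.2 ⟨R, hR, ⟨hz, (hR q).2⟩, hf, rfl⟩⟩

/-- A minimum is unique. Hence an expansion enqueues at most one pair per neighbor, which makes it
finite and bounds the work. -/
theorem injOn_fst_expand (T : ImpreciseTerrain V) (q : V) (z : ℝ) :
    Set.InjOn Prod.fst (T.expand q z) := by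
  rintro ⟨a, x⟩ ⟨-, hx⟩ ⟨b, y⟩ ⟨-, hy⟩ (h : a = b)
  subst h
  exact Prod.ext rfl (hx.unique hy)

theorem finite_expand [Finite V] (T : ImpreciseTerrain V) (q : V) (z : ℝ) :
    (T.expand q z).Finite :=
  Set.Finite.of_finite_image (Set.toFinite _) (T.injOn_fst_expand q z)

variable {Q : Finset V} {Rbar : V → ℝ}

/-- What holds after every iteration of a run of `PotentialWS(Q)`. -/
structure RunInv (T : ImpreciseTerrain V) (Q : Finset V) (Rbar : V → ℝ)
    (S : Multiset (V × ℝ)) (L : List (V × ℝ)) : Prop where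
  queue : ∀ x ∈ S, x.1 ∈ T.potentialWatershed ↑Q ∧ Rbar x.1 ≤ x.2
  output : ∀ x ∈ L, x.1 ∈ T.potentialWatershed ↑Q ∧ x.2 = Rbar x.1
  nodup : (L.map Prod.fst).Nodup
  source : ∀ q ∈ Q, q ∉ L.map Prod.fst → (q, T.low q) ∈ S
  expanded : ∀ x ∈ L, ∀ y ∈ T.expand x.1 x.2, y.1 ∉ L.map Prod.fst → y ∈ S

/-- A node of the potential watershed that has not been output flows through a node at the front
of the search: a member of `Q`, or a node that flows on to an output node. -/
theorem exists_front {D : Set V}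
    (hp : p ∈ T.watershed Rbar ↑Q) (hpD : p ∉ D) : ∃ w, w ∉ D ∧ Rbar w ≤ Rbar p ∧
      (w ∈ Q ∨ ∃ u ∈ D, T.WaterStep Rbar w u) := by
  obtain ⟨q, hq, hf⟩ := mem_watershed.1 hp
  clear hp
  induction hf using Relation.ReflTransGen.head_induction_on with
  | refl => exact ⟨q, hpD, le_rfl, Or.inl hq⟩
  | @head a c hs _ ih =>
    by_cases hc : c ∈ D
    · exact ⟨a, hpD, le_rfl, Or.inr ⟨c, hc, hs⟩⟩
    · obtain ⟨w, hw, hle, h'⟩ := ih hc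
      exact ⟨w, hw, hle.trans hs.le, h'⟩

/-- Soundness of the queue: the realization behind a pair has `q` no lower than `Rbar` does, so
water from the neighbor may go on to `Q`. -/
theorem mem_and_le_of_mem_expand [Finite V] (h : T.IsCanonicalRealization ↑Q Rbar) {z : ℝ}
    (hq : q ∈ T.potentialWatershed ↑Q) (hz : Rbar q ≤ z) {x : V × ℝ} (hx : x ∈ T.expand q z) :
    x.1 ∈ T.potentialWatershed ↑Q ∧ Rbar x.1 ≤ x.2 := by
  obtain ⟨-, ⟨R, hR, hRq, hf, e⟩, -⟩ := hx
  rw [← e]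
  exact h.mem_and_le_of_flowsTo hq hR (hz.trans hRq.1) hf

/-- Completeness of the queue. Water never rises on its way from `p` to `Q` in `Rbar`, so the front
node `w` is at most as high as `p`. Either `w` is a source, or its step to an output node has
produced a pair no higher than `Rbar w`. -/
theorem RunInv.exists_le [Finite V] {S L} (h : T.IsCanonicalRealization ↑Q Rbar)
    (hI : RunInv T Q Rbar S L) (hp : p ∈ T.potentialWatershed ↑Q) (hpL : p ∉ L.map Prod.fst) :
    ∃ x ∈ S, x.1 ∉ L.map Prod.fst ∧ x.2 ≤ Rbar p := by
  obtain ⟨w, hw, hle, hw'⟩ :=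
    exists_front (D := {v | v ∈ L.map Prod.fst}) (h.watershed_eq ▸ hp) hpL
  rcases hw' with hwQ | ⟨u, hu, hs⟩
  · exact ⟨_, hI.source w hwQ hw, hw, (h.eq_low hwQ).ge.trans hle⟩
  · obtain ⟨⟨u', z⟩, hx, rfl⟩ := List.mem_map.1 hu
    have hz := (hI.output _ hx).2
    simp only at hz hs
    obtain ⟨y, hy, hle'⟩ := exists_mem_expand hs h.isRealization hz.le
    exact ⟨_, hI.expanded _ hx _ hy hw, hw, hle'.trans hle⟩

theorem PWSRun.inv [Finite V] (h : T.IsCanonicalRealization ↑Q Rbar) {k S L}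
    (hr : T.PWSRun Q k S L) : RunInv T Q Rbar S L := by
  have hsrc : ∀ q ∈ Q, q ∈ T.potentialWatershed ↑Q := fun q hq =>
    mem_potentialWatershed.2 ⟨_, h.isRealization, mem_watershed.2 ⟨q, hq, .refl⟩⟩
  induction hr with
  | init =>
    refine ⟨fun x hx => ?_, by simp, by simp, fun q hq _ => Multiset.mem_map.2 ⟨q, hq, rfl⟩,
      by simp⟩
    obtain ⟨q, hq, rfl⟩ := Multiset.mem_map.1 hx
    exact ⟨hsrc q hq, (h.eq_low hq).le⟩
  | discard q z _ hmin hq ih =>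
    refine ⟨fun x hx => ih.queue x (Multiset.mem_cons_of_mem hx), ih.output, ih.nodup,
      fun p hp hpL => ?_, fun x hx y hy hyL => ?_⟩
    · refine (Multiset.mem_cons.1 (ih.source p hp hpL)).resolve_left fun e => hpL ?_
      rw [show p = q from (Prod.ext_iff.1 e).1]; exact hq
    · refine (Multiset.mem_cons.1 (ih.expanded x hx y hy hyL)).resolve_left fun e => hyL ?_
      rw [e]; exact hq
  | @output k S L q z E _ hmin hq hE ih =>
    have hqz := ih.queue (q, z) (Multiset.mem_cons_self _ _)
    -- As for Dijkstra's algorithm: soundness gives `Rbar q ≤ z`, and completeness gives some pair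
    -- not above `Rbar q`, which the minimum `z` does not exceed.
    have hz : z = Rbar q := by
      refine le_antisymm ?_ hqz.2
      obtain ⟨x, hx, -, hle⟩ := ih.exists_le h hqz.1 hq
      rcases Multiset.mem_cons.1 hx with rfl | hx
      · exact hle
      · exact (hmin x hx).trans hle
    have hEm : ∀ x, x ∈ E.val ↔ x ∈ T.expand q z := fun x => by
      rw [← hE]; rfl
    have hout : ∀ p, p ∉ (L ++ [(q, z)]).map Prod.fst → p ∉ L.map Prod.fst ∧ p ≠ q := by
      intro p hp
      simpa only [List.map_append, List.mem_append, not_or, List.map_cons, List.map_nil,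
        List.mem_singleton] using hp
    refine ⟨fun x hx => ?_, fun x hx => ?_, ?_, fun p hp hpL => ?_, fun x hx y hy hyL => ?_⟩
    · rcases Multiset.mem_add.1 hx with hx | hx
      · exact ih.queue x (Multiset.mem_cons_of_mem hx)
      · exact mem_and_le_of_mem_expand h hqz.1 hz.ge ((hEm x).1 hx)
    · rcases List.mem_append.1 hx with hx | hx
      · exact ih.output x hx
      · rw [List.mem_singleton.1 hx]; exact ⟨hqz.1, hz⟩
    · rw [List.map_append, List.nodup_append]
      refine ⟨ih.nodup, by simp, fun a ha b hb e => hq ?_⟩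
      simp only [List.map_cons, List.map_nil, List.mem_singleton] at hb
      rw [← hb, ← e]; exact ha
    · obtain ⟨h1, h2⟩ := hout p hpL
      refine Multiset.mem_add.2 (Or.inl ?_)
      exact (Multiset.mem_cons.1 (ih.source p hp h1)).resolve_left fun e =>
        h2 (Prod.ext_iff.1 e).1
    · obtain ⟨h1, h2⟩ := hout y.1 hyL
      rcases List.mem_append.1 hx with hx | hx
      · refine Multiset.mem_add.2 (Or.inl ?_)
        exact (Multiset.mem_cons.1 (ih.expanded x hx y hy h1)).resolve_left fun e => h2 (e ▸ rfl)
      · rw [List.mem_singleton.1 hx] at hy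
        exact Multiset.mem_add.2 (Or.inr ((hEm y).2 hy))

/-- The number of neighbors of a node. -/
noncomputable def deg (T : ImpreciseTerrain V) (v : V) : ℕ := {w | T.graph.Adj w v}.ncard

theorem sum_deg [Fintype V] (T : ImpreciseTerrain V) : ∑ v, T.deg v = 2 * T.numEdges := by
  classical
  have h := T.graph.sum_degrees_eq_twice_card_edges
  rw [numEdges, ← SimpleGraph.coe_edgeFinset, Set.ncard_coe_finset, ← h]
  refine Finset.sum_congr rfl fun v _ => ?_
  rw [deg, ← SimpleGraph.card_neighborFinset_eq_degree, ← Set.ncard_coe_finset]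
  congr 1
  ext w
  simp [SimpleGraph.adj_comm]

theorem card_le_deg [Finite V] {z : ℝ} {E : Finset (V × ℝ)} (hE : (E : Set (V × ℝ)) = T.expand q z) :
    E.card ≤ T.deg q := by
  rw [deg, ← Set.ncard_coe_finset]
  refine Set.ncard_le_ncard_of_injOn Prod.fst (fun x hx => ?_) (hE ▸ T.injOn_fst_expand q z)
    (Set.toFinite _)
  rw [hE] at hx
  exact mem_neighborhood_singleton.1 hx.1

/-- Every iteration consumes one pair, and an output creates at most as many as its node has
neighbors. So the sources and the degrees of the output nodes pay for the past iterations and the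
present queue. -/
theorem PWSRun.add_card_le [Finite V] {k S L} (hr : T.PWSRun Q k S L) :
    k + S.card ≤ Q.card + ((L.map Prod.fst).map T.deg).sum := by
  induction hr with
  | init => simp
  | discard q z _ _ _ ih => rw [Multiset.card_cons] at ih; omega
  | @output k S L q z E _ _ _ hE ih =>
    have := card_le_deg hE
    have hc : Multiset.card E.val = E.card := rfl
    simp only [Multiset.card_cons] at ih
    simp only [Multiset.card_add, List.map_append, List.map_cons, List.map_nil, List.sum_append,
      List.sum_cons, List.sum_nil]
    omega

theorem PWSRun.le [Fintype V] (h : T.IsCanonicalRealization ↑Q Rbar) {k S L}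
    (hr : T.PWSRun Q k S L) : k ≤ Q.card + 2 * T.numEdges := by
  classical
  have h1 := hr.add_card_le
  -- No node is output twice, so each degree counts at most once.
  have h2 : ((L.map Prod.fst).map T.deg).sum ≤ 2 * T.numEdges := by
    rw [← List.sum_toFinset T.deg (hr.inv h).nodup, ← T.sum_deg]
    exact Finset.sum_le_sum_of_subset (Finset.subset_univ _)
  omega

theorem exists_min_cons {S : Multiset (V × ℝ)} (hS : S ≠ 0) :
    ∃ x S', S = x ::ₘ S' ∧ ∀ y ∈ S', x.2 ≤ y.2 := by
  classical
  obtain ⟨x, hx, hmin⟩ := Finset.exists_min_image S.toFinset Prod.snd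
    (Multiset.toFinset_nonempty.2 hS)
  refine ⟨x, S.erase x, (Multiset.cons_erase (Multiset.mem_toFinset.1 hx)).symm, fun y hy => ?_⟩
  exact hmin y (Multiset.mem_toFinset.2 (Multiset.mem_of_mem_erase hy))

/-- If all nodes of the potential watershed have been output, the queue can be emptied. -/
theorem PWSRun.finish [Finite V] (h : T.IsCanonicalRealization ↑Q Rbar) {k S L}
    (hr : T.PWSRun Q k S L) (hL : ∀ v ∈ T.potentialWatershed ↑Q, v ∈ L.map Prod.fst) :
    T.PotentialWSOutputs Q L := by
  induction hc : S.card generalizing k S with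
  | zero => rw [Multiset.card_eq_zero.1 hc] at hr; exact ⟨k, hr⟩
  | succ n ih =>
    have hS : S ≠ 0 := by rintro rfl; simp at hc
    obtain ⟨⟨q, z⟩, S', rfl, hmin⟩ := exists_min_cons hS
    rw [Multiset.card_cons] at hc
    refine ih (hr.discard q z hmin (hL q ?_)) (by omega)
    exact ((hr.inv h).queue _ (Multiset.mem_cons_self _ _)).1

/-- A queue element with the correct elevation can be output, after superfluous elements have been
discarded, if no node of the potential watershed that is still missing is lower. -/
theorem PWSRun.extend [Finite V] (h : T.IsCanonicalRealization ↑Q Rbar) {k S L}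
    (hr : T.PWSRun Q k S L) (hpL : p ∉ L.map Prod.fst) (hpS : (p, Rbar p) ∈ S)
    (hmin : ∀ v ∈ T.potentialWatershed ↑Q, v ∉ L.map Prod.fst → Rbar p ≤ Rbar v) :
    ∃ k' S', T.PWSRun Q k' S' (L ++ [(p, Rbar p)]) := by
  classical
  induction hc : S.card generalizing k S with
  | zero => rw [Multiset.card_eq_zero.1 hc] at hpS; simp at hpS
  | succ n ih =>
    have hS : S ≠ 0 := by rintro rfl; simp at hc
    by_cases hle : ∀ x ∈ S, Rbar p ≤ x.2
    · rw [← Multiset.cons_erase hpS] at hr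
      exact ⟨_, _, hr.output p (Rbar p) (T.finite_expand p (Rbar p)).toFinset
        (fun x hx => hle x (Multiset.mem_of_mem_erase hx)) hpL (Set.Finite.coe_toFinset _)⟩
    · push Not at hle
      obtain ⟨y, hy, hlt⟩ := hle
      obtain ⟨⟨q, z⟩, S', rfl, hmin'⟩ := exists_min_cons hS
      rw [Multiset.card_cons] at hc
      have hz : z < Rbar p := by
        rcases Multiset.mem_cons.1 hy with rfl | hy
        · exact hlt
        · exact (hmin' y hy).trans_lt hlt
      obtain ⟨h1, h2⟩ := (hr.inv h).queue _ (Multiset.mem_cons_self _ _)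
      -- A pair below `Rbar p` cannot belong to a missing node, since no missing node has a
      -- canonical elevation below `Rbar p`.
      have hqL : q ∈ L.map Prod.fst := by
        by_contra hqL
        exact ((hmin q h1 hqL).trans h2).not_gt hz
      refine ih (hr.discard q z hmin' hqL) ?_ (by omega)
      refine (Multiset.mem_cons.1 hpS).resolve_left fun e => hz.ne ?_
      exact (Prod.ext_iff.1 e).2.symm

/-- A run with a nonempty queue can always be continued, so if no run ever emptied its queue, there
would be runs of any length, against the bound on iterations. -/
theorem exists_potentialWSOutputs [Fintype V] (h : T.IsCanonicalRealization ↑Q Rbar) :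
    ∃ L, T.PotentialWSOutputs Q L := by
  by_contra hno
  push Not at hno
  have step : ∀ n, ∃ k S L, T.PWSRun Q k S L ∧ n ≤ k := by
    intro n
    induction n with
    | zero => exact ⟨_, _, _, .init, le_rfl⟩
    | succ n ih =>
      obtain ⟨k, S, L, hr, hk⟩ := ih
      have hS : S ≠ 0 := by rintro rfl; exact hno L ⟨k, hr⟩
      obtain ⟨⟨q, z⟩, S', rfl, hmin⟩ := exists_min_cons hS
      by_cases hq : q ∈ L.map Prod.fst
      · exact ⟨_, _, _, hr.discard q z hmin hq, by omega⟩
      · exact ⟨_, _, _, hr.output q z (T.finite_expand q z).toFinset hmin hq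
          (Set.Finite.coe_toFinset _), by omega⟩
  obtain ⟨k, S, L, hr, hk⟩ := step (Q.card + 2 * T.numEdges + 1)
  have := hr.le h
  omega

theorem potentialWSOutputs_spec [Fintype V] (h : T.IsCanonicalRealization ↑Q Rbar)
    {L : List (V × ℝ)} (hL : T.PotentialWSOutputs Q L) : (L.map Prod.fst).Nodup ∧
      {p | p ∈ L.map Prod.fst} = T.potentialWatershed ↑Q ∧ ∀ x ∈ L, x.2 = Rbar x.1 := by
  obtain ⟨k, hr⟩ := hL
  have hI := hr.inv h
  refine ⟨hI.nodup, Set.Subset.antisymm (fun p hp => ?_) fun p hp => ?_, fun x hx =>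
    (hI.output x hx).2⟩
  · obtain ⟨x, hx, rfl⟩ := List.mem_map.1 hp
    exact (hI.output x hx).1
  · by_contra hpL
    obtain ⟨x, hx, -⟩ := hI.exists_le h hp hpL
    simp at hx

end ImpreciseTerrain

namespace ImpreciseTerrain

variable {V : Type} {T : ImpreciseTerrain V} {R : V → ℝ} {p q : V}

/-! ### Expansion along a single edge -/

/-- The elevations at which `p` can have `q` as a steepest descent neighbor when `q` has
elevation `z`. -/
def edgeExpand (T : ImpreciseTerrain V) (p q : V) (z : ℝ) : Set ℝ :=
  {y | T.low p ≤ y ∧ z ≤ y ∧ y ≤ T.high p ∧ ∀ r, T.graph.Adj p r →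
    (y - T.high r) / dist (T.pos p) (T.pos r) ≤ (y - z) / dist (T.pos p) (T.pos q)}

/-- Raising the competitors to `high` makes them less steep, and lowering `q` to `z` makes `q`
steeper. -/
theorem WaterStep.mem_edgeExpand {z : ℝ} (h : T.WaterStep R p q) (hR : T.IsRealization R)
    (hz : z ≤ R q) : R p ∈ T.edgeExpand p q z := by
  refine ⟨(hR p).1, hz.trans h.le, (hR p).2, fun r hr => ?_⟩
  have h1 := h.steep_le hr
  have h2 := dist_pos_of_adj hr
  have h3 := dist_pos_of_adj h.adj
  unfold steep at h1
  calc (R p - T.high r) / dist (T.pos p) (T.pos r) ≤ (R p - R r) / dist (T.pos p) (T.pos r) := by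
        have := (hR r).2
        gcongr
    _ ≤ (R p - R q) / dist (T.pos p) (T.pos q) := h1
    _ ≤ _ := by gcongr

/-- The inequalities in `edgeExpand` describe exactly the most favorable realization: everything at
`high`, except for `p` and `q`. -/
theorem exists_waterStep_of_mem_edgeExpand {y z : ℝ} (hpq : T.graph.Adj p q)
    (hy : y ∈ T.edgeExpand p q z) (hl : T.low q ≤ z) (hh : z ≤ T.high q) :
    ∃ R, T.IsRealization R ∧ R p = y ∧ R q = z ∧ T.WaterStep R p q := by
  classical
  obtain ⟨h1, h2, h3, h4⟩ := hy
  have hRp : Function.update (Function.update T.high q z) p y p = y := Function.update_self ..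
  have hRq : Function.update (Function.update T.high q z) p y q = z := by
    rw [Function.update_of_ne hpq.ne', Function.update_self]
  refine ⟨Function.update (Function.update T.high q z) p y, fun v => ?_, hRp, hRq,
    waterStep_iff.2 ⟨hpq, ?_, fun r hr => ?_⟩⟩
  · by_cases hv : v = p
    · subst hv; rw [hRp]; exact ⟨h1, h3⟩
    by_cases hv' : v = q
    · subst hv'; rw [hRq]; exact ⟨hl, hh⟩
    rw [Function.update_of_ne hv, Function.update_of_ne hv']
    exact ⟨T.low_le_high v, le_rfl⟩
  · rw [steep_nonneg_iff hpq, hRp, hRq]; exact h2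
  · by_cases hr' : r = q
    · rw [hr']
    rw [steep, steep, hRp, hRq, Function.update_of_ne hr.ne', Function.update_of_ne hr']
    exact h4 r hr

variable {Q : Finset V} {Rbar : V → ℝ}

theorem IsCanonicalRealization.mem_and_le_of_mem_edgeExpand [Finite V]
    (h : T.IsCanonicalRealization ↑Q Rbar) (hq : q ∈ T.potentialWatershed ↑Q)
    (hpq : T.graph.Adj p q) {y : ℝ} (hy : y ∈ T.edgeExpand p q (Rbar q)) :
    p ∈ T.potentialWatershed ↑Q ∧ Rbar p ≤ y := by
  have hb := h.isRealization q
  obtain ⟨R, hR, e, e', hs⟩ := exists_waterStep_of_mem_edgeExpand hpq hy hb.1 hb.2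
  rw [← e]
  exact h.mem_and_le_of_flowsTo hq hR e'.ge (.single hs)

/-- The state of a search that keeps, for every node, the best elevation known so far, and `M`
for nodes that have not been reached or have already been output. -/
structure SearchInv (T : ImpreciseTerrain V) (Q : Finset V) (M : ℝ) (key : V → ℝ)
    (L : List (V × ℝ)) : Prop where
  run : ∃ k S, T.PWSRun Q k S L
  done : ∀ v ∈ L.map Prod.fst, key v = M
  origin : ∀ v, key v < M → (v ∈ Q ∧ key v = T.low v) ∨
    ∃ x ∈ L, T.graph.Adj v x.1 ∧ key v ∈ T.edgeExpand v x.1 x.2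
  source : ∀ v ∈ Q, v ∉ L.map Prod.fst → key v ≤ T.low v
  expanded : ∀ x ∈ L, ∀ v, T.graph.Adj v x.1 → v ∉ L.map Prod.fst →
    ∀ y ∈ T.edgeExpand v x.1 x.2, key v ≤ y

namespace SearchInv

variable {M : ℝ} {key : V → ℝ} {L : List (V × ℝ)}

/-- Completeness of the keys. The front node reaches an output node in a single step, so expansion
along edges suffices where the algorithm considers flow of any length. -/
theorem key_le [Finite V] (hS : SearchInv T Q M key L) (h : T.IsCanonicalRealization ↑Q Rbar)
    {v : V} (hv : v ∈ T.potentialWatershed ↑Q) (hvL : v ∉ L.map Prod.fst) :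
    ∃ w, w ∉ L.map Prod.fst ∧ key w ≤ Rbar v := by
  obtain ⟨k, S, hr⟩ := hS.run
  obtain ⟨w, hw, hle, hw'⟩ :=
    exists_front (D := {v | v ∈ L.map Prod.fst}) (h.watershed_eq ▸ hv) hvL
  refine ⟨w, hw, ?_⟩
  rcases hw' with hwQ | ⟨u, hu, hs⟩
  · exact (hS.source w hwQ hw).trans ((h.eq_low hwQ).ge.trans hle)
  · obtain ⟨⟨u', z⟩, hx, rfl⟩ := List.mem_map.1 hu
    have hz := ((hr.inv h).output _ hx).2
    simp only at hz hs
    exact (hS.expanded _ hx w hs.adj hw _ (hs.mem_edgeExpand h.isRealization hz.le)).trans hle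

/-- Soundness of the keys: a key below `M` comes from a source or from a realizable step into an
output node. -/
theorem mem_and_le [Finite V] (hS : SearchInv T Q M key L) (h : T.IsCanonicalRealization ↑Q Rbar)
    {v : V} (hv : key v < M) : v ∈ T.potentialWatershed ↑Q ∧ Rbar v ≤ key v := by
  obtain ⟨k, S, hr⟩ := hS.run
  rcases hS.origin v hv with ⟨h1, h2⟩ | ⟨x, hx, hadj, hy⟩
  · rw [h2]
    exact ⟨mem_potentialWatershed.2 ⟨_, h.isRealization, mem_watershed.2 ⟨v, h1, .refl⟩⟩,
      (h.eq_low h1).le⟩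
  · obtain ⟨h1, h2⟩ := (hr.inv h).output x hx
    rw [h2] at hy
    exact h.mem_and_le_of_mem_edgeExpand h1 hadj hy

theorem key_eq [Finite V] (hS : SearchInv T Q M key L) (h : T.IsCanonicalRealization ↑Q Rbar)
    {v : V} (hv : key v < M) (hmin : ∀ w, key v ≤ key w) : key v = Rbar v := by
  obtain ⟨h1, h2⟩ := hS.mem_and_le h hv
  obtain ⟨w, -, hw⟩ := hS.key_le h h1 fun hvL => hv.ne (hS.done v hvL)
  exact le_antisymm ((hmin w).trans hw) h2

/-- The step of the search: output a node of minimum key and update the keys of its neighbors. -/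
theorem step [Finite V] (hS : SearchInv T Q M key L) {v : V} (hv : key v < M)
    (hmin : ∀ w, key v ≤ key w) {key' : V → ℝ} (hv' : key' v = M)
    (hdone : ∀ u ∈ L.map Prod.fst, key' u = M)
    (hle : ∀ u, u ≠ v → key' u ≤ key u)
    (hnew : ∀ u, u ≠ v → key' u ≠ key u →
      T.graph.Adj u v ∧ key' u ∈ T.edgeExpand u v (key v))
    (hexp : ∀ u, T.graph.Adj u v → u ∉ L.map Prod.fst → ∀ y ∈ T.edgeExpand u v (key v),
      key' u ≤ y) :
    SearchInv T Q M key' (L ++ [(v, key v)]) := by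
  obtain ⟨Rbar, h⟩ := T.exists_isCanonicalRealization (Q : Set V)
  obtain ⟨k, S, hr⟩ := hS.run
  have hI := hr.inv h
  have hvL : v ∉ L.map Prod.fst := fun hvL => hv.ne (hS.done v hvL)
  have hkey := hS.key_eq h hv hmin
  -- Keys come from single steps and queue elements from flow of any length, but they meet here: the
  -- queue has a pair for `v` not above `key v`, which is the canonical elevation, and no pair lies
  -- below the canonical elevation.
  have hvS : (v, Rbar v) ∈ S := by
    rcases hS.origin v hv with ⟨h1, h2⟩ | ⟨x, hx, hadj, hy⟩
    · rw [h.eq_low h1]; exact hI.source v h1 hvL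
    · obtain ⟨h1, h2⟩ := hI.output x hx
      have hb := h.isRealization x.1
      rw [← h2] at hb
      obtain ⟨R, hR, e, e', hs⟩ := exists_waterStep_of_mem_edgeExpand hadj hy hb.1 hb.2
      obtain ⟨y, hy, hle⟩ := exists_mem_expand hs hR e'.ge
      have hyR := (mem_and_le_of_mem_expand h h1 h2.ge hy).2
      rw [e, hkey] at hle
      rw [le_antisymm hyR hle]
      exact hI.expanded x hx _ hy hvL
  have hmem : ∀ u, u ∈ (L ++ [(v, key v)]).map Prod.fst ↔ u ∈ L.map Prod.fst ∨ u = v := fun u => by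
    rw [List.map_append, List.mem_append, List.map_singleton, List.mem_singleton]
  refine ⟨?_, fun u hu => ?_, fun u hu => ?_, fun u hu huL => ?_, fun x hx u hux huL y hy => ?_⟩
  · rw [hkey]
    refine hr.extend h hvL hvS fun w hw hwL => ?_
    obtain ⟨w', -, hw'⟩ := hS.key_le h hw hwL
    rw [← hkey]
    exact (hmin w').trans hw'
  · rcases (hmem u).1 hu with hu | rfl
    exacts [hdone u hu, hv']
  · have huv : u ≠ v := by rintro rfl; exact hu.ne hv'
    by_cases e : key' u = key u
    · rw [e] at hu ⊢
      refine (hS.origin u hu).imp_right fun ⟨x, hx, h'⟩ => ⟨x, List.mem_append_left _ hx, h'⟩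
    · exact Or.inr ⟨_, List.mem_append_right _ (List.mem_singleton_self _), hnew u huv e⟩
  · rw [hmem, not_or] at huL
    exact (hle u huL.2).trans (hS.source u hu huL.1)
  · rw [hmem, not_or] at huL
    rcases List.mem_append.1 hx with hx | hx
    · exact (hle u huL.2).trans (hS.expanded x hx u hux huL.1 y hy)
    · rw [List.mem_singleton.1 hx] at hux hy
      exact hexp u hux huL.1 y hy

theorem init (hkey : ∀ v ∈ Q, key v = T.low v)
    (hkey' : ∀ v, v ∉ Q → key v = M) : SearchInv T Q M key [] := by
  refine ⟨⟨_, _, .init⟩, by simp, fun v hv => Or.inl ?_, fun v hv _ => (hkey v hv).le, by simp⟩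
  have : v ∈ Q := by
    by_contra hvQ
    exact hv.ne (hkey' v hvQ)
  exact ⟨this, hkey v this⟩

/-- As `M` exceeds all legal elevations, a missing node would force some key below `M`. -/
theorem finish [Finite V] (hS : SearchInv T Q M key L) (hM : ∀ v, T.high v < M)
    (hmin : ∀ v, M ≤ key v) : T.PotentialWSOutputs Q L := by
  obtain ⟨Rbar, h⟩ := T.exists_isCanonicalRealization (Q : Set V)
  obtain ⟨k, S, hr⟩ := hS.run
  refine hr.finish h fun v hv => by_contra fun hvL => ?_
  obtain ⟨w, -, hw⟩ := hS.key_le h hv hvL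
  exact ((hmin w).trans (hw.trans (h.isRealization v).2)).not_gt (hM v)

end SearchInv

theorem potentialWSOutputs_isCanonicalRealization [Fintype V] {L : List (V × ℝ)}
    (hL : T.PotentialWSOutputs Q L) {E : V → ℝ} (hE : ∀ x ∈ L, E x.1 = x.2)
    (hE' : ∀ v, v ∉ L.map Prod.fst → E v = T.high v) : T.IsCanonicalRealization ↑Q E := by
  obtain ⟨Rbar, h⟩ := T.exists_isCanonicalRealization (Q : Set V)
  obtain ⟨-, h1, h2⟩ := potentialWSOutputs_spec h hL
  suffices E = Rbar by rwa [this]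
  funext v
  by_cases hv : v ∈ L.map Prod.fst
  · obtain ⟨x, hx, rfl⟩ := List.mem_map.1 hv
    rw [hE x hx, h2 x hx]
  · rw [hE' v hv, h.eq_high]
    rwa [← h1]

end ImpreciseTerrain

namespace RealRAM

/-! ### Reasoning about programs -/

/-- The integer registers assigned by a program. -/
def Cmd.iregs : Cmd → List ℕ
  | .iset x _ => [x]
  | .seq c d => c.iregs ++ d.iregs
  | .ite _ c d => c.iregs ++ d.iregs
  | .loop _ c => c.iregs
  | _ => []

/-- The real registers assigned by a program. -/
def Cmd.rregs : Cmd → List ℕ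
  | .rset x _ => [x]
  | .seq c d => c.rregs ++ d.rregs
  | .ite _ c d => c.rregs ++ d.rregs
  | .loop _ c => c.rregs
  | _ => []

/-- The integer arrays written by a program. -/
def Cmd.iarrs : Cmd → List ℕ
  | .iwrite a _ _ => [a]
  | .seq c d => c.iarrs ++ d.iarrs
  | .ite _ c d => c.iarrs ++ d.iarrs
  | .loop _ c => c.iarrs
  | _ => []

/-- The real arrays written by a program. -/
def Cmd.rarrs : Cmd → List ℕ
  | .rwrite a _ _ => [a]
  | .seq c d => c.rarrs ++ d.rarrs
  | .ite _ c d => c.rarrs ++ d.rarrs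
  | .loop _ c => c.rarrs
  | _ => []

/-- `s'` agrees with `s` outside the part of the memory that `c` may modify. -/
structure Frame (c : Cmd) (s s' : Store) : Prop where
  ireg : ∀ x, x ∉ c.iregs → s'.ireg x = s.ireg x
  rreg : ∀ x, x ∉ c.rregs → s'.rreg x = s.rreg x
  iarr : ∀ a, a ∉ c.iarrs → s'.iarr a = s.iarr a
  rarr : ∀ a, a ∉ c.rarrs → s'.rarr a = s.rarr a

theorem Frame.refl (c : Cmd) (s : Store) : Frame c s s :=
  ⟨fun _ _ => rfl, fun _ _ => rfl, fun _ _ => rfl, fun _ _ => rfl⟩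

theorem Frame.trans {c : Cmd} {s s' s'' : Store} (h : Frame c s s') (h' : Frame c s' s'') :
    Frame c s s'' :=
  ⟨fun x hx => (h'.ireg x hx).trans (h.ireg x hx), fun x hx => (h'.rreg x hx).trans (h.rreg x hx),
    fun x hx => (h'.iarr x hx).trans (h.iarr x hx), fun x hx => (h'.rarr x hx).trans (h.rarr x hx)⟩

theorem Frame.mono {c d : Cmd} {s s' : Store} (h : Frame c s s') (h1 : c.iregs ⊆ d.iregs)
    (h2 : c.rregs ⊆ d.rregs) (h3 : c.iarrs ⊆ d.iarrs) (h4 : c.rarrs ⊆ d.rarrs) : Frame d s s' :=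
  ⟨fun x hx => h.ireg x fun hc => hx (h1 hc), fun x hx => h.rreg x fun hc => hx (h2 hc),
    fun x hx => h.iarr x fun hc => hx (h3 hc), fun x hx => h.rarr x fun hc => hx (h4 hc)⟩

/-- With this syntactic frame rule a specification has to mention only what changes; that a register
or array is preserved follows by deciding membership in a list. -/
theorem Exec.frame {B : ℕ} {c : Cmd} {s s' : Store} {t : ℕ} (h : Exec B c s t s') :
    Frame c s s' := by
  induction h with
  | skip => exact Frame.refl _ _
  | iset s x e _ =>
    refine ⟨fun y hy => ?_, fun _ _ => rfl, fun _ _ => rfl, fun _ _ => rfl⟩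
    exact Function.update_of_ne (by simpa [Cmd.iregs] using hy) ..
  | rset s x e _ =>
    refine ⟨fun _ _ => rfl, fun y hy => ?_, fun _ _ => rfl, fun _ _ => rfl⟩
    exact Function.update_of_ne (by simpa [Cmd.rregs] using hy) ..
  | iwrite s a i e _ _ =>
    refine ⟨fun _ _ => rfl, fun _ _ => rfl, fun y hy => ?_, fun _ _ => rfl⟩
    exact Function.update_of_ne (by simpa [Cmd.iarrs] using hy) ..
  | rwrite s a i e _ _ =>
    refine ⟨fun _ _ => rfl, fun _ _ => rfl, fun _ _ => rfl, fun y hy => ?_⟩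
    exact Function.update_of_ne (by simpa [Cmd.rarrs] using hy) ..
  | seq _ _ ih ih' =>
    exact (ih.mono (List.subset_append_left _ _) (List.subset_append_left _ _)
      (List.subset_append_left _ _) (List.subset_append_left _ _)).trans
      (ih'.mono (List.subset_append_right _ _) (List.subset_append_right _ _)
        (List.subset_append_right _ _) (List.subset_append_right _ _))
  | ite_true _ _ _ ih =>
    exact ih.mono (List.subset_append_left _ _) (List.subset_append_left _ _)
      (List.subset_append_left _ _) (List.subset_append_left _ _)
  | ite_false _ _ _ ih =>
    exact ih.mono (List.subset_append_right _ _) (List.subset_append_right _ _)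
      (List.subset_append_right _ _) (List.subset_append_right _ _)
  | loop_false => exact Frame.refl _ _
  | loop_true _ _ _ _ ih ih' => exact Frame.trans ⟨ih.1, ih.2, ih.3, ih.4⟩ ih'

/-- Started in `s`, the program `c` halts within `k` steps in a store that satisfies `Q`. -/
def Run (B : ℕ) (c : Cmd) (s : Store) (k : ℕ) (Q : Store → Prop) : Prop :=
  ∃ t s', Exec B c s t s' ∧ t ≤ k ∧ Q s'

namespace Run

variable {B : ℕ} {c d : Cmd} {s : Store} {k k' : ℕ} {Q Q' : Store → Prop}

theorem mono (h : Run B c s k Q) (hk : k ≤ k') (hQ : ∀ s', Frame c s s' → Q s' → Q' s') :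
    Run B c s k' Q' := by
  obtain ⟨t, s', he, ht, hs⟩ := h
  exact ⟨t, s', he, ht.trans hk, hQ s' he.frame hs⟩

theorem seq {k'' : ℕ} (h : Run B c s k fun s' => Run B d s' k' Q) (hk : k + k' ≤ k'') :
    Run B (.seq c d) s k'' Q := by
  obtain ⟨t, s', he, ht, t', s'', he', ht', hs⟩ := h
  exact ⟨_, s'', .seq he he', (Nat.add_le_add ht ht').trans hk, hs⟩

theorem ite {b : BExp} (hb : b.Ok B s) (h1 : b.Holds s → Run B c s k Q)
    (h2 : ¬ b.Holds s → Run B d s k Q) : Run B (.ite b c d) s (b.cost + k + 1) Q := by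
  by_cases h : b.Holds s
  · obtain ⟨t, s', he, ht, hs⟩ := h1 h
    exact ⟨_, s', .ite_true hb h he, by omega, hs⟩
  · obtain ⟨t, s', he, ht, hs⟩ := h2 h
    exact ⟨_, s', .ite_false hb h he, by omega, hs⟩

/-- A loop with invariant `I` whose total cost is paid for by the potential `pot`. -/
theorem loop {b : BExp} (I : Store → Prop) (pot : Store → ℕ) (h0 : I s)
    (hok : ∀ s', Frame c s s' → I s' → b.Ok B s')
    (h : ∀ s', Frame c s s' → I s' → b.Holds s' → ∃ k, Run B c s' k fun s'' =>
      I s'' ∧ k + b.cost + 1 + pot s'' ≤ pot s') :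
    Run B (.loop b c) s (pot s + b.cost + 1) fun s' => I s' ∧ ¬ b.Holds s' := by
  suffices ∀ n s', Frame c s s' → I s' → pot s' ≤ n →
      Run B (.loop b c) s' (pot s' + b.cost + 1) fun s' => I s' ∧ ¬ b.Holds s' from
    this _ s (.refl _ _) h0 le_rfl
  intro n
  induction n with
  | zero =>
    intro s' hF hI hp
    by_cases hb : b.Holds s'
    · obtain ⟨k, t, s'', -, -, -, hle⟩ := h s' hF hI hb
      omega
    · exact ⟨_, s', .loop_false (hok s' hF hI) hb, by omega, hI, hb⟩
  | succ n ih =>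
    intro s' hF hI hp
    by_cases hb : b.Holds s'
    · obtain ⟨k, t, s'', he, ht, hI'', hle⟩ := h s' hF hI hb
      obtain ⟨t', s₃, he', ht', hs⟩ := ih s'' (hF.trans he.frame) hI'' (by omega)
      exact ⟨_, s₃, .loop_true (hok s' hF hI) hb he he', by omega, hs⟩
    · exact ⟨_, s', .loop_false (hok s' hF hI) hb, by omega, hI, hb⟩

end Run

/-- Weakest precondition of a program without loops. -/
def Cmd.wp (B : ℕ) : Cmd → Store → (Store → Prop) → Prop
  | .skip, s, Q => Q s
  | .iset x e, s, Q => e.Ok B s ∧ Q { s with ireg := Function.update s.ireg x (e.eval s) }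
  | .rset x e, s, Q => e.Ok B s ∧ Q { s with rreg := Function.update s.rreg x (e.eval s) }
  | .iwrite a i e, s, Q => i.Ok B s ∧ e.Ok B s ∧
      Q { s with
        iarr := Function.update s.iarr a (Function.update (s.iarr a) (i.eval s) (e.eval s)) }
  | .rwrite a i e, s, Q => i.Ok B s ∧ e.Ok B s ∧
      Q { s with
        rarr := Function.update s.rarr a (Function.update (s.rarr a) (i.eval s) (e.eval s)) }
  | .seq c d, s, Q => Cmd.wp B c s fun s' => Cmd.wp B d s' Q
  | .ite b c d, s, Q => b.Ok B s ∧ (b.Holds s → Cmd.wp B c s Q) ∧ (¬ b.Holds s → Cmd.wp B d s Q)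
  | .loop _ _, _, _ => False

/-- A bound for the running time of a program without loops. -/
def Cmd.time : Cmd → ℕ
  | .skip => 1
  | .iset _ e => e.cost + 1
  | .rset _ e => e.cost + 1
  | .iwrite _ i e => i.cost + e.cost + 1
  | .rwrite _ i e => i.cost + e.cost + 1
  | .seq c d => c.time + d.time
  | .ite b c d => b.cost + max c.time d.time + 1
  | .loop _ _ => 0

theorem Run.of_wp {B : ℕ} {c : Cmd} {s : Store} {Q : Store → Prop} (h : c.wp B s Q) :
    Run B c s c.time Q := by
  induction c generalizing s Q with
  | skip => exact ⟨_, _, .skip s, le_rfl, h⟩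
  | iset x e => exact ⟨_, _, .iset s x e h.1, le_rfl, h.2⟩
  | rset x e => exact ⟨_, _, .rset s x e h.1, le_rfl, h.2⟩
  | iwrite a i e => exact ⟨_, _, .iwrite s a i e h.1 h.2.1, le_rfl, h.2.2⟩
  | rwrite a i e => exact ⟨_, _, .rwrite s a i e h.1 h.2.1, le_rfl, h.2.2⟩
  | seq c d ihc ihd => exact Run.seq ((ihc h).mono le_rfl fun s' _ hs => ihd hs) le_rfl
  | ite b c d ihc ihd =>
    exact Run.ite h.1 (fun hb => (ihc (h.2.1 hb)).mono (le_max_left _ _) fun _ _ hs => hs)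
      (fun hb => (ihd (h.2.2 hb)).mono (le_max_right _ _) fun _ _ hs => hs)
  -- A loop has precondition `False`, so the running time 0 assigned to it is never used.
  | loop => exact h.elim

theorem Run.wp_seq {B : ℕ} {c d : Cmd} {s : Store} {k k' : ℕ} {Q : Store → Prop}
    (h : c.wp B s fun s' => Run B d s' k Q) (hk : c.time + k ≤ k') :
    Run B (.seq c d) s k' Q :=
  (Run.of_wp h).seq hk

/-! ### Tournament trees

The nodes of the tree are `1, …, 2N - 1`, the children of `i < N` are `2i` and `2i + 1`, and
every inner node carries a copy of the label and key of a child with the smaller key. -/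

/-- The inner node `i` is a copy of its better child. -/
def IsWinner (val : ℕ → ℝ) (win : ℕ → ℕ) (i : ℕ) : Prop :=
  (val i = val (2 * i) ∧ win i = win (2 * i) ∨ val i = val (2 * i + 1) ∧ win i = win (2 * i + 1)) ∧
    val i ≤ val (2 * i) ∧ val i ≤ val (2 * i + 1)

/-- A tournament tree with the keys `key 0, …, key (N - 1)` at its leaves, up to the inner nodes
excluded by `P`. -/
structure IsTreeExcept (N : ℕ) (key : ℕ → ℝ) (val : ℕ → ℝ) (win : ℕ → ℕ) (P : ℕ → Prop) : Prop where
  leaf_val : ∀ j < N, val (N + j) = key j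
  leaf_win : ∀ j < N, win (N + j) = j
  inner : ∀ i, 1 ≤ i → i < N → ¬ P i → IsWinner val win i

theorem IsTreeExcept.mono {N : ℕ} {key val : ℕ → ℝ} {win : ℕ → ℕ} {P P' : ℕ → Prop}
    (h : IsTreeExcept N key val win P) (hP : ∀ i, 1 ≤ i → i < N → P i → P' i) :
    IsTreeExcept N key val win P' :=
  ⟨h.leaf_val, h.leaf_win, fun i h1 h2 h3 => h.inner i h1 h2 fun hp => h3 (hP i h1 h2 hp)⟩

abbrev IsTree (N : ℕ) (key : ℕ → ℝ) (val : ℕ → ℝ) (win : ℕ → ℕ) : Prop :=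
  IsTreeExcept N key val win fun _ => False

namespace IsTree

variable {N : ℕ} {key val : ℕ → ℝ} {win : ℕ → ℕ}

theorem node (h : IsTree N key val win) {i : ℕ} (h1 : 1 ≤ i) (h2 : i < 2 * N) :
    win i < N ∧ val i = key (win i) := by
  -- The children of a node have larger indices, so the induction runs from the end of the array
  -- towards the root.
  induction hn : 2 * N - i using Nat.strong_induction_on generalizing i with
  | _ n ih =>
  by_cases hi : i < N
  · rcases (h.inner i h1 hi id).1 with ⟨e, e'⟩ | ⟨e, e'⟩
    · rw [e, e']; exact ih (2 * N - 2 * i) (by omega) (by omega) (by omega) rfl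
    · rw [e, e']; exact ih (2 * N - (2 * i + 1)) (by omega) (by omega) (by omega) rfl
  · obtain ⟨j, rfl⟩ := Nat.exists_eq_add_of_le (not_lt.1 hi)
    rw [h.leaf_win j (by omega), h.leaf_val j (by omega)]
    exact ⟨by omega, rfl⟩

theorem root_le (h : IsTree N key val win) {j : ℕ} (hj : j < N) : val 1 ≤ key j := by
  have : ∀ i, 1 ≤ i → i < 2 * N → val 1 ≤ val i := by
    intro i
    induction i using Nat.strong_induction_on with
    | _ i ih =>
    intro h1 h2
    by_cases hi : i = 1
    · rw [hi]
    refine (ih (i / 2) (by omega) (by omega) (by omega)).trans ?_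
    obtain ⟨-, hl, hr⟩ := h.inner (i / 2) (by omega) (by omega) id
    rcases Nat.mod_two_eq_zero_or_one i with e | e
    · rwa [show 2 * (i / 2) = i by omega] at hl
    · rwa [show 2 * (i / 2) + 1 = i by omega] at hr
  rw [← h.leaf_val j hj]
  exact this _ (by omega) (by omega)

theorem root (h : IsTree N key val win) (hN : 0 < N) : win 1 < N ∧ val 1 = key (win 1) :=
  h.node le_rfl (by omega)

/-- Changing a key only affects the parent of the leaf. -/
theorem update_key (h : IsTree N key val win) (j : ℕ) (x : ℝ) :
    IsTreeExcept N (Function.update key j x) (Function.update val (N + j) x) win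
      fun i => i = (N + j) / 2 := by
  refine ⟨fun i hi => ?_, h.leaf_win, fun i h1 h2 h3 => ?_⟩
  · by_cases e : i = j
    · rw [e, Function.update_self, Function.update_self]
    · rw [Function.update_of_ne e, Function.update_of_ne (by omega), h.leaf_val i hi]
  · have := h.inner i h1 h2 id
    unfold IsWinner
    rw [Function.update_of_ne (by omega), Function.update_of_ne (by omega),
      Function.update_of_ne (by omega)]
    exact this

end IsTree

/-- Recomputing an inner node only affects its parent. -/
theorem IsTreeExcept.update_inner {N : ℕ} {key val : ℕ → ℝ} {win : ℕ → ℕ} {i : ℕ} {P : ℕ → Prop}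
    (h : IsTreeExcept N key val win fun k => P k ∨ k = i) (h1 : 1 ≤ i) (h2 : i < N)
    {x : ℝ} {w : ℕ}
    (hx : x = val (2 * i) ∧ w = win (2 * i) ∨ x = val (2 * i + 1) ∧ w = win (2 * i + 1))
    (hl : x ≤ val (2 * i)) (hr : x ≤ val (2 * i + 1)) :
    IsTreeExcept N key (Function.update val i x) (Function.update win i w)
      fun k => (P k ∧ k ≠ i) ∨ k = i / 2 := by
  refine ⟨fun j hj => ?_, fun j hj => ?_, fun k h3 h4 h5 => ?_⟩
  · rw [Function.update_of_ne (by omega), h.leaf_val j hj]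
  · rw [Function.update_of_ne (by omega), h.leaf_win j hj]
  · unfold IsWinner
    rw [Function.update_of_ne (show 2 * k ≠ i by omega),
      Function.update_of_ne (show 2 * k + 1 ≠ i by omega),
      Function.update_of_ne (show 2 * k ≠ i by omega),
      Function.update_of_ne (show 2 * k + 1 ≠ i by omega)]
    by_cases e : k = i
    · subst e
      rw [Function.update_self, Function.update_self]
      exact ⟨hx, hl, hr⟩
    · rw [Function.update_of_ne e, Function.update_of_ne e]
      exact h.inner k h3 h4 (by tauto)

end RealRAM

/-! ### Programs on tournament trees. -/

namespace RealRAM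

attribute [simp] Cmd.wp IExp.Ok IExp.eval RExp.Ok RExp.eval BExp.Ok BExp.Holds
attribute [simp] Cmd.iregs Cmd.rregs Cmd.iarrs Cmd.rarrs

/-- Recompute the inner node `ireg 3` of the tournament tree stored in the arrays 6 (keys) and 4
(labels). -/
def pull : Cmd :=
  .ite (.rlt (.read 6 (.mul (.const 2) (.reg 3))) (.read 6 (.add (.mul (.const 2) (.reg 3)) (.const 1))))
    (.seq (.rwrite 6 (.reg 3) (.read 6 (.mul (.const 2) (.reg 3))))
      (.iwrite 4 (.reg 3) (.read 4 (.mul (.const 2) (.reg 3)))))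
    (.seq (.rwrite 6 (.reg 3) (.read 6 (.add (.mul (.const 2) (.reg 3)) (.const 1))))
      (.iwrite 4 (.reg 3) (.read 4 (.add (.mul (.const 2) (.reg 3)) (.const 1)))))

/-- Reading a label is legal only if its value is a word. Requiring this of all cells of array 4
avoids keeping track of those that are in use. -/
theorem pull_wp {B N : ℕ} {s : Store} {Q : Store → Prop} (hB : 2 * N + 2 ≤ B)
    (h2 : s.ireg 3 < N) (hw : ∀ k, s.iarr 4 k ≤ B)
    (hQ : ∀ x w, (x = s.rarr 6 (2 * s.ireg 3) ∧ w = s.iarr 4 (2 * s.ireg 3) ∨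
        x = s.rarr 6 (2 * s.ireg 3 + 1) ∧ w = s.iarr 4 (2 * s.ireg 3 + 1)) →
      x ≤ s.rarr 6 (2 * s.ireg 3) → x ≤ s.rarr 6 (2 * s.ireg 3 + 1) →
      Q { s with
        rarr := Function.update s.rarr 6 (Function.update (s.rarr 6) (s.ireg 3) x)
        iarr := Function.update s.iarr 4 (Function.update (s.iarr 4) (s.ireg 3) w) }) :
    pull.wp B s Q := by
  have e1 : 1 ≤ B := by omega
  have e2 : 2 ≤ B := by omega
  have e3 : s.ireg 3 ≤ B := by omega
  have e4 : 2 * s.ireg 3 ≤ B := by omega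
  have e5 : 2 * s.ireg 3 < B := by omega
  simp [pull, hw, e1, e2, e3, e4, e5]
  exact ⟨fun h => hQ _ _ (Or.inl ⟨rfl, rfl⟩) le_rfl h.le,
    fun h => hQ _ _ (Or.inr ⟨rfl, rfl⟩) h le_rfl⟩

/-- Halving an index removes a binary digit; this makes the climb to the root, and likewise a binary
search, logarithmic. -/
theorem size_div_two_lt {i : ℕ} (hi : 0 < i) : Nat.size (i / 2) + 1 ≤ Nat.size i := by
  have h1 := Nat.lt_size_self i
  have h2 : 0 < Nat.size i := Nat.size_pos.2 hi
  obtain ⟨k, hk⟩ := Nat.exists_eq_add_of_lt h2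
  rw [hk, zero_add, pow_succ] at h1
  have : Nat.size (i / 2) ≤ k := Nat.size_le.2 (by omega)
  omega

/-- Recompute all proper ancestors of the node `ireg 3`. -/
def climb : Cmd :=
  .seq (.iset 3 (.div (.reg 3) (.const 2)))
    (.loop (.ilt (.const 0) (.reg 3)) (.seq pull (.iset 3 (.div (.reg 3) (.const 2)))))

theorem climb_run {B N : ℕ} {s : Store} {key : ℕ → ℝ} (hB : 2 * N + 2 ≤ B)
    (hi : s.ireg 3 < 2 * N) (hw : ∀ k, s.iarr 4 k ≤ B)
    (hT : IsTreeExcept N key (s.rarr 6) (s.iarr 4) fun k => k = s.ireg 3 / 2) :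
    Run B climb s (60 * Nat.size (2 * N) + 60) fun s' =>
      IsTree N key (s'.rarr 6) (s'.iarr 4) ∧ ∀ k, s'.iarr 4 k ≤ B := by
  refine Run.wp_seq (k := 60 * Nat.size (2 * N) + 50) ?_ (by simp [Cmd.time, IExp.cost]; omega)
  have e2 : 2 ≤ B := by omega
  have e3 : s.ireg 3 ≤ B := by omega
  simp [e2, e3]
  refine (Run.loop (fun s' => s'.ireg 3 < N ∧ (∀ k, s'.iarr 4 k ≤ B) ∧
    IsTreeExcept N key (s'.rarr 6) (s'.iarr 4) fun k => k = s'.ireg 3)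
    (fun s' => 60 * Nat.size (s'.ireg 3)) ?_ ?_ ?_).mono ?_ ?_
  · simp
    exact ⟨by omega, hw, hT⟩
  · rintro s' - ⟨h1, -⟩
    simp; omega
  · rintro s' - ⟨h1, h2, h3⟩ hb
    simp at hb
    refine ⟨_, Run.of_wp (pull_wp (N := N) (by omega) h1 h2 fun x w hx hl hr => ?_)⟩
    have := size_div_two_lt hb
    simp
    refine ⟨by omega, ⟨by omega, fun k => ?_, ?_⟩, ?_⟩
    · by_cases hk : k = s'.ireg 3
      · rw [hk, Function.update_self]
        rcases hx with ⟨-, rfl⟩ | ⟨-, rfl⟩ <;> exact h2 _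
      · rw [Function.update_of_ne hk]; exact h2 k
    -- The only stale node moves up to its parent. When it becomes 0, which is no inner node, the
    -- tree is intact.
    · refine (IsTreeExcept.update_inner (P := fun _ => False) (h3.mono ?_) hb h1 hx hl hr).mono ?_
      · tauto
      · tauto
    · have : (pull.seq (Cmd.iset 3 ((IExp.reg 3).div (IExp.const 2)))).time +
        (BExp.ilt (.const 0) (.reg 3)).cost + 1 ≤ 60 := by decide
      omega
  · have : Nat.size (s.ireg 3 / 2) ≤ Nat.size (2 * N) := Nat.size_le_size (by omega)
    simp [BExp.cost, IExp.cost]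
    omega
  · rintro s' - ⟨⟨-, h2, h3⟩, h4⟩
    simp at h4
    exact ⟨h3.mono (by omega), h2⟩

/-- Compute all inner nodes of a tournament tree with `ireg 2` leaves. -/
def build : Cmd :=
  .seq (.iset 3 (.reg 2))
    (.loop (.ilt (.const 1) (.reg 3)) (.seq (.iset 3 (.sub (.reg 3) (.const 1))) pull))

theorem build_run {B N : ℕ} {s : Store} {key : ℕ → ℝ} (hB : 2 * N + 2 ≤ B)
    (hN : s.ireg 2 = N) (hw : ∀ k, s.iarr 4 k ≤ B) (hv : ∀ j < N, s.rarr 6 (N + j) = key j)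
    (hl : ∀ j < N, s.iarr 4 (N + j) = j) :
    Run B build s (60 * N + 60) fun s' =>
      IsTree N key (s'.rarr 6) (s'.iarr 4) ∧ ∀ k, s'.iarr 4 k ≤ B := by
  refine Run.wp_seq (k := 60 * N + 50) ?_ (by simp [Cmd.time, IExp.cost]; omega)
  have e1 : N ≤ B := by omega
  simp [hN, e1]
  refine (Run.loop (fun s' => s'.ireg 3 ≤ N ∧ (∀ k, s'.iarr 4 k ≤ B) ∧
    IsTreeExcept N key (s'.rarr 6) (s'.iarr 4) fun k => k < s'.ireg 3)
    (fun s' => 60 * s'.ireg 3) ?_ ?_ ?_).mono ?_ ?_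
  · simp
    exact ⟨hw, hv, hl, fun i _ h2 h3 => absurd h2 h3⟩
  · rintro s' - ⟨h1, -⟩
    simp; omega
  · rintro s' - ⟨h1, h2, h3⟩ hb
    simp at hb
    have e2 : 1 ≤ B := by omega
    have e3 : s'.ireg 3 ≤ B := by omega
    refine ⟨_, Run.of_wp ?_⟩
    simp [e2, e3]
    refine pull_wp (N := N) (by omega) (by simp; omega) h2 fun x w hx hl hr => ?_
    simp at hx hl hr ⊢
    refine ⟨⟨by omega, fun k => ?_, ?_⟩, ?_⟩
    · by_cases hk : k = s'.ireg 3 - 1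
      · rw [hk, Function.update_self]
        rcases hx with ⟨-, rfl⟩ | ⟨-, rfl⟩ <;> exact h2 _
      · rw [Function.update_of_ne hk]; exact h2 k
    -- The nodes are treated in decreasing order, so both children of the present one are final;
    -- only smaller indices remain stale.
    · refine (IsTreeExcept.update_inner (P := fun k => k < s'.ireg 3 - 1) (h3.mono ?_)
        (by omega) (by omega) hx hl hr).mono ?_
      · omega
      · omega
    · have : (Cmd.seq (.iset 3 (.sub (.reg 3) (.const 1))) pull).time +
        (BExp.ilt (.const 1) (.reg 3)).cost + 1 ≤ 60 := by decide
      omega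
  · simp [BExp.cost, IExp.cost]
  · rintro s' - ⟨⟨-, h2, h3⟩, h4⟩
    simp at h4
    exact ⟨h3.mono (by omega), h2⟩

/-- Change the key of the leaf `ireg r` to `rreg y`. -/
def setKey (r y : ℕ) : Cmd :=
  .seq (.seq (.iset 3 (.add (.reg 2) (.reg r))) (.rwrite 6 (.reg 3) (.reg y))) climb

theorem setKey_run {B N r y : ℕ} {s : Store} {key : ℕ → ℝ} (hB : 2 * N + 2 ≤ B)
    (hN : s.ireg 2 = N) (hr : s.ireg r < N) (hw : ∀ k, s.iarr 4 k ≤ B)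
    (hT : IsTree N key (s.rarr 6) (s.iarr 4)) :
    Run B (setKey r y) s (60 * Nat.size (2 * N) + 70) fun s' =>
      IsTree N (Function.update key (s.ireg r) (s.rreg y)) (s'.rarr 6) (s'.iarr 4) ∧
        ∀ k, s'.iarr 4 k ≤ B := by
  refine Run.wp_seq (k := 60 * Nat.size (2 * N) + 60) ?_
    (by simp [Cmd.time, IExp.cost, RExp.cost]; omega)
  have e1 : N ≤ B := by omega
  have e2 : s.ireg r ≤ B := by omega
  have e3 : N + s.ireg r ≤ B := by omega
  simp [hN, e1, e2, e3]
  refine climb_run hB (by simp; omega) hw ?_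
  simp
  exact hT.update_key _ _

end RealRAM

/-! ### Upper envelopes of lines -/

/-- The elevation profile `y ↦ (y - l.2) / l.1` of descent to a node at distance `l.1` with
elevation `l.2`. -/
noncomputable def slopeLine (l : ℝ × ℝ) (y : ℝ) : ℝ := (y - l.2) / l.1

theorem slopeLine_sub (l : ℝ × ℝ) (x y : ℝ) : slopeLine l y = slopeLine l x + (y - x) / l.1 := by
  unfold slopeLine; ring

/-- The nearer neighbor has the steeper line and never loses a lead on the way to the right. The
next two lemmas look to the left, where it never makes up for a deficit. -/
theorem slopeLine_le_of_le {l l' : ℝ × ℝ} (h0 : 0 < l.1) (h : l.1 ≤ l'.1) {x y : ℝ} (hxy : x ≤ y)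
    (hx : slopeLine l' x ≤ slopeLine l x) : slopeLine l' y ≤ slopeLine l y := by
  rw [slopeLine_sub l x y, slopeLine_sub l' x y]
  have : (y - x) / l'.1 ≤ (y - x) / l.1 := by
    have := sub_nonneg.2 hxy
    gcongr
  linarith

theorem slopeLine_lt_of_le {l l' : ℝ × ℝ} (h0 : 0 < l.1) (h : l.1 ≤ l'.1) {x y : ℝ} (hxy : y ≤ x)
    (hx : slopeLine l x < slopeLine l' x) : slopeLine l y < slopeLine l' y := by
  by_contra hlt
  exact (slopeLine_le_of_le h0 h hxy (not_lt.1 hlt)).not_gt hx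

theorem slopeLine_le_of_ge {l l' : ℝ × ℝ} (h0 : 0 < l.1) (h : l.1 ≤ l'.1) {x y : ℝ} (hxy : y ≤ x)
    (hx : slopeLine l x ≤ slopeLine l' x) : slopeLine l y ≤ slopeLine l' y := by
  rw [slopeLine_sub l x y, slopeLine_sub l' x y]
  have : (x - y) / l'.1 ≤ (x - y) / l.1 := by
    have := sub_nonneg.2 hxy
    gcongr
  have h1 : (y - x) / l.1 = -((x - y) / l.1) := by ring
  have h2 : (y - x) / l'.1 = -((x - y) / l'.1) := by ring
  linarith

/-- The first `k` members of the sequence `(D, H)` form the upper envelope, on the half-line that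
starts at `lo`, of the lines in `lines`; the member `i` is maximal from `BP i` to `BP (i + 1)`,
where on the part that the last member is responsible for, lines in `pend` may be larger. -/
structure IsEnvelope (lines pend : Set (ℝ × ℝ)) (lo : ℝ) (k : ℕ) (D H BP : ℕ → ℝ) : Prop where
  mem : ∀ i < k, (D i, H i) ∈ lines
  start : 0 < k → BP 0 = lo
  mono : ∀ i, i + 1 < k → BP i ≤ BP (i + 1)
  cover : ∀ i, i + 1 < k → ∀ y, BP i ≤ y → y ≤ BP (i + 1) → ∀ l ∈ lines,
    slopeLine l y ≤ slopeLine (D i, H i) y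
  last : ∀ y, (if k = 0 then lo else BP (k - 1)) ≤ y → ∀ l ∈ lines,
    (0 < k ∧ slopeLine l y ≤ slopeLine (D (k - 1), H (k - 1)) y) ∨
      ∃ l' ∈ pend, slopeLine l y ≤ slopeLine l' y

namespace IsEnvelope

variable {lines pend : Set (ℝ × ℝ)} {lo : ℝ} {k : ℕ} {D H BP : ℕ → ℝ} {l : ℝ × ℝ}

theorem congr (h : IsEnvelope lines pend lo k D H BP) {D' H' BP' : ℕ → ℝ}
    (hD : ∀ i < k, D' i = D i) (hH : ∀ i < k, H' i = H i) (hBP : ∀ i < k, BP' i = BP i) :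
    IsEnvelope lines pend lo k D' H' BP' := by
  refine ⟨fun i hi => ?_, fun hk => ?_, fun i hi => ?_, fun i hi y => ?_, fun y => ?_⟩
  · rw [hD i hi, hH i hi]; exact h.mem i hi
  · rw [hBP 0 hk]; exact h.start hk
  · rw [hBP i (by omega), hBP (i + 1) hi]; exact h.mono i hi
  · rw [hBP i (by omega), hBP (i + 1) hi, hD i (by omega), hH i (by omega)]; exact h.cover i hi y
  · rcases Nat.eq_zero_or_pos k with rfl | hk
    · simpa using h.last y
    · rw [hBP (k - 1) (by omega), hD (k - 1) (by omega), hH (k - 1) (by omega)]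
      exact h.last y

theorem mono_pend (h : IsEnvelope lines pend lo k D H BP) {pend' : Set (ℝ × ℝ)}
    (hp : pend ⊆ pend') : IsEnvelope lines pend' lo k D H BP :=
  ⟨h.mem, h.start, h.mono, h.cover, fun y hy l hl => (h.last y hy l hl).imp_right
    fun ⟨l', hl', h'⟩ => ⟨l', hp hl', h'⟩⟩

/-- The new line `l` is at least as steep as the last member and not below it where that starts to
be maximal, so `l` dominates it from there on. The pending set lets `l` answer for this part before
it is stored. -/
theorem pop (h : IsEnvelope lines {l} lo k D H BP) (hk : 0 < k) (h0 : 0 < l.1)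
    (hl : l.1 ≤ D (k - 1))
    (hle : slopeLine (D (k - 1), H (k - 1)) (BP (k - 1)) ≤ slopeLine l (BP (k - 1))) :
    IsEnvelope lines {l} lo (k - 1) D H BP := by
  have hlast : ∀ y, BP (k - 1) ≤ y → ∀ l' ∈ lines, slopeLine l' y ≤ slopeLine l y := by
    intro y hy l' hl'
    rcases h.last y (by rwa [if_neg hk.ne']) l' hl' with ⟨-, h1⟩ | ⟨l'', rfl, h1⟩
    · exact h1.trans (slopeLine_le_of_le h0 hl hy hle)
    · exact h1
  refine ⟨fun i hi => h.mem i (by omega), fun _ => h.start hk, fun i hi => h.mono i (by omega),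
    fun i hi => h.cover i (by omega), fun y hy l' hl' => ?_⟩
  by_cases hk1 : k - 1 = 0
  · rw [if_pos hk1, ← h.start hk, ← hk1] at hy
    exact Or.inr ⟨l, rfl, hlast y hy l' hl'⟩
  · rw [if_neg hk1] at hy
    rcases le_total y (BP (k - 1)) with hy' | hy'
    · refine Or.inl ⟨by omega, h.cover (k - 1 - 1) (by omega) y hy ?_ l' hl'⟩
      rwa [show k - 1 - 1 + 1 = k - 1 by omega]
    · exact Or.inr ⟨l, rfl, hlast y hy' l' hl'⟩

theorem push_first (h : IsEnvelope lines {l} lo 0 D H BP) (hD : D 0 = l.1) (hH : H 0 = l.2)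
    (hBP : BP 0 = lo) : IsEnvelope (insert l lines) ∅ lo 1 D H BP := by
  have e : (D 0, H 0) = l := Prod.ext hD hH
  refine ⟨fun i hi => ?_, fun _ => hBP, fun i hi => by omega, fun i hi => by omega,
    fun y hy l' hl' => Or.inl ⟨one_pos, ?_⟩⟩
  · obtain rfl : i = 0 := by omega
    exact e ▸ Set.mem_insert _ _
  · simp only [one_ne_zero, if_false, Nat.sub_self, hBP, e] at hy ⊢
    rcases hl' with rfl | hl'
    · exact le_rfl
    · rcases h.last y (by simpa using hy) l' hl' with ⟨h1, -⟩ | ⟨l'', rfl, h1⟩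
      exacts [absurd h1 (by omega), h1]

/-- The two lines are parallel, so the lower one is maximal nowhere. -/
theorem discard (h : IsEnvelope lines {l} lo k D H BP) (hk : 0 < k)
    (hl : l.1 = D (k - 1))
    (hlt : slopeLine l (BP (k - 1)) < slopeLine (D (k - 1), H (k - 1)) (BP (k - 1))) :
    IsEnvelope (insert l lines) ∅ lo k D H BP := by
  have hle : ∀ y, slopeLine l y ≤ slopeLine (D (k - 1), H (k - 1)) y := fun y => by
    rw [slopeLine_sub l (BP (k - 1)), slopeLine_sub (D (k - 1), H (k - 1)) (BP (k - 1)), hl]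
    simp only
    linarith
  refine ⟨fun i hi => Or.inr (h.mem i hi), h.start, h.mono, fun i hi y hy hy' l' hl' => ?_,
    fun y hy l' hl' => Or.inl ⟨hk, ?_⟩⟩
  · rcases hl' with rfl | hl'
    · exact (hle y).trans (h.cover i hi y hy hy' _ (h.mem (k - 1) (by omega)))
    · exact h.cover i hi y hy hy' l' hl'
  · rcases hl' with rfl | hl'
    · exact hle y
    · rcases h.last y hy l' hl' with ⟨-, h1⟩ | ⟨l'', rfl, h1⟩
      exacts [h1, h1.trans (hle y)]

/-- The new line starts below the last member but is steeper, so it overtakes at a crossing further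
right, the new breakpoint. Left of the crossing it is below the old last member, hence below
whichever member is responsible there. -/
theorem push (h : IsEnvelope lines {l} lo k D H BP) (hk : 0 < k) (h0 : 0 < l.1)
    (hl : l.1 < D (k - 1))
    (hlt : slopeLine l (BP (k - 1)) < slopeLine (D (k - 1), H (k - 1)) (BP (k - 1)))
    (hD : D k = l.1) (hH : H k = l.2)
    (hBP : BP k = (l.2 * D (k - 1) - H (k - 1) * l.1) / (D (k - 1) - l.1)) :
    IsEnvelope (insert l lines) ∅ lo (k + 1) D H BP := by
  have e : (D k, H k) = l := Prod.ext hD hH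
  have hd : 0 < D (k - 1) := h0.trans hl
  have hx : slopeLine l (BP k) = slopeLine (D (k - 1), H (k - 1)) (BP k) := by
    have := (sub_pos.2 hl).ne'
    rw [hBP, slopeLine, slopeLine]
    field_simp
    ring
  have hle : BP (k - 1) ≤ BP k := by
    by_contra hlt'
    exact (slopeLine_le_of_le (l' := (D (k - 1), H (k - 1))) h0 hl.le (not_le.1 hlt').le
      hx.ge).not_gt hlt
  refine ⟨fun i hi => ?_, fun _ => h.start hk, fun i hi => ?_, fun i hi y hy hy' l' hl' => ?_,
    fun y hy l' hl' => Or.inl ⟨k.succ_pos, ?_⟩⟩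
  · rcases Nat.lt_succ_iff_lt_or_eq.1 hi with hi | rfl
    · exact Or.inr (h.mem i hi)
    · exact e ▸ Set.mem_insert _ _
  · by_cases hi' : i + 1 < k
    · exact h.mono i hi'
    · obtain rfl : i = k - 1 := by omega
      rwa [show k - 1 + 1 = k by omega]
  · by_cases hi' : i + 1 < k
    · rcases hl' with rfl | hl'
      · have hmono : ∀ j, i + 1 + j < k → BP (i + 1) ≤ BP (i + 1 + j) := by
          intro j
          induction j with
          | zero => exact fun _ => le_rfl
          | succ j ih => exact fun hj => (ih (by omega)).trans (h.mono (i + 1 + j) hj)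
        have h1 := hmono (k - 1 - (i + 1)) (by omega)
        rw [show i + 1 + (k - 1 - (i + 1)) = k - 1 by omega] at h1
        exact (slopeLine_le_of_ge (l' := (D (k - 1), H (k - 1))) h0 hl.le
          (hy'.trans (h1.trans hle)) hx.le).trans
          (h.cover i hi' y hy hy' _ (h.mem (k - 1) (by omega)))
      · exact h.cover i hi' y hy hy' l' hl'
    · obtain rfl : i = k - 1 := by omega
      rw [show k - 1 + 1 = k by omega] at hy'
      have h1 := slopeLine_le_of_ge (l' := (D (k - 1), H (k - 1))) h0 hl.le hy' hx.le
      rcases hl' with rfl | hl'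
      · exact h1
      · rcases h.last y (by rwa [if_neg hk.ne']) l' hl' with ⟨-, h2⟩ | ⟨l'', rfl, h2⟩
        exacts [h2, h2.trans h1]
  · simp only [Nat.add_sub_cancel, Nat.succ_ne_zero, if_false, e] at hy ⊢
    rcases hl' with rfl | hl'
    · exact le_rfl
    · rcases h.last y (by rw [if_neg hk.ne']; exact hle.trans hy) l' hl' with
        ⟨-, h2⟩ | ⟨l'', rfl, h2⟩
      · exact h2.trans (slopeLine_le_of_le (l' := (D (k - 1), H (k - 1))) h0 hl.le hy hx.ge)
      · exact h2

/-- The member `i` of the envelope is maximal on its interval. -/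
theorem le_of_mem_interval (h : IsEnvelope lines ∅ lo k D H BP) {i : ℕ} (hi : i < k) {y : ℝ}
    (hy : BP i ≤ y) (hy' : i + 1 < k → y ≤ BP (i + 1)) (hl : l ∈ lines) :
    slopeLine l y ≤ slopeLine (D i, H i) y := by
  by_cases hi' : i + 1 < k
  · exact h.cover i hi' y hy (hy' hi') l hl
  · obtain rfl : i = k - 1 := by omega
    rcases h.last y (by rwa [if_neg (by omega)]) l hl with ⟨-, h1⟩ | ⟨l', h1, -⟩
    · exact h1
    · exact h1.elim

/-- A line that is at least as steep as member `i` and below it at `BP i` is below it everywhere to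
the left, so no solution is lost by starting at `BP i`. -/
theorem le_of_above (h : IsEnvelope lines ∅ lo k D H BP) {g : ℝ × ℝ} (hg : 0 < g.1) {y₀ : ℝ}
    (h0 : lo ≤ y₀) {i : ℕ} (hi : i < k)
    (hleft : 0 < i → BP i < y₀ ∨
      (g.1 ≤ D i ∧ slopeLine g (BP i) < slopeLine (D i, H i) (BP i)))
    {y : ℝ} (h1 : y₀ ≤ y) (h2 : ∀ l ∈ lines, slopeLine l y ≤ slopeLine g y) :
    max y₀ (BP i) ≤ y := by
  refine max_le h1 ?_
  rcases Nat.eq_zero_or_pos i with rfl | hi0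
  · rw [h.start hi]; exact h0.trans h1
  rcases hleft hi0 with h3 | ⟨h3, h4⟩
  · exact h3.le.trans h1
  · by_contra hlt
    exact (h2 _ (h.mem i hi)).not_gt
      (slopeLine_lt_of_le (l' := (D i, H i)) hg h3 (not_le.1 hlt).le h4)

/-- Where to find the first point, at or after `y₀`, at which the line `g` is above the envelope,
once the right member `i` of the envelope has been found. -/
theorem isLeast_above (h : IsEnvelope lines ∅ lo k D H BP) (hpos : ∀ l ∈ lines, 0 < l.1)
    {g : ℝ × ℝ} (hg : 0 < g.1) {y₀ : ℝ} (h0 : lo ≤ y₀) {i : ℕ} (hi : i < k)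
    (hleft : 0 < i → BP i < y₀ ∨
      (g.1 ≤ D i ∧ slopeLine g (BP i) < slopeLine (D i, H i) (BP i)))
    (hright : i + 1 < k → y₀ ≤ BP (i + 1) ∧ (D (i + 1) < g.1 ∨
      slopeLine (D (i + 1), H (i + 1)) (BP (i + 1)) ≤ slopeLine g (BP (i + 1))))
    {a y : ℝ} (ha : a = max y₀ (BP i))
    (hy : slopeLine (D i, H i) a ≤ slopeLine g a ∧ y = a ∨
      slopeLine g a < slopeLine (D i, H i) a ∧ g.1 < D i ∧
        y = a + (slopeLine (D i, H i) a - slopeLine g a) / (1 / g.1 - 1 / D i) ∧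
        (i + 1 < k → y ≤ BP (i + 1))) :
    IsLeast {y | y₀ ≤ y ∧ ∀ l ∈ lines, slopeLine l y ≤ slopeLine g y} y := by
  have hDi := hpos _ (h.mem i hi)
  simp only at hDi
  have ha1 : y₀ ≤ a := ha ▸ le_max_left _ _
  have ha2 : BP i ≤ a := ha ▸ le_max_right _ _
  -- Either `g` is above the envelope at `a` already, or it gains on member `i` at the rate `1 / g.1
  -- - 1 / D i` and draws level within the interval of that member.
  rcases hy with ⟨h1, rfl⟩ | ⟨h1, h2, h3, h4⟩
  · refine ⟨⟨ha1, fun l hl => (h.le_of_mem_interval hi ha2 (fun hi' => ?_) hl).trans h1⟩,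
      fun y' hy' => ha ▸ h.le_of_above hg h0 hi hleft hy'.1 hy'.2⟩
    rw [ha]
    exact max_le (hright hi').1 (h.mono i hi')
  · have hpos' : 0 < 1 / g.1 - 1 / D i := by
      rw [sub_pos]; exact one_div_lt_one_div_of_lt hg h2
    have hay : a ≤ y := by
      rw [h3]
      have := div_nonneg (sub_pos.2 h1).le hpos'.le
      linarith
    have hdiff : ∀ y', slopeLine g y' - slopeLine (D i, H i) y' =
        slopeLine g a - slopeLine (D i, H i) a + (y' - a) * (1 / g.1 - 1 / D i) := fun y' => by
      rw [slopeLine_sub g a, slopeLine_sub (D i, H i) a]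
      simp only
      ring
    have hyeq : slopeLine (D i, H i) y = slopeLine g y := by
      have h5 := hdiff y
      rw [h3, add_sub_cancel_left, div_mul_cancel₀ _ hpos'.ne', ← h3] at h5
      linarith
    refine ⟨⟨ha1.trans hay, fun l hl =>
      (h.le_of_mem_interval hi (ha2.trans hay) h4 hl).trans hyeq.le⟩, fun y' hy' => ?_⟩
    have h5 := hdiff y'
    have h6 := hdiff y
    have h7 := hy'.2 _ (h.mem i hi)
    by_contra hlt
    push Not at hlt
    nlinarith

/-- The cases that are missing in `IsEnvelope.isLeast_above`. -/
theorem not_above (h : IsEnvelope lines ∅ lo k D H BP) (hpos : ∀ l ∈ lines, 0 < l.1)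
    {g : ℝ × ℝ} (hg : 0 < g.1) {y₀ : ℝ} (h0 : lo ≤ y₀) {i : ℕ} (hi : i < k)
    (hleft : 0 < i → BP i < y₀ ∨
      (g.1 ≤ D i ∧ slopeLine g (BP i) < slopeLine (D i, H i) (BP i)))
    (hright : i + 1 < k → y₀ ≤ BP (i + 1) ∧ (D (i + 1) < g.1 ∨
      slopeLine (D (i + 1), H (i + 1)) (BP (i + 1)) ≤ slopeLine g (BP (i + 1))))
    {a : ℝ} (ha : a = max y₀ (BP i))
    (ha' : slopeLine g a < slopeLine (D i, H i) a)
    (hno : D i ≤ g.1 ∨ i + 1 < k ∧ g.1 < D i ∧ BP (i + 1) <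
        a + (slopeLine (D i, H i) a - slopeLine g a) / (1 / g.1 - 1 / D i)) (y : ℝ) :
    ¬ (y₀ ≤ y ∧ ∀ l ∈ lines, slopeLine l y ≤ slopeLine g y) := by
  rintro ⟨h1, h2⟩
  have hDi := hpos _ (h.mem i hi)
  simp only at hDi
  have hay : a ≤ y := ha ▸ h.le_of_above hg h0 hi hleft h1 h2
  have h3 := h2 _ (h.mem i hi)
  have hdiff : ∀ y', slopeLine g y' - slopeLine (D i, H i) y' =
      slopeLine g a - slopeLine (D i, H i) a + (y' - a) * (1 / g.1 - 1 / D i) := fun y' => by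
    rw [slopeLine_sub g a, slopeLine_sub (D i, H i) a]
    simp only
    ring
  -- In the first case `g` never catches up with member `i`. In the second it is still below at `BP
  -- (i + 1)`, hence below member `i + 1` there; then `hright` says that it is less steep than that
  -- member and falls further behind.
  rcases hno with hno | ⟨hi', hgD, hlt⟩
  · have : 1 / g.1 - 1 / D i ≤ 0 := by
      rw [sub_nonpos]; exact one_div_le_one_div_of_le hDi hno
    have h4 := hdiff y
    nlinarith
  · have hpos' : 0 < 1 / g.1 - 1 / D i := by
      rw [sub_pos]; exact one_div_lt_one_div_of_lt hg hgD
    have key : ∀ y', slopeLine (D i, H i) y' ≤ slopeLine g y' → BP (i + 1) < y' := by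
      intro y' hy'
      refine hlt.trans_le ?_
      rw [← le_sub_iff_add_le', div_le_iff₀ hpos']
      have := hdiff y'
      linarith
    have hb : slopeLine g (BP (i + 1)) < slopeLine (D i, H i) (BP (i + 1)) := by
      by_contra hlt'
      exact lt_irrefl _ (key _ (not_lt.1 hlt'))
    have hDi' := hpos _ (h.mem (i + 1) hi')
    simp only at hDi'
    have hle : slopeLine g (BP (i + 1)) < slopeLine (D (i + 1), H (i + 1)) (BP (i + 1)) := by
      exact hb.trans_le (h.le_of_mem_interval hi' le_rfl (fun hi2 => h.mono _ hi2) (h.mem i hi))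
    obtain ⟨-, h5 | h5⟩ := hright hi'
    · have h6 := h2 _ (h.mem (i + 1) hi')
      have h7 := slopeLine_le_of_le (l := (D (i + 1), H (i + 1))) (l' := g) hDi' h5.le
        (key y h3).le hle.le
      have h9 := le_antisymm h6 h7
      rw [slopeLine_sub g (BP (i + 1)) y, slopeLine_sub (D (i + 1), H (i + 1)) (BP (i + 1)) y] at h9
      have : (y - BP (i + 1)) / g.1 ≤ (y - BP (i + 1)) / D (i + 1) := by
        have := sub_nonneg.2 (key y h3).le
        have := h5.le
        gcongr
      simp only at h9
      linarith
    · exact h5.not_gt hle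

end IsEnvelope

/-! ### Binary search on an envelope. -/

namespace RealRAM

/-- One step of the binary search: `ireg 7`, `ireg 8` delimit the range. -/
def bisect : Cmd :=
  .seq (.iset 9 (.div (.add (.reg 7) (.reg 8)) (.const 2)))
    (.ite (.and (.not (.rlt (.read 9 (.reg 9)) (.reg 2)))
        (.not (.and (.not (.rlt (.read 7 (.reg 9)) (.reg 1)))
          (.rlt (.div (.sub (.read 9 (.reg 9)) (.reg 0)) (.reg 1))
            (.div (.sub (.read 9 (.reg 9)) (.read 8 (.reg 9))) (.read 7 (.reg 9)))))))
      (.iset 8 (.reg 9)) (.iset 7 (.reg 9)))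

/-- Set up the search for the node `ireg 6`. -/
def searchInit : Cmd :=
  .seq (.rset 2 (.read 2 (.reg 6))) <|
  .seq (.ite (.rlt (.reg 2) (.reg 0)) (.rset 2 (.reg 0)) .skip) <|
  .seq (.iset 7 (.read 0 (.reg 6))) <|
  .seq (.iset 10 (.add (.read 0 (.reg 6)) (.read 6 (.reg 6))))
    (.iset 8 (.reg 10))

/-- Solve for the elevation on the linear piece that has been found. -/
def solve : Cmd :=
  .seq (.rset 3 (.read 9 (.reg 7))) <|
  .seq (.ite (.rlt (.reg 3) (.reg 2)) (.rset 3 (.reg 2)) .skip) <|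
  .seq (.rset 4 (.div (.sub (.reg 3) (.read 8 (.reg 7))) (.read 7 (.reg 7)))) <|
  .seq (.rset 5 (.div (.sub (.reg 3) (.reg 0)) (.reg 1))) <|
  .ite (.rlt (.reg 5) (.reg 4))
    (.ite (.rlt (.reg 1) (.read 7 (.reg 7)))
      (.seq (.rset 6 (.add (.reg 3) (.div (.sub (.reg 4) (.reg 5))
          (.sub (.div (.const 1) (.reg 1)) (.div (.const 1) (.read 7 (.reg 7)))))))
        (.ite (.and (.ilt (.reg 8) (.reg 10)) (.rlt (.read 9 (.reg 8)) (.reg 6)))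
          (.rset 6 (.reg 7)) .skip))
      (.rset 6 (.reg 7)))
    (.rset 6 (.reg 3))

/-- Compute the lowest elevation of node `ireg 6` from which it can flow to a node with elevation
`rreg 0` at distance `rreg 1`; the result goes to `rreg 6`, and is `rreg 7` if there is none. -/
def search : Cmd :=
  .seq searchInit <|
  .seq (.loop (.ilt (.add (.reg 7) (.const 1)) (.reg 8)) bisect) solve

theorem searchInit_run {B : ℕ} {s : Store} (hp : s.ireg 6 ≤ B)
    (hoff : s.iarr 0 (s.ireg 6) + s.iarr 6 (s.ireg 6) ≤ B) :
    Run B searchInit s 20 fun s' =>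
      s'.rreg 2 = max (s.rreg 0) (s.rarr 2 (s.ireg 6)) ∧ s'.ireg 7 = s.iarr 0 (s.ireg 6) ∧
      s'.ireg 8 = s.iarr 0 (s.ireg 6) + s.iarr 6 (s.ireg 6) ∧
      s'.ireg 10 = s.iarr 0 (s.ireg 6) + s.iarr 6 (s.ireg 6) := by
  have e1 : s.iarr 0 (s.ireg 6) ≤ B := by omega
  have e2 : s.iarr 6 (s.ireg 6) ≤ B := by omega
  refine (Run.of_wp ?_).mono (by decide) fun _ _ h => h
  simp +contextual [searchInit, hp, hoff, e1, e2, le_of_lt]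

theorem bisect_run {B : ℕ} {s : Store} (hB : 2 ≤ B) (h : s.ireg 7 + s.ireg 8 ≤ B)
    (hd : s.rreg 1 ≠ 0) (hD : s.rarr 7 ((s.ireg 7 + s.ireg 8) / 2) ≠ 0) :
    Run B bisect s 50 fun s' => ∃ i, i = (s.ireg 7 + s.ireg 8) / 2 ∧
      ((s'.ireg 7 = s.ireg 7 ∧ s'.ireg 8 = i ∧ s.rreg 2 ≤ s.rarr 9 i ∧
        (s.rarr 7 i < s.rreg 1 ∨ slopeLine (s.rarr 7 i, s.rarr 8 i) (s.rarr 9 i) ≤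
          slopeLine (s.rreg 1, s.rreg 0) (s.rarr 9 i))) ∨
      (s'.ireg 7 = i ∧ s'.ireg 8 = s.ireg 8 ∧ (s.rarr 9 i < s.rreg 2 ∨ (s.rreg 1 ≤ s.rarr 7 i ∧
        slopeLine (s.rreg 1, s.rreg 0) (s.rarr 9 i) <
          slopeLine (s.rarr 7 i, s.rarr 8 i) (s.rarr 9 i))))) := by
  have e1 : s.ireg 7 ≤ B := by omega
  have e2 : s.ireg 8 ≤ B := by omega
  have e3 : (s.ireg 7 + s.ireg 8) / 2 ≤ B := by omega
  refine (Run.of_wp ?_).mono (by decide) fun _ _ h => h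
  simp [bisect, h, e1, e2, e3, hB, hd, hD]
  refine ⟨fun h1 h2 => Or.inl ⟨h1, ?_⟩, fun h1 => Or.inr ?_⟩
  · rcases lt_or_ge (s.rarr 7 ((s.ireg 7 + s.ireg 8) / 2)) (s.rreg 1) with h3 | h3
    · exact Or.inl h3
    · exact Or.inr (h2 h3)
  · rcases lt_or_ge (s.rarr 9 ((s.ireg 7 + s.ireg 8) / 2)) (s.rreg 2) with h3 | h3
    · exact Or.inl h3
    · exact Or.inr (h1 h3)

theorem solve_run {B : ℕ} {s : Store} (h7 : s.ireg 7 ≤ B) (h8 : s.ireg 8 ≤ B) (h10 : s.ireg 10 ≤ B)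
    (hd : 0 < s.rreg 1) (hD : 0 < s.rarr 7 (s.ireg 7)) {a : ℝ}
    (ha : a = max (s.rreg 2) (s.rarr 9 (s.ireg 7))) {g f : ℝ × ℝ} (hg : g = (s.rreg 1, s.rreg 0))
    (hf : f = (s.rarr 7 (s.ireg 7), s.rarr 8 (s.ireg 7))) :
    Run B solve s 60 fun s' =>
      (slopeLine f a ≤ slopeLine g a ∧ s'.rreg 6 = a) ∨
      (slopeLine g a < slopeLine f a ∧ g.1 < f.1 ∧
        s'.rreg 6 = a + (slopeLine f a - slopeLine g a) / (1 / g.1 - 1 / f.1) ∧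
        (s.ireg 8 < s.ireg 10 → s'.rreg 6 ≤ s.rarr 9 (s.ireg 8))) ∨
      (slopeLine g a < slopeLine f a ∧ (f.1 ≤ g.1 ∨ s.ireg 8 < s.ireg 10 ∧ g.1 < f.1 ∧
        s.rarr 9 (s.ireg 8) < a + (slopeLine f a - slopeLine g a) / (1 / g.1 - 1 / f.1)) ∧
        s'.rreg 6 = s.rreg 7) := by
  subst hg hf
  have hdiv : s.rreg 1 < s.rarr 7 (s.ireg 7) →
      (s.rreg 1)⁻¹ - (s.rarr 7 (s.ireg 7))⁻¹ ≠ 0 := fun h => by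
    have := inv_strictAnti₀ hd h
    exact (sub_pos.2 this).ne'
  simp only [slopeLine]
  -- Only the final `rreg 6` matters. An abstract predicate `P` keeps the precondition small while
  -- the branches of the program are separated.
  have key : ∀ P : ℝ → Prop,
      ((a - s.rarr 8 (s.ireg 7)) / s.rarr 7 (s.ireg 7) ≤ (a - s.rreg 0) / s.rreg 1 → P a) →
      ((a - s.rreg 0) / s.rreg 1 < (a - s.rarr 8 (s.ireg 7)) / s.rarr 7 (s.ireg 7) →
        (s.rreg 1 < s.rarr 7 (s.ireg 7) → ∀ y, y = a + ((a - s.rarr 8 (s.ireg 7)) /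
          s.rarr 7 (s.ireg 7) - (a - s.rreg 0) / s.rreg 1) /
            ((s.rreg 1)⁻¹ - (s.rarr 7 (s.ireg 7))⁻¹) →
          ((s.ireg 8 < s.ireg 10 → y ≤ s.rarr 9 (s.ireg 8)) → P y) ∧
          (s.ireg 8 < s.ireg 10 → s.rarr 9 (s.ireg 8) < y → P (s.rreg 7))) ∧
        (s.rarr 7 (s.ireg 7) ≤ s.rreg 1 → P (s.rreg 7))) →
      solve.wp B s fun s' => P (s'.rreg 6) := by
    intro P hP1 hP2
    rcases lt_or_ge (s.rarr 9 (s.ireg 7)) (s.rreg 2) with h1 | h1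
    · rw [ha.trans (max_eq_left h1.le)] at hP1 hP2
      simp [solve, h7, h8, h10, hd.ne', hD.ne', h1]
      refine ⟨fun h2 => ⟨fun h3 => ⟨hdiv h3, fun h4 h5 => ?_, fun h4 => ?_⟩, (hP2 h2).2⟩, hP1⟩
      · exact ((hP2 h2).1 h3 _ rfl).2 h4 h5
      · exact ((hP2 h2).1 h3 _ rfl).1 h4
    · rw [ha.trans (max_eq_right h1)] at hP1 hP2
      simp [solve, h7, h8, h10, hd.ne', hD.ne', h1.not_gt]
      refine ⟨fun h2 => ⟨fun h3 => ⟨hdiv h3, fun h4 h5 => ?_, fun h4 => ?_⟩, (hP2 h2).2⟩, hP1⟩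
      · exact ((hP2 h2).1 h3 _ rfl).2 h4 h5
      · exact ((hP2 h2).1 h3 _ rfl).1 h4
  refine (Run.of_wp (key (fun y => _ ∧ y = _ ∨ _ ∧ _ ∧ y = _ ∧ (_ → y ≤ _) ∨ _ ∧ _ ∧ y = _)
    (fun h => Or.inl ⟨h, rfl⟩) fun h => ⟨fun h1 y hy => ⟨fun h2 => ?_, fun h2 h3 => ?_⟩,
      fun h1 => ?_⟩)).mono (by decide) fun _ _ h => h
  · simp only [one_div]
    exact Or.inr (Or.inl ⟨h, h1, hy, h2⟩)
  · simp only [one_div]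
    exact Or.inr (Or.inr ⟨h, Or.inr ⟨h2, h1, hy ▸ h3⟩, trivial⟩)
  · exact Or.inr (Or.inr ⟨h, Or.inl h1, rfl⟩)

theorem search_run {B : ℕ} {s : Store} {lines : Set (ℝ × ℝ)} (hB : 2 ≤ B)
    (hp : s.ireg 6 ≤ B) (hk : 0 < s.iarr 6 (s.ireg 6))
    (hoff : 2 * (s.iarr 0 (s.ireg 6) + s.iarr 6 (s.ireg 6)) ≤ B)
    (hE : IsEnvelope lines ∅ (s.rarr 2 (s.ireg 6)) (s.iarr 6 (s.ireg 6))
      (fun i => s.rarr 7 (s.iarr 0 (s.ireg 6) + i)) (fun i => s.rarr 8 (s.iarr 0 (s.ireg 6) + i))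
      (fun i => s.rarr 9 (s.iarr 0 (s.ireg 6) + i)))
    (hpos : ∀ l ∈ lines, 0 < l.1) (hd : 0 < s.rreg 1) :
    Run B search s (80 * Nat.size (s.iarr 6 (s.ireg 6)) + 140) fun s' =>
      IsLeast {y | max (s.rreg 0) (s.rarr 2 (s.ireg 6)) ≤ y ∧
        ∀ l ∈ lines, slopeLine l y ≤ slopeLine (s.rreg 1, s.rreg 0) y} (s'.rreg 6) ∨
      s'.rreg 6 = s.rreg 7 ∧ ∀ y, ¬ (max (s.rreg 0) (s.rarr 2 (s.ireg 6)) ≤ y ∧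
        ∀ l ∈ lines, slopeLine l y ≤ slopeLine (s.rreg 1, s.rreg 0) y) := by
  generalize hpe : s.ireg 6 = p at *
  generalize hoe : s.iarr 0 p = o at *
  generalize hke : s.iarr 6 p = k at *
  generalize hze : s.rreg 0 = z at *
  generalize hde : s.rreg 1 = d at *
  generalize hye : max z (s.rarr 2 p) = y₀ at *
  have hD : ∀ i < k, 0 < s.rarr 7 (o + i) := fun i hi => hpos _ (hE.mem i hi)
  refine Run.seq ((searchInit_run (hpe ▸ hp) (by rw [hpe, hoe, hke]; omega)).mono le_rfl
    fun s₁ hF₁ ⟨hy₁, h7, h8, h10⟩ => ?_) (show 20 + (80 * Nat.size k + 120) ≤ _ by omega)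
  have hr₁ : s₁.rarr = s.rarr := funext fun a => hF₁.rarr a (by simp [searchInit])
  have hd₁ : s₁.rreg 1 = d := (hF₁.rreg 1 (by decide)).trans hde
  have hz₁ : s₁.rreg 0 = z := (hF₁.rreg 0 (by decide)).trans hze
  have hM₁ : s₁.rreg 7 = s.rreg 7 := hF₁.rreg 7 (by decide)
  rw [hpe, hze, hye] at hy₁
  rw [hpe, hoe] at h7
  rw [hpe, hoe, hke] at h8 h10
  clear hF₁
  -- The range from `i` to `j` satisfies `hleft` and `hright` of `IsEnvelope.isLeast_above`,
  -- vacuously at first, when `i = 0` and `j = k`. Both outcomes of the test preserve this, so no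
  -- monotonicity of the test along the envelope is needed.
  refine Run.seq ((Run.loop (fun s' => ∃ i j, s'.ireg 7 = o + i ∧ s'.ireg 8 = o + j ∧
    i < j ∧ j ≤ k ∧
    (0 < i → s.rarr 9 (o + i) < y₀ ∨ (d ≤ s.rarr 7 (o + i) ∧ slopeLine (d, z) (s.rarr 9 (o + i)) <
      slopeLine (s.rarr 7 (o + i), s.rarr 8 (o + i)) (s.rarr 9 (o + i)))) ∧
    (j < k → y₀ ≤ s.rarr 9 (o + j) ∧ (s.rarr 7 (o + j) < d ∨
      slopeLine (s.rarr 7 (o + j), s.rarr 8 (o + j)) (s.rarr 9 (o + j)) ≤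
        slopeLine (d, z) (s.rarr 9 (o + j))))) (fun s' => 80 * Nat.size (s'.ireg 8 - s'.ireg 7 - 1))
    ?_ ?_ ?_).mono le_rfl fun s₂ hF₂ ⟨⟨i, j, hi, hj, hij, hjk, hl, hr⟩, hb⟩ =>
      (solve_run ?_ ?_ ?_ ?_ ?_ rfl rfl rfl).mono le_rfl fun s₃ _ hs₃ => ?_) ?_
  · exact ⟨0, k, h7, h8, hk, le_rfl, by omega, by omega⟩
  · rintro s' hF ⟨i, j, hi, hj, hij, hjk, -⟩
    simp; omega
  · rintro s' hF ⟨i, j, hi, hj, hij, hjk, hl, hr⟩ hb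
    simp at hb
    have hr' : s'.rarr = s.rarr := (funext fun a => hF.rarr a (by simp [bisect])).trans hr₁
    have hd' : s'.rreg 1 = d := (hF.rreg 1 (by decide)).trans hd₁
    have hz' : s'.rreg 0 = z := (hF.rreg 0 (by decide)).trans hz₁
    have hy' : s'.rreg 2 = y₀ := (hF.rreg 2 (by decide)).trans hy₁
    have hmid : (s'.ireg 7 + s'.ireg 8) / 2 = o + (i + j) / 2 := by omega
    refine ⟨50, (bisect_run hB (by omega) (hd' ▸ hd.ne') ?_).mono le_rfl fun s'' _ hs => ?_⟩
    · rw [hmid, hr']; exact (hD _ (by omega)).ne'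
    · rw [hmid, hr', hd', hz', hy'] at hs
      have hsz := size_div_two_lt (show 0 < j - i - 1 by omega)
      obtain ⟨_, rfl, ⟨h1, h2, h3⟩ | ⟨h1, h2, h3⟩⟩ := hs
      · refine ⟨⟨i, (i + j) / 2, h1.trans hi, h2, by omega, by omega, hl, fun _ => h3⟩, ?_⟩
        have : Nat.size ((i + j) / 2 - i - 1) ≤ Nat.size ((j - i - 1) / 2) :=
          Nat.size_le_size (by omega)
        simp only [BExp.cost, IExp.cost]
        rw [h1, h2, hi, hj, show o + (i + j) / 2 - (o + i) - 1 = (i + j) / 2 - i - 1 by omega,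
          show o + j - (o + i) - 1 = j - i - 1 by omega]
        omega
      · refine ⟨⟨(i + j) / 2, j, h1, h2.trans hj, by omega, by omega, fun _ => h3, hr⟩, ?_⟩
        have : Nat.size (j - (i + j) / 2 - 1) ≤ Nat.size ((j - i - 1) / 2) :=
          Nat.size_le_size (by omega)
        simp only [BExp.cost, IExp.cost]
        rw [h1, h2, hi, hj, show o + j - (o + (i + j) / 2) - 1 = j - (i + j) / 2 - 1 by omega,
          show o + j - (o + i) - 1 = j - i - 1 by omega]
        omega
  · omega
  · omega
  · rw [hF₂.ireg 10 (by decide)]; omega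
  · rw [hF₂.rreg 1 (by decide), hd₁]; exact hd
  · rw [hF₂.rarr 7 (by decide), hr₁, hi]; exact hD i (by omega)
  · simp at hb
    obtain rfl : j = i + 1 := by omega
    rw [hF₂.rarr 7 (by decide), hF₂.rarr 8 (by decide), hF₂.rarr 9 (by decide), hr₁, hi, hj,
      hF₂.rreg 0 (by decide), hF₂.rreg 1 (by decide), hF₂.rreg 2 (by decide),
      hF₂.rreg 7 (by decide), hF₂.ireg 10 (by decide), hz₁, hd₁, hy₁, hM₁, h10,
      Nat.add_lt_add_iff_left] at hs₃
    have hlo : s.rarr 2 p ≤ y₀ := hye ▸ le_max_right _ _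
    rcases hs₃ with h | h | ⟨h1, h2, h3⟩
    · exact Or.inl (hE.isLeast_above hpos (g := (d, z)) hd hlo (by omega) hl hr rfl (Or.inl h))
    · exact Or.inl (hE.isLeast_above hpos (g := (d, z)) hd hlo (by omega) hl hr rfl (Or.inr h))
    · exact Or.inr ⟨h3, hE.not_above hpos (g := (d, z)) hd hlo (by omega) hl hr rfl h1 h2⟩
  · have : Nat.size (s₁.ireg 8 - s₁.ireg 7 - 1) ≤ Nat.size k := Nat.size_le_size (by omega)
    simp only [BExp.cost, IExp.cost]
    omega

end RealRAM

/-! ### The input -/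

theorem List.getElem?_flatten_sum_add {α : Type*} (L : List (List α)) {i j : ℕ} (hi : i < L.length)
    (hj : j < L[i].length) :
    L.flatten[((L.take i).map List.length).sum + j]? = some L[i][j] := by
  induction L generalizing i with
  | nil => simp at hi
  | cons l L ih =>
    cases i with
    | zero =>
      simp only [List.getElem_cons_zero] at hj
      simp [List.getElem?_append_left hj, List.getElem?_eq_getElem hj]
    | succ i =>
      have h := ih (i := i) (by simpa using hi) (by simpa using hj)
      rw [List.flatten_cons, List.take_succ_cons, List.map_cons, List.sum_cons,
        List.getElem?_append_right (by omega)]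
      exact (congrArg (fun k => L.flatten[k]?) (by omega)).trans h

namespace RealRAM

open ImpreciseTerrain

/-- The arrays `off` and `nbr` represent the graph of `T`: the neighbors of `v` are listed in
`nbr` from position `off v` up to position `off (v + 1)`. -/
structure IsAdjacencyArray {m : ℕ} (T : ImpreciseTerrain (Fin m)) (off nbr : ℕ → ℕ) : Prop where
  off_zero : off 0 = 0
  off_le : ∀ v < m, off v ≤ off (v + 1)
  off_last : off m = 2 * T.numEdges
  adj : ∀ (v : Fin m) (e : ℕ), off v ≤ e → e < off (v + 1) → ∃ w : Fin m, nbr e = w ∧ T.graph.Adj v w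
  exists_eq : ∀ v w : Fin m, T.graph.Adj v w → ∃ e, off v ≤ e ∧ e < off (v + 1) ∧ nbr e = w

namespace IsAdjacencyArray

variable {m : ℕ} {T : ImpreciseTerrain (Fin m)} {off nbr : ℕ → ℕ}

theorem off_mono (h : IsAdjacencyArray T off nbr) {u v : ℕ} (huv : u ≤ v) (hv : v ≤ m) :
    off u ≤ off v := by
  induction v, huv using Nat.le_induction with
  | base => exact le_rfl
  | succ v _ ih => exact (ih (by omega)).trans (h.off_le v (by omega))

theorem off_le_last (h : IsAdjacencyArray T off nbr) {v : ℕ} (hv : v ≤ m) :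
    off v ≤ 2 * T.numEdges :=
  h.off_last ▸ h.off_mono hv le_rfl

/-- Without isolated nodes, every node owns at least one adjacency entry. This lets the number of
edges bound all the work done per node. -/
theorem le_two_mul_numEdges (h : IsAdjacencyArray T off nbr) (hT : ∀ v, ∃ w, T.graph.Adj v w) :
    m ≤ 2 * T.numEdges := by
  have : ∀ v ≤ m, v ≤ off v := by
    intro v
    induction v with
    | zero => omega
    | succ v ih =>
      intro hv
      obtain ⟨w, hw⟩ := hT ⟨v, hv⟩
      obtain ⟨e, h1, h2, -⟩ := h.exists_eq _ _ hw
      have := ih (by omega)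
      simp only at h1 h2
      omega
  rw [← h.off_last]
  exact this m le_rfl

end IsAdjacencyArray

theorem isAdjacencyArray_inputStore {m : ℕ} (T : ImpreciseTerrain (Fin m))
    {adj : Fin m → List (Fin m)} (h : IsAdjacencyLists T adj) :
    IsAdjacencyArray T ((inputStore T adj).iarr 0) ((inputStore T adj).iarr 1) := by
  have hoff : ∀ i ≤ m, (inputStore T adj).iarr 0 i =
      ∑ v : Fin m, (if v.val < i then (adj v).length else 0) := fun i hi => by
    simp [inputStore, hi]
  have hsucc : ∀ v : Fin m, (inputStore T adj).iarr 0 (v + 1) =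
      (inputStore T adj).iarr 0 v + (adj v).length := fun v => by
    rw [hoff _ v.2, hoff _ v.2.le]
    have : ∀ w : Fin m, (if w.val < v + 1 then (adj w).length else 0) =
        (if w.val < v then (adj w).length else 0) + if v = w then (adj w).length else 0 := by
      intro w
      rcases lt_trichotomy w v with hw | rfl | hw
      · simp [hw, hw.ne', Nat.lt_succ_of_lt hw]
      · simp
      · have : ¬ w.val < v + 1 := by omega
        simp [this, hw.ne, hw.not_gt]
    rw [Finset.sum_congr rfl fun w _ => this w, Finset.sum_add_distrib]
    simp
  have htake : ∀ i ≤ m, (inputStore T adj).iarr 0 i =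
      (((List.ofFn adj).take i).map List.length).sum := by
    intro i
    induction i with
    | zero => intro _; rw [hoff 0 (by omega)]; simp
    | succ i ih =>
      intro hi
      rw [hsucc ⟨i, hi⟩, ih (by omega), List.take_add_one]
      simp [show i < m by omega]
  have hget : ∀ (v : Fin m) (j : ℕ) (hj : j < (adj v).length),
      (inputStore T adj).iarr 1 ((inputStore T adj).iarr 0 v + j) = (adj v)[j] := by
    intro v j hj
    have h1 := List.getElem?_flatten_sum_add (List.ofFn adj) (i := v) (j := j) (by simp)
      (by simpa using hj)
    rw [← htake v v.2.le] at h1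
    have h2 : ∀ i, (inputStore T adj).iarr 1 i =
        (((List.ofFn adj).flatten).map Fin.val).getD i 0 := fun i => by simp [inputStore]
    rw [h2, List.getD_eq_getElem?_getD, List.getElem?_map, h1]
    simp
  refine ⟨by rw [hoff 0 (by omega)]; simp, fun v hv => ?_, ?_, fun v e h1 h2 => ?_,
    fun v w hvw => ?_⟩
  · rw [hsucc ⟨v, hv⟩]; exact Nat.le_add_right _ _
  · rw [hoff m le_rfl, ← T.sum_deg]
    refine Finset.sum_congr rfl fun v _ => ?_
    rw [if_pos v.2, deg, ← List.toFinset_card_of_nodup (h v).1, ← Set.ncard_coe_finset]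
    congr 1
    ext w
    simp [(h v).2 w, SimpleGraph.adj_comm]
  · obtain ⟨j, rfl⟩ := Nat.exists_eq_add_of_le h1
    rw [hsucc] at h2
    have hj : j < (adj v).length := by omega
    exact ⟨_, hget v j hj, ((h v).2 _).1 (List.getElem_mem hj)⟩
  · obtain ⟨j, hj, e⟩ := List.getElem_of_mem (((h v).2 w).2 hvw)
    exact ⟨(inputStore T adj).iarr 0 v + j, Nat.le_add_right _ _, by rw [hsucc]; omega,
      by rw [hget v j hj, e]⟩

/-- The distance of the nodes `ireg a` and `ireg b`. -/
def distExp (a b : ℕ) : RExp :=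
  .sqrt (.add (.mul (.sub (.read 0 (.reg a)) (.read 0 (.reg b)))
      (.sub (.read 0 (.reg a)) (.read 0 (.reg b))))
    (.mul (.sub (.read 1 (.reg a)) (.read 1 (.reg b)))
      (.sub (.read 1 (.reg a)) (.read 1 (.reg b)))))

theorem distExp_ok {B a b : ℕ} {s : Store} (ha : s.ireg a ≤ B) (hb : s.ireg b ≤ B) :
    (distExp a b).Ok B s := by
  simp [distExp, ha, hb]
  exact add_nonneg (mul_self_nonneg _) (mul_self_nonneg _)

/-- The real arrays 0 to 3 hold the positions and the elevation bounds of the nodes. -/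
structure HoldsTerrain {m : ℕ} (T : ImpreciseTerrain (Fin m)) (s : Store) : Prop where
  x : ∀ v : Fin m, s.rarr 0 v = T.pos v 0
  y : ∀ v : Fin m, s.rarr 1 v = T.pos v 1
  low : ∀ v : Fin m, s.rarr 2 v = T.low v
  high : ∀ v : Fin m, s.rarr 3 v = T.high v

theorem holdsTerrain_inputStore {m : ℕ} (T : ImpreciseTerrain (Fin m))
    (adj : Fin m → List (Fin m)) : HoldsTerrain T (inputStore T adj) := by
  constructor <;> intro v <;> simp [inputStore]

theorem HoldsTerrain.congr {m : ℕ} {T : ImpreciseTerrain (Fin m)} {s s' : Store}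
    (h : HoldsTerrain T s) (h0 : s'.rarr 0 = s.rarr 0) (h1 : s'.rarr 1 = s.rarr 1)
    (h2 : s'.rarr 2 = s.rarr 2) (h3 : s'.rarr 3 = s.rarr 3) : HoldsTerrain T s' :=
  ⟨by rw [h0]; exact h.x, by rw [h1]; exact h.y, by rw [h2]; exact h.low, by rw [h3]; exact h.high⟩

theorem distExp_eval {m : ℕ} {T : ImpreciseTerrain (Fin m)} {s : Store} (h : HoldsTerrain T s)
    {a b : ℕ} {v w : Fin m} (ha : s.ireg a = v) (hb : s.ireg b = w) :
    (distExp a b).eval s = dist (T.pos v) (T.pos w) := by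
  simp [distExp, ha, hb, h.x, h.y, EuclideanSpace.dist_eq, Real.dist_eq, Fin.sum_univ_two, sq_abs]
  congr 1
  ring

end RealRAM

namespace RealRAM

/-! ### Envelopes of all nodes, stored in a common array -/

/-- Every item `e < N` lies in the segment from `off p` to `off (p + 1)` of its owner `p < m`. -/
structure IsPartition (N m : ℕ) (off own : ℕ → ℕ) : Prop where
  mono : ∀ u v, u ≤ v → v ≤ m → off u ≤ off v
  own_lt : ∀ e < N, own e < m
  off_le : ∀ e < N, off (own e) ≤ e
  lt_off : ∀ e < N, e < off (own e + 1)

/-- The lines of the items of `p` that have been removed, that is, have key 1. -/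
def removedLines (N : ℕ) (own : ℕ → ℕ) (line : ℕ → ℝ × ℝ) (key : ℕ → ℝ) (p : ℕ) : Set (ℝ × ℝ) :=
  {l | ∃ e < N, own e = p ∧ key e = 1 ∧ l = line e}

/-- The line of the item `top`, if it belongs to `p` and has not been removed. -/
def pendingLine (own : ℕ → ℕ) (line : ℕ → ℝ × ℝ) (key : ℕ → ℝ) (top p : ℕ) : Set (ℝ × ℝ) :=
  {l | key top ≠ 1 ∧ own top = p ∧ l = line top}

/-- For every node `p < m`, the envelope of the removed lines of `p` is stored in the first `cnt p`
cells of its segment. -/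
structure HullInv (N m : ℕ) (off own : ℕ → ℕ) (line : ℕ → ℝ × ℝ) (lo : ℕ → ℝ) (key : ℕ → ℝ)
    (top : ℕ) (cnt : ℕ → ℕ) (D H BP : ℕ → ℝ) : Prop where
  env : ∀ p < m, IsEnvelope (removedLines N own line key p) (pendingLine own line key top p) (lo p)
    (cnt p) (fun i => D (off p + i)) (fun i => H (off p + i)) (fun i => BP (off p + i))
  cnt_le : ∀ p < m, cnt p ≤ ((Finset.range N).filter fun e => own e = p ∧ key e = 1).card
  dist_le : ∀ p < m, ∀ i < cnt p, ∀ e < N, own e = p → key e ≠ 1 → (line e).1 ≤ D (off p + i)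

namespace HullInv

variable {N m : ℕ} {off own : ℕ → ℕ} {line : ℕ → ℝ × ℝ} {lo key : ℕ → ℝ} {top : ℕ} {cnt : ℕ → ℕ}
  {D H BP : ℕ → ℝ}

theorem card_owned_le (hS : IsPartition N m off own) (p : ℕ) (hp : p < m) :
    off p + ((Finset.range N).filter fun e => own e = p).card ≤ off (p + 1) := by
  have h1 : ((Finset.range N).filter fun e => own e = p) ⊆ Finset.Ico (off p) (off (p + 1)) := by
    intro e he'
    obtain ⟨he, rfl⟩ := Finset.mem_filter.1 he'
    replace he := Finset.mem_range.1 he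
    exact Finset.mem_Ico.2 ⟨hS.off_le e he, hS.lt_off e he⟩
  have h2 := Finset.card_le_card h1
  have h3 := hS.mono p (p + 1) (by omega) (by omega)
  rw [Nat.card_Ico] at h2
  omega

theorem add_cnt_le (hS : IsPartition N m off own)
    (h : HullInv N m off own line lo key top cnt D H BP) {p : ℕ} (hp : p < m) :
    off p + cnt p ≤ off (p + 1) := by
  have h1 := card_owned_le hS p hp
  have h2 := h.cnt_le p hp
  have h3 : ((Finset.range N).filter fun e => own e = p ∧ key e = 1).card ≤
      ((Finset.range N).filter fun e => own e = p).card :=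
    Finset.card_le_card fun e he => by
      simp only [Finset.mem_filter] at he ⊢
      exact ⟨he.1, he.2.1⟩
  omega

/-- An unremoved item has not been put on the stack of its owner, so the segment of the owner still
has a free cell for it. -/
theorem add_cnt_lt (hS : IsPartition N m off own)
    (h : HullInv N m off own line lo key top cnt D H BP) {e : ℕ} (he : e < N) (hk : key e ≠ 1) :
    off (own e) + cnt (own e) < off (own e + 1) := by
  have h1 := card_owned_le hS _ (hS.own_lt e he)
  have h2 := h.cnt_le _ (hS.own_lt e he)
  have h3 : ((Finset.range N).filter fun e' => own e' = own e ∧ key e' = 1).card <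
      ((Finset.range N).filter fun e' => own e' = own e).card := by
    refine Finset.card_lt_card ⟨fun e' he' => ?_, fun hsub => ?_⟩
    · simp only [Finset.mem_filter] at he' ⊢
      exact ⟨he'.1, he'.2.1⟩
    · have := hsub (Finset.mem_filter.2 ⟨Finset.mem_range.2 he, rfl⟩)
      exact hk (Finset.mem_filter.1 this).2.2
  omega

theorem pendingLine_top (hk : key top ≠ 1) :
    pendingLine own line key top (own top) = {line top} := by
  ext l; simp [pendingLine, hk]

/-- Drop the last line of the envelope of the owner of `top`. -/
theorem pop (h : HullInv N m off own line lo key top cnt D H BP) (hk : key top ≠ 1)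
    (htop : top < N) (hp : own top < m) (hpos : 0 < (line top).1) (hc : 0 < cnt (own top))
    (hle : slopeLine (D (off (own top) + (cnt (own top) - 1)), H (off (own top) + (cnt (own top) - 1)))
      (BP (off (own top) + (cnt (own top) - 1))) ≤
      slopeLine (line top) (BP (off (own top) + (cnt (own top) - 1)))) :
    HullInv N m off own line lo key top (Function.update cnt (own top) (cnt (own top) - 1))
      D H BP := by
  refine ⟨fun p hpm => ?_, fun p hpm => ?_, fun p hpm i hi => ?_⟩
  · by_cases e : p = own top
    · subst e
      have h1 := h.env _ hp
      rw [Function.update_self]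
      rw [pendingLine_top hk] at h1 ⊢
      exact h1.pop hc hpos (h.dist_le _ hp _ (by omega) _ htop rfl hk) hle
    · rw [Function.update_of_ne e]; exact h.env p hpm
  · by_cases e : p = own top
    · subst e; rw [Function.update_self]
      exact (Nat.sub_le _ _).trans (h.cnt_le _ hpm)
    · rw [Function.update_of_ne e]; exact h.cnt_le p hpm
  · refine h.dist_le p hpm i ?_
    by_cases e : p = own top
    · subst e; rw [Function.update_self] at hi; omega
    · rwa [Function.update_of_ne e] at hi

/-- Remove the item `top` after its line has been added to the envelope of its owner. -/
theorem remove (hS : IsPartition N m off own)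
    (h : HullInv N m off own line lo key top cnt D H BP) (hk : key top ≠ 1) (htop : top < N)
    (hmax : ∀ e < N, key e ≠ 1 → (line e).1 ≤ (line top).1) {cnt' : ℕ → ℕ} {D' H' BP' : ℕ → ℝ}
    (hcnt : ∀ p, p ≠ own top → cnt' p = cnt p) (hcnt' : cnt' (own top) ≤ cnt (own top) + 1)
    (hD : ∀ i, i ≠ off (own top) + cnt (own top) → D' i = D i)
    (hH : ∀ i, i ≠ off (own top) + cnt (own top) → H' i = H i)
    (hBP : ∀ i, i ≠ off (own top) + cnt (own top) → BP' i = BP i)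
    (hD' : ∀ i < cnt' (own top), (line top).1 ≤ D' (off (own top) + i))
    (henv : IsEnvelope (insert (line top) (removedLines N own line key (own top))) ∅ (lo (own top))
      (cnt' (own top)) (fun i => D' (off (own top) + i)) (fun i => H' (off (own top) + i))
      (fun i => BP' (off (own top) + i))) (top' : ℕ) :
    HullInv N m off own line lo (Function.update key top 1) top' cnt' D' H' BP' := by
  have hpm := hS.own_lt top htop
  have hkey : ∀ e, Function.update key top 1 e = 1 ↔ key e = 1 ∨ e = top := fun e => by
    by_cases he : e = top
    · simp [he]
    · simp [he]
  -- The one cell that may be overwritten is in the segment of the owner of `top`, hence in no other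
  -- envelope.
  have hne : ∀ p < m, p ≠ own top → ∀ i < cnt p,
      off p + i ≠ off (own top) + cnt (own top) := by
    intro p hp hne i hi
    have h1 := h.add_cnt_le hS hp
    have h2 := h.add_cnt_lt hS htop hk
    rcases Nat.lt_or_gt_of_ne hne with hlt | hlt
    · have := hS.mono (p + 1) (own top) (by omega) (by omega)
      omega
    · have := hS.mono (own top + 1) p (by omega) (by omega)
      omega
  refine ⟨fun p hp => ?_, fun p hp => ?_, fun p hp i hi e he hep hke => ?_⟩
  · by_cases e : p = own top
    · subst e
      have : removedLines N own line (Function.update key top 1) (own top) =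
          insert (line top) (removedLines N own line key (own top)) := by
        ext l
        simp only [removedLines, Set.mem_ofPred_eq, Set.mem_insert_iff, hkey]
        constructor
        · rintro ⟨e, he, h1, h2 | rfl, rfl⟩
          exacts [Or.inr ⟨e, he, h1, h2, rfl⟩, Or.inl rfl]
        · rintro (rfl | ⟨e, he, h1, h2, rfl⟩)
          exacts [⟨top, htop, rfl, Or.inr rfl, rfl⟩, ⟨e, he, h1, Or.inl h2, rfl⟩]
      rw [this]
      exact henv.mono_pend (Set.empty_subset _)
    · have h1 : removedLines N own line (Function.update key top 1) p =
          removedLines N own line key p := by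
        ext l
        simp only [removedLines, Set.mem_ofPred_eq, hkey]
        constructor
        · rintro ⟨e', he, h1, h2 | rfl, rfl⟩
          exacts [⟨e', he, h1, h2, rfl⟩, absurd h1.symm e]
        · rintro ⟨e', he, h1, h2, rfl⟩
          exact ⟨e', he, h1, Or.inl h2, rfl⟩
      have h2 : pendingLine own line key top p = ∅ := by
        ext l; simp [pendingLine, Ne.symm e]
      have h3 := h.env p hp
      rw [h2] at h3
      rw [h1, hcnt p e]
      exact (h3.congr (fun i hi => hD _ (hne p hp e i hi)) (fun i hi => hH _ (hne p hp e i hi))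
        fun i hi => hBP _ (hne p hp e i hi)).mono_pend (Set.empty_subset _)
  · by_cases e : p = own top
    · subst e
      have : ((Finset.range N).filter fun e => own e = own top ∧ Function.update key top 1 e = 1) =
          insert top ((Finset.range N).filter fun e => own e = own top ∧ key e = 1) := by
        ext e
        simp only [Finset.mem_filter, Finset.mem_insert, hkey, Finset.mem_range]
        constructor
        · rintro ⟨h1, h2, h3 | h3⟩
          exacts [Or.inr ⟨h1, h2, h3⟩, Or.inl h3]
        · rintro (rfl | ⟨h1, h2, h3⟩)
          exacts [⟨htop, rfl, Or.inr rfl⟩, ⟨h1, h2, Or.inl h3⟩]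
      rw [this, Finset.card_insert_of_notMem (by simp [hk])]
      have := h.cnt_le _ hp
      omega
    · rw [hcnt p e]
      refine (h.cnt_le p hp).trans (Finset.card_le_card fun e' he => ?_)
      simp only [Finset.mem_filter, hkey] at he ⊢
      exact ⟨he.1, he.2.1, Or.inl he.2.2⟩
  · have hke' : key e ≠ 1 := fun h1 => hke ((hkey e).2 (Or.inl h1))
    by_cases e' : p = own top
    · subst e'
      -- Items are removed by decreasing distance, so the remaining ones are no farther than any
      -- line kept on the stack.
      exact (hmax e he hke').trans (hD' i hi)
    · rw [hcnt p e'] at hi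
      rw [hD _ (hne p hp e' i hi)]
      exact h.dist_le p hp i hi e he hep hke'

end HullInv

end RealRAM

namespace RealRAM

open ImpreciseTerrain

variable {m : ℕ} {T : ImpreciseTerrain (Fin m)}

/-! ### The precomputation -/

/-- The input of the computation is in memory. -/
structure HoldsInput (T : ImpreciseTerrain (Fin m)) (s : Store) : Prop where
  count : s.ireg 0 = m
  graph : IsAdjacencyArray T (s.iarr 0) (s.iarr 1)
  terrain : HoldsTerrain T s

/-- Position of the node with number `i`. -/
noncomputable def posAt (T : ImpreciseTerrain (Fin m)) (i : ℕ) : EuclideanSpace ℝ (Fin 2) :=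
  if h : i < m then T.pos ⟨i, h⟩ else 0

theorem posAt_val (v : Fin m) : posAt T v = T.pos v := by simp [posAt]

theorem distExp_eval_posAt {s : Store} (h : HoldsTerrain T s) {a b : ℕ} (ha : s.ireg a < m)
    (hb : s.ireg b < m) :
    (distExp a b).eval s = dist (posAt T (s.ireg a)) (posAt T (s.ireg b)) := by
  rw [distExp_eval h (v := ⟨_, ha⟩) (w := ⟨_, hb⟩) rfl rfl, ← posAt_val, ← posAt_val]

/-- One step of the scan over the adjacency lists: record the owner `ireg 4` and the key of entry
`ireg 5`, or move on to the next node. -/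
def fillStep : Cmd :=
  .ite (.ilt (.reg 5) (.read 0 (.add (.reg 4) (.const 1))))
    (.seq (.iwrite 5 (.reg 5) (.reg 4)) <|
      .seq (.iset 6 (.read 1 (.reg 5))) <|
      .seq (.rwrite 6 (.add (.reg 2) (.reg 5)) (.sub (.const 0) (distExp 4 6))) <|
      .seq (.iwrite 4 (.add (.reg 2) (.reg 5)) (.reg 5)) (.iset 5 (.add (.reg 5) (.const 1))))
    (.iset 4 (.add (.reg 4) (.const 1)))

theorem fillStep_run {B : ℕ} {s : Store} (h : HoldsTerrain T s) (h4 : s.ireg 4 < m)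
    (h1 : s.iarr 1 (s.ireg 5) < m) (hB : s.ireg 2 + s.ireg 5 < B) (hm : m ≤ B)
    (hoff : s.iarr 0 (s.ireg 4 + 1) ≤ B) :
    Run B fillStep s 60 fun s' =>
      (s.ireg 5 < s.iarr 0 (s.ireg 4 + 1) ∧ s'.ireg 4 = s.ireg 4 ∧ s'.ireg 5 = s.ireg 5 + 1 ∧
        s'.iarr 5 = Function.update (s.iarr 5) (s.ireg 5) (s.ireg 4) ∧
        s'.iarr 4 = Function.update (s.iarr 4) (s.ireg 2 + s.ireg 5) (s.ireg 5) ∧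
        s'.rarr 6 = Function.update (s.rarr 6) (s.ireg 2 + s.ireg 5)
          (-dist (posAt T (s.ireg 4)) (posAt T (s.iarr 1 (s.ireg 5))))) ∨
      (s.iarr 0 (s.ireg 4 + 1) ≤ s.ireg 5 ∧ s'.ireg 4 = s.ireg 4 + 1 ∧ s'.ireg 5 = s.ireg 5 ∧
        s'.iarr 5 = s.iarr 5 ∧ s'.iarr 4 = s.iarr 4 ∧ s'.rarr 6 = s.rarr 6) := by
  refine (Run.of_wp ?_).mono (by decide) fun _ _ h => h
  have e1 : s.ireg 4 < B := by omega
  have e2 : s.ireg 5 < B := by omega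
  have e3 : s.iarr 1 (s.ireg 5) ≤ B := by omega
  have e4 : s.ireg 2 ≤ B := by omega
  have e5 : 1 ≤ B := by omega
  simp [fillStep, e1, e1.le, e2, e2.le, e3, e4, e5, hB.le, hoff]
  refine fun hlt => ⟨?_, hlt, ?_⟩
  · refine distExp_ok ?_ ?_ <;> simp [e1.le, e3]
  · congr 2
    refine (distExp_eval_posAt (T := T) ?_ ?_ ?_).trans ?_
    · exact ⟨h.x, h.y, h.low, h.high⟩
    all_goals simp [h1, h4]

/-- Set up a tournament of all entries of the adjacency lists, in order of decreasing distance. -/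
def fill : Cmd :=
  .seq (.seq (.iset 2 (.read 0 (.reg 0))) (.seq (.iset 4 (.const 0)) (.iset 5 (.const 0))))
    (.loop (.ilt (.reg 5) (.reg 2)) fillStep)

/-- The line that the entry `e` of the adjacency lists contributes to the envelope of its owner. -/
noncomputable def entryLine (T : ImpreciseTerrain (Fin m)) (own nbr : ℕ → ℕ) (high : ℕ → ℝ)
    (e : ℕ) : ℝ × ℝ :=
  (dist (posAt T (own e)) (posAt T (nbr e)), high (nbr e))

theorem fill_run {B : ℕ} {s : Store} (h : HoldsInput T s) (hm : m ≤ 2 * T.numEdges)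
    (hB : 2 * (2 * T.numEdges) + 2 ≤ B) (hw : ∀ k, s.iarr 4 k ≤ B) :
    Run B fill s (300 * T.numEdges + 80) fun s' =>
      s'.ireg 2 = 2 * T.numEdges ∧ (∀ k, s'.iarr 4 k ≤ B) ∧
      IsPartition (2 * T.numEdges) m (s.iarr 0) (s'.iarr 5) ∧
      ∀ e < 2 * T.numEdges, s'.iarr 4 (2 * T.numEdges + e) = e ∧
        s'.rarr 6 (2 * T.numEdges + e) = -(entryLine T (s'.iarr 5) (s.iarr 1) (s.rarr 3) e).1 := by
  have hlast := h.graph.off_last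
  generalize hN : 2 * T.numEdges = N at *
  refine Run.wp_seq (k := 140 * N + 60) ?_ (by simp [Cmd.time, IExp.cost]; omega)
  have e1 : m ≤ B := by omega
  have e2 : N ≤ B := by omega
  simp [h.count, e1, hlast, e2]
  refine (Run.loop (fun s' => s'.ireg 5 ≤ N ∧ s'.ireg 4 ≤ m ∧ s.iarr 0 (s'.ireg 4) ≤ s'.ireg 5 ∧
    (∀ k, s'.iarr 4 k ≤ B) ∧ ∀ e < s'.ireg 5, s'.iarr 5 e < m ∧ s.iarr 0 (s'.iarr 5 e) ≤ e ∧
      e < s.iarr 0 (s'.iarr 5 e + 1) ∧ s'.iarr 4 (N + e) = e ∧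
      s'.rarr 6 (N + e) = -(entryLine T (s'.iarr 5) (s.iarr 1) (s.rarr 3) e).1)
    -- Every iteration uses up an adjacency entry or a node.
    (fun s' => 70 * ((N - s'.ireg 5) + (m - s'.ireg 4))) ?_ ?_ ?_).mono ?_ ?_
  · simp [hw, h.graph.off_zero]
  · rintro s' hF ⟨h5, -⟩
    have h2 : s'.ireg 2 = N := by rw [hF.ireg 2 (by decide)]; simp
    simp [h2]; omega
  · rintro s' hF ⟨h5, h4, hle, hw', hI⟩ hb
    have h2 : s'.ireg 2 = N := by rw [hF.ireg 2 (by decide)]; simp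
    have hi0 : s'.iarr 0 = s.iarr 0 := by rw [hF.iarr 0 (by decide)]
    have hi1 : s'.iarr 1 = s.iarr 1 := by rw [hF.iarr 1 (by decide)]
    simp [h2] at hb
    have h4' : s'.ireg 4 < m := by
      refine lt_of_le_of_ne h4 fun e => ?_
      rw [e] at hle; omega
    have hT : HoldsTerrain T s' := h.terrain.congr (by rw [hF.rarr 0 (by decide)])
      (by rw [hF.rarr 1 (by decide)]) (by rw [hF.rarr 2 (by decide)]) (by rw [hF.rarr 3 (by decide)])
    -- `fillStep_run` asks for this also when the scan only moves on to the next node. The entry may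
    -- then belong to a later node, which is found as the last one whose segment starts no later
    -- than the entry.
    have hnbr : s.iarr 1 (s'.ireg 5) < m := by
      have hex : ∃ v < m, s.iarr 0 v ≤ s'.ireg 5 ∧ s'.ireg 5 < s.iarr 0 (v + 1) := by
        have := Nat.findGreatest_spec (P := fun v => s.iarr 0 v ≤ s'.ireg 5) h4 hle
        have hle' := Nat.findGreatest_le (P := fun v => s.iarr 0 v ≤ s'.ireg 5) m
        have hg := fun k => Nat.findGreatest_is_greatest (P := fun v => s.iarr 0 v ≤ s'.ireg 5)
          (n := m) (k := k)
        generalize Nat.findGreatest (fun v => s.iarr 0 v ≤ s'.ireg 5) m = v at *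
        have hv : v < m := lt_of_le_of_ne hle' fun e => by rw [e] at this; omega
        exact ⟨v, hv, this, not_le.1 (hg _ (Nat.lt_succ_self v) hv)⟩
      obtain ⟨v, hv, h6, h7⟩ := hex
      obtain ⟨w, hw, -⟩ := h.graph.adj ⟨v, hv⟩ _ h6 h7
      rw [hw]; exact w.2
    have hoffB : s.iarr 0 (s'.ireg 4 + 1) ≤ N := hN ▸ h.graph.off_le_last h4'
    refine ⟨60, (fillStep_run hT h4' (by rwa [hi1]) (by omega) e1
      (by rw [hi0]; omega)).mono le_rfl fun s'' _ hs => ?_⟩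
    rw [hi0, hi1, h2] at hs
    rcases hs with ⟨h6, h7, h8, h9, h10, h11⟩ | ⟨h6, h7, h8, h9, h10, h11⟩
    · refine ⟨⟨by omega, by omega, by rw [h7, h8]; omega, fun k => ?_, fun e he => ?_⟩, ?_⟩
      · rw [h10]
        by_cases hk : k = N + s'.ireg 5
        · rw [hk, Function.update_self]; omega
        · rw [Function.update_of_ne hk]; exact hw' k
      · rw [h9, h10, h11]
        unfold entryLine
        by_cases hk : e = s'.ireg 5
        · subst hk
          simp only [Function.update_self]
          exact ⟨h4', hle, h6, trivial, trivial⟩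
        · simp only [Function.update_of_ne hk, Function.update_of_ne (show N + e ≠ N + s'.ireg 5 by omega)]
          exact hI e (by omega)
      · simp only [BExp.cost, IExp.cost, h7, h8]
        omega
    · refine ⟨⟨by omega, by omega, by rw [h7, h8]; omega, by rwa [h10], ?_⟩, ?_⟩
      · rw [h8, h9, h10, h11]; exact hI
      · simp only [BExp.cost, IExp.cost, h7, h8]
        omega
  · simp [BExp.cost, IExp.cost]; omega
  · rintro s' hF ⟨⟨h5, h4, hle, hw', hI⟩, hb⟩
    have h2 : s'.ireg 2 = N := by rw [hF.ireg 2 (by decide)]; simp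
    simp [h2] at hb
    obtain h5 : s'.ireg 5 = N := by omega
    rw [h5] at hI
    exact ⟨h2, hw', ⟨fun u v huv hv => h.graph.off_mono huv hv, fun e he => (hI e he).1,
      fun e he => (hI e he).2.1, fun e he => (hI e he).2.2.1⟩, fun e he => (hI e he).2.2.2⟩

end RealRAM

/-! ### The sweep that builds all envelopes. -/

namespace RealRAM

open ImpreciseTerrain

variable {m : ℕ} {T : ImpreciseTerrain (Fin m)}

/-- Load the next entry: its index, its owner, the end of the owner's envelope, and the line. -/
def loadTop : Cmd :=
  .seq (.iset 5 (.read 4 (.const 1))) <|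
  .seq (.iset 6 (.read 5 (.reg 5))) <|
  .seq (.iset 7 (.add (.read 0 (.reg 6)) (.read 6 (.reg 6)))) <|
  .seq (.rset 1 (.sub (.const 0) (.read 6 (.const 1))))
    (.rset 2 (.read 3 (.read 1 (.reg 5))))

theorem loadTop_run {B : ℕ} {s : Store} (hB : 1 ≤ B) (h1 : s.iarr 4 1 ≤ B)
    (h2 : s.iarr 5 (s.iarr 4 1) ≤ B)
    (h3 : s.iarr 0 (s.iarr 5 (s.iarr 4 1)) + s.iarr 6 (s.iarr 5 (s.iarr 4 1)) ≤ B)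
    (h4 : s.iarr 1 (s.iarr 4 1) ≤ B) :
    Run B loadTop s 30 fun s' => s'.ireg 5 = s.iarr 4 1 ∧ s'.ireg 6 = s.iarr 5 (s.iarr 4 1) ∧
      s'.ireg 7 = s.iarr 0 (s.iarr 5 (s.iarr 4 1)) + s.iarr 6 (s.iarr 5 (s.iarr 4 1)) ∧
      s'.rreg 1 = -s.rarr 6 1 ∧ s'.rreg 2 = s.rarr 3 (s.iarr 1 (s.iarr 4 1)) := by
  refine (Run.of_wp ?_).mono (by decide) fun _ _ h => h
  have e1 := (Nat.le_add_right _ _).trans h3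
  have e2 := (Nat.le_add_left _ _).trans h3
  simp [loadTop, hB, h1, h2, h3, h4, e1, e2]

/-- Append the line (`rreg 1`, `rreg 2`) with breakpoint `x` to the envelope of `ireg 6`, which ends
before cell `ireg 7`. -/
def pushLine (x : RExp) : Cmd :=
  .seq (.rwrite 9 (.reg 7) x) <|
  .seq (.rwrite 7 (.reg 7) (.reg 1)) <|
  .seq (.rwrite 8 (.reg 7) (.reg 2))
    (.iwrite 6 (.reg 6) (.add (.read 6 (.reg 6)) (.const 1)))

theorem pushLine_run {B : ℕ} {s : Store} {x : RExp} (hx : x.Ok B s) (h6 : s.ireg 6 ≤ B)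
    (h7 : s.ireg 7 ≤ B) (hc : s.iarr 6 (s.ireg 6) + 1 ≤ B) :
    Run B (pushLine x) s (x.cost + 30) fun s' =>
      s'.rarr 9 = Function.update (s.rarr 9) (s.ireg 7) (x.eval s) ∧
      s'.rarr 7 = Function.update (s.rarr 7) (s.ireg 7) (s.rreg 1) ∧
      s'.rarr 8 = Function.update (s.rarr 8) (s.ireg 7) (s.rreg 2) ∧
      s'.iarr 6 = Function.update (s.iarr 6) (s.ireg 6) (s.iarr 6 (s.ireg 6) + 1) := by
  refine (Run.of_wp ?_).mono ?_ fun _ _ h => h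
  · have e1 : 1 ≤ B := by omega
    have e2 : s.iarr 6 (s.ireg 6) < B := hc
    simp [pushLine, hx, h6, h7, e1, e2, e2.le]
  · simp [pushLine, Cmd.time, IExp.cost, RExp.cost]; omega

/-- The last member of the envelope, and the place where it starts to be maximal. -/
def lastD : RExp := .read 7 (.sub (.reg 7) (.const 1))
/-- See `lastD`. -/
def lastH : RExp := .read 8 (.sub (.reg 7) (.const 1))
/-- See `lastD`. -/
def lastBP : RExp := .read 9 (.sub (.reg 7) (.const 1))

/-- The intersection of the new line with the last member of the envelope. -/
def crossing : RExp :=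
  .div (.sub (.mul (.reg 2) lastD) (.mul lastH (.reg 1))) (.sub lastD (.reg 1))

/-- Remove one line from the envelope of `ireg 6`. -/
def popLine : Cmd := .iwrite 6 (.reg 6) (.sub (.read 6 (.reg 6)) (.const 1))

/-- Is the new line below the last member of the envelope where that starts to be maximal? -/
def belowLast : BExp :=
  .rlt (.div (.sub lastBP (.reg 2)) (.reg 1)) (.div (.sub lastBP lastH) lastD)

/-- Add the next line to the envelope of its owner and remove it from the tournament, or remove one
line that the new line makes superfluous. -/
def hullStep : Cmd :=
  .seq loadTop <|
    .ite (.ilt (.const 0) (.read 6 (.reg 6)))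
      (.ite belowLast
        (.seq (.ite (.rlt (.reg 1) lastD) (pushLine crossing) .skip) (setKey 5 8))
        popLine)
      (.seq (pushLine (.read 2 (.reg 6))) (setKey 5 8))

/-- The invariant of the construction of the envelopes. -/
structure HullState (T : ImpreciseTerrain (Fin m)) (B : ℕ) (s : Store) : Prop where
  input : HoldsInput T s
  size : s.ireg 2 = 2 * T.numEdges
  one : s.rreg 8 = 1
  le : ∀ k, s.iarr 4 k ≤ B
  part : IsPartition (2 * T.numEdges) m (s.iarr 0) (s.iarr 5)
  tree : ∃ key, IsTree (2 * T.numEdges) key (s.rarr 6) (s.iarr 4) ∧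
    (∀ e < 2 * T.numEdges, key e = -(entryLine T (s.iarr 5) (s.iarr 1) (s.rarr 3) e).1 ∨ key e = 1) ∧
    HullInv (2 * T.numEdges) m (s.iarr 0) (s.iarr 5) (entryLine T (s.iarr 5) (s.iarr 1) (s.rarr 3))
      (s.rarr 2) key (s.iarr 4 1) (s.iarr 6) (s.rarr 7) (s.rarr 8) (s.rarr 9)

open Classical in
/-- A bound for the number of steps that remain. -/
noncomputable def hullMeasure (T : ImpreciseTerrain (Fin m)) (s : Store) : ℕ :=
  2 * ((Finset.range (2 * T.numEdges)).filter fun e => s.rarr 6 (2 * T.numEdges + e) ≠ 1).card +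
    ∑ p ∈ Finset.range m, s.iarr 6 p

theorem hullMeasure_eq {s : Store} {key : ℕ → ℝ} {win : ℕ → ℕ}
    (h : IsTree (2 * T.numEdges) key (s.rarr 6) win) : hullMeasure T s =
    2 * ((Finset.range (2 * T.numEdges)).filter fun e => key e ≠ 1).card +
      ∑ p ∈ Finset.range m, s.iarr 6 p := by
  classical
  unfold hullMeasure
  congr 2
  refine congrArg Finset.card ?_
  refine Finset.filter_congr fun e he => ?_
  rw [h.leaf_val e (Finset.mem_range.1 he)]

theorem nbr_lt {s : Store} (h : HoldsInput T s)
    (hp : IsPartition (2 * T.numEdges) m (s.iarr 0) (s.iarr 5)) {e : ℕ} (he : e < 2 * T.numEdges) :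
    ∃ w : Fin m, s.iarr 1 e = w ∧ T.graph.Adj ⟨s.iarr 5 e, hp.own_lt e he⟩ w :=
  h.graph.adj ⟨s.iarr 5 e, hp.own_lt e he⟩ e (hp.off_le e he) (hp.lt_off e he)

theorem entryLine_pos {s : Store} (h : HoldsInput T s)
    (hp : IsPartition (2 * T.numEdges) m (s.iarr 0) (s.iarr 5)) {e : ℕ} (he : e < 2 * T.numEdges) :
    0 < (entryLine T (s.iarr 5) (s.iarr 1) (s.rarr 3) e).1 := by
  obtain ⟨w, hw, hadj⟩ := nbr_lt h hp he
  have := dist_pos_of_adj hadj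
  rw [← posAt_val, ← posAt_val, ← hw] at this
  exact this

theorem HullState.of_frame {B : ℕ} {s s' : Store} (h : HullState T B s) (hF : Frame hullStep s s')
    (hle : ∀ k, s'.iarr 4 k ≤ B)
    (ht : ∃ key, IsTree (2 * T.numEdges) key (s'.rarr 6) (s'.iarr 4) ∧
      (∀ e < 2 * T.numEdges, key e = -(entryLine T (s.iarr 5) (s.iarr 1) (s.rarr 3) e).1 ∨
        key e = 1) ∧
      HullInv (2 * T.numEdges) m (s.iarr 0) (s.iarr 5)
        (entryLine T (s.iarr 5) (s.iarr 1) (s.rarr 3))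
        (s.rarr 2) key (s'.iarr 4 1) (s'.iarr 6) (s'.rarr 7) (s'.rarr 8) (s'.rarr 9)) :
    HullState T B s' := by
  have i0 := hF.iarr 0 (by decide)
  have i1 := hF.iarr 1 (by decide)
  have i5 := hF.iarr 5 (by decide)
  have r2 := hF.rarr 2 (by decide)
  have r3 := hF.rarr 3 (by decide)
  refine ⟨⟨?_, by rw [i0, i1]; exact h.input.graph, h.input.terrain.congr (hF.rarr 0 (by decide))
    (hF.rarr 1 (by decide)) r2 r3⟩, ?_, ?_, hle, by rw [i0, i5]; exact h.part, ?_⟩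
  · rw [hF.ireg 0 (by decide)]; exact h.input.count
  · rw [hF.ireg 2 (by decide)]; exact h.size
  · rw [hF.rreg 8 (by decide)]; exact h.one
  · rw [i0, i1, i5, r2, r3]; exact ht

theorem hullStep_run {B : ℕ} {s : Store} (h : HullState T B s) (hm : m ≤ 2 * T.numEdges)
    (hB : 2 * (2 * T.numEdges) + 2 ≤ B) (hN : 0 < 2 * T.numEdges) (hneg : s.rarr 6 1 < 0) :
    Run B hullStep s (60 * Nat.size (2 * (2 * T.numEdges)) + 250) fun s' =>
      HullState T B s' ∧ hullMeasure T s' < hullMeasure T s := by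
  classical
  obtain ⟨key, htree, hkey, hI⟩ := h.tree
  have hpos := fun e => entryLine_pos h.input h.part (e := e)
  have hnbr : ∀ e < 2 * T.numEdges, s.iarr 1 e < m := fun e he => by
    obtain ⟨w, hw, -⟩ := nbr_lt h.input h.part he
    rw [hw]; exact w.2
  have hpart := h.part
  have hoffle := fun p => h.input.graph.off_le_last (v := p)
  have hsize := h.size
  have hmeas := hullMeasure_eq htree
  generalize hNe : 2 * T.numEdges = N at *
  generalize hline : entryLine T (s.iarr 5) (s.iarr 1) (s.rarr 3) = line at *
  obtain ⟨htopN, htopv⟩ := htree.root hN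
  generalize htop : s.iarr 4 1 = top at *
  -- Live entries carry negated distances and removed ones the positive mark 1. So a negative root
  -- is a live entry of greatest distance.
  have hk1 : key top ≠ 1 := by rw [← htopv]; linarith
  have hkl : key top = -(line top).1 := (hkey top htopN).resolve_right hk1
  have hmax : ∀ e < N, key e ≠ 1 → (line e).1 ≤ (line top).1 := fun e he hke => by
    have h1 := htree.root_le he
    rw [htopv, hkl, (hkey e he).resolve_right hke] at h1
    linarith
  have hw := hnbr top htopN
  have hpm := hpart.own_lt top htopN
  have hcl := hI.add_cnt_lt hpart htopN hk1
  have hcl' : s.iarr 0 (s.iarr 5 top + 1) ≤ N := hoffle _ hpm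
  have hln : (line top).2 = s.rarr 3 (s.iarr 1 top) := by rw [← hline]; rfl
  refine Run.seq ((loadTop_run (by omega) (by omega) (by rw [htop]; omega) (by rw [htop]; omega)
    (by rw [htop]; omega)).mono le_rfl fun s₁ hF₁ ⟨h5, h6, h7, hr1, hr2⟩ => ?_)
    (show 30 + (60 * Nat.size (2 * N) + 220) ≤ _ by omega)
  rw [htop] at h5 h6 h7 hr2
  rw [htopv, hkl, neg_neg] at hr1
  rw [← hln] at hr2
  generalize hp : s.iarr 5 top = p at *
  generalize ho : s.iarr 0 p = o at *
  generalize hc : s.iarr 6 p = c at *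
  have i6 : s₁.iarr 6 = s.iarr 6 := hF₁.iarr 6 (by decide)
  have hr : s₁.rarr = s.rarr := funext fun a => hF₁.rarr a (by simp [loadTop])
  have i4 : s₁.iarr 4 = s.iarr 4 := hF₁.iarr 4 (by decide)
  have hFr : ∀ {d s'}, Frame d s₁ s' → d.iregs ⊆ hullStep.iregs → d.rregs ⊆ hullStep.rregs →
      d.iarrs ⊆ hullStep.iarrs → d.rarrs ⊆ hullStep.rarrs → Frame hullStep s s' :=
    fun hF a1 a2 a3 a4 => (hF₁.mono (by decide) (by decide) (by decide) (by decide)).trans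
      (hF.mono a1 a2 a3 a4)
  -- the end of all branches in which the entry is removed
  have fin : ∀ {d s₂ k}, Frame d s₁ s₂ → d.iregs = [] → d.rregs = [] → d.iarrs ⊆ [6] →
      d.rarrs ⊆ hullStep.rarrs → 6 ∉ d.rarrs → s₂.iarr 6 p ≤ c + 1 →
      (∀ q, q ≠ p → s₂.iarr 6 q = s.iarr 6 q) →
      (∀ top', HullInv N m (s.iarr 0) (s.iarr 5) line (s.rarr 2) (Function.update key top 1) top'
        (s₂.iarr 6) (s₂.rarr 7) (s₂.rarr 8) (s₂.rarr 9)) → 60 * Nat.size (2 * N) + 70 ≤ k →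
      Run B (setKey 5 8) s₂ k fun s' => HullState T B s' ∧ hullMeasure T s' < hullMeasure T s := by
    intro d s₂ k hF a1 a2 a3 a4 a5 hc1 hc2 hinv hk
    have j4 : s₂.iarr 4 = s.iarr 4 := (hF.iarr 4 fun h => by simpa using a3 h).trans i4
    have j6 : s₂.rarr 6 = s.rarr 6 := (hF.rarr 6 a5).trans (by rw [hr])
    have k5 : s₂.ireg 5 = top := (hF.ireg 5 (by simp [a1])).trans h5
    have k2 : s₂.ireg 2 = N :=
      (hF.ireg 2 (by simp [a1])).trans ((hF₁.ireg 2 (by decide)).trans hsize)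
    have k8 : s₂.rreg 8 = 1 :=
      (hF.rreg 8 (by simp [a2])).trans ((hF₁.rreg 8 (by decide)).trans h.one)
    refine (setKey_run (key := key) hB k2 (by rw [k5]; exact htopN) (by rw [j4]; exact h.le)
      (by rw [j4, j6]; exact htree)).mono hk fun s₃ hF₃ ⟨ht, hle⟩ => ?_
    rw [k5, k8] at ht
    have l6 : s₃.iarr 6 = s₂.iarr 6 := hF₃.iarr 6 (by simp [setKey, climb, pull])
    refine ⟨h.of_frame (((hFr hF (by simp [a1]) (by simp [a2])
      (List.Subset.trans a3 (by decide)) a4)).trans (hF₃.mono (by decide) (by decide) (by decide)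
        (by decide))) hle ⟨Function.update key top 1, ?_, ?_, ?_⟩, ?_⟩
    · rw [hNe]; exact ht
    · intro e he
      rw [hline]
      by_cases e' : e = top
      · right; rw [e', Function.update_self]
      · rw [Function.update_of_ne e']; exact hkey e (hNe ▸ he)
    · rw [hNe, hline, l6, hF₃.rarr 7 (by simp [setKey, climb, pull]),
        hF₃.rarr 8 (by simp [setKey, climb, pull]), hF₃.rarr 9 (by simp [setKey, climb, pull])]
      exact hinv _
    -- Removal of the entry gains 2 and at most one line is pushed, at a loss of 1; a pop gains 1.
    -- This is the usual amortization for a stack.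
    · rw [hmeas]
      rw [hullMeasure_eq (T := T) (s := s₃) (key := Function.update key top 1) (by rw [hNe]; exact ht),
        hNe, l6]
      have hcard : ((Finset.range N).filter fun e => key e ≠ 1).card =
          ((Finset.range N).filter fun e => Function.update key top 1 e ≠ 1).card + 1 := by
        rw [← Finset.card_insert_of_notMem (a := top) (by simp)]
        congr 1
        ext e
        simp only [Finset.mem_filter, Finset.mem_insert, Finset.mem_range]
        by_cases e' : e = top
        · simp [e', htopN, hk1]
        · simp [e']
      have hsum : ∑ q ∈ Finset.range m, s₂.iarr 6 q ≤ ∑ q ∈ Finset.range m, s.iarr 6 q + 1 := by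
        have : ∀ q ∈ Finset.range m, s₂.iarr 6 q ≤ s.iarr 6 q + if q = p then 1 else 0 := by
          intro q _
          by_cases hq : q = p
          · rw [if_pos hq, hq, hc]; exact hc1
          · rw [if_neg hq, hc2 q hq]; exact Nat.le_add_right _ _
        refine (Finset.sum_le_sum this).trans ?_
        rw [Finset.sum_add_distrib, Finset.sum_ite_eq', if_pos (Finset.mem_range.2 hpm)]
      omega
  have hpB : s₁.ireg 6 ≤ B := by omega
  have hcB : s₁.iarr 6 (s₁.ireg 6) + 1 ≤ B := by rw [i6, h6, hc]; omega
  have hoB : s₁.ireg 7 ≤ B := by omega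
  have hIpush := fun cnt' D' H' BP' a1 a2 a3 a4 a5 a6 a7 top' => hI.remove (cnt' := cnt')
    (D' := D') (H' := H') (BP' := BP') hpart hk1 htopN hmax a1 a2 a3 a4 a5 a6 a7 top'
  have henv := hI.env _ hpm
  have hpend := HullInv.pendingLine_top (own := s.iarr 5) (line := line) hk1
  have hdist := hI.dist_le _ hpm
  rw [hp] at hpend hIpush
  rw [hpend] at henv
  rw [hc] at hIpush henv hdist
  rw [ho] at hIpush henv hdist
  have htp := hpos top htopN
  -- Pushing onto an empty and onto a nonempty stack differ only in the expression `x` for the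
  -- breakpoint.
  have hpush : ∀ (x : RExp), x.Ok B s₁ → x.cost ≤ 50 →
      IsEnvelope (insert (line top) (removedLines N (s.iarr 5) line key p)) ∅ (s.rarr 2 p) (c + 1)
        (fun i => Function.update (s.rarr 7) (o + c) (line top).1 (o + i))
        (fun i => Function.update (s.rarr 8) (o + c) (line top).2 (o + i))
        (fun i => Function.update (s.rarr 9) (o + c) (x.eval s₁) (o + i)) →
      Run B (pushLine x) s₁ 80 fun s₂ => Run B (setKey 5 8) s₂ (60 * Nat.size (2 * N) + 70)
        fun s' => HullState T B s' ∧ hullMeasure T s' < hullMeasure T s := by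
    intro x hx hxc henv'
    refine (pushLine_run hx hpB hoB hcB).mono (by omega) fun s₂ hF ⟨q9, q7, q8, q6⟩ => ?_
    rw [hr, h7] at q9 q7 q8
    rw [i6, h6, hc] at q6
    rw [hr1] at q7
    rw [hr2] at q8
    refine fin hF (by simp [pushLine]) (by simp [pushLine]) (by simp [pushLine])
      (by simp [pushLine, hullStep]) (by simp [pushLine]) (by rw [q6]; simp)
      (fun q hq => by rw [q6, Function.update_of_ne hq]) ?_ le_rfl
    refine hIpush _ _ _ _ (fun q hq => by rw [q6, Function.update_of_ne hq]) (by rw [q6]; simp)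
      (fun i hi => by rw [q7, Function.update_of_ne hi])
      (fun i hi => by rw [q8, Function.update_of_ne hi])
      (fun i hi => by rw [q9, Function.update_of_ne hi]) (fun i hi => ?_) ?_
    · rw [q6, Function.update_self] at hi
      rw [q7]
      by_cases hic : i = c
      · rw [hic, Function.update_self]
      · rw [Function.update_of_ne (by omega)]
        exact hdist i (by omega) top htopN hp hk1
    · rw [q6, q7, q8, q9, Function.update_self]
      exact henv'
  refine (Run.ite (k := 60 * Nat.size (2 * N) + 200) (by simp [hpB]; omega) (fun hb => ?_)
    fun hb => ?_).mono (by simp [BExp.cost, IExp.cost]; omega) fun _ _ h => h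
  · simp [i6, h6, hc] at hb
    have hle : o + c - 1 = o + (c - 1) := by omega
    have hDpos : 0 < s.rarr 7 (o + (c - 1)) :=
      htp.trans_le (hdist (c - 1) (by omega) top htopN hp hk1)
    have hDle := hdist (c - 1) (by omega) top htopN hp hk1
    refine (Run.ite (k := 60 * Nat.size (2 * N) + 170) ?_ (fun hb' => ?_) fun hb' => ?_).mono
      (by simp [belowLast, lastBP, lastH, lastD, BExp.cost, IExp.cost, RExp.cost]; omega)
      fun _ _ h => h
    · simp [belowLast, lastBP, lastH, lastD, h7, hr1, hr, hle, hDpos.ne', htp.ne']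
      omega
    · simp [belowLast, lastBP, lastH, lastD, h7, hr1, hr, hle, hr2] at hb'
      refine Run.seq (k' := 60 * Nat.size (2 * N) + 70)
        (Run.ite (k := 80) ?_ (fun hb'' => ?_) fun hb'' => ?_) ?_
      · simp [lastD, h7]; omega
      · simp [lastD, h7, hr1, hr, hle] at hb''
        refine hpush _ ?_ (by decide) ?_
        · simp [crossing, lastD, lastH, h7, hr1, hr, hle, sub_ne_zero.2 hb''.ne']
          omega
        · refine (henv.congr (D' := fun i => Function.update (s.rarr 7) (o + c) (line top).1 (o + i))
            (H' := fun i => Function.update (s.rarr 8) (o + c) (line top).2 (o + i))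
            (BP' := fun i => Function.update (s.rarr 9) (o + c) (crossing.eval s₁) (o + i))
            ?_ ?_ ?_).push hb htp ?_ ?_ (by simp) (by simp) ?_
          · intro i hi; rw [Function.update_of_ne (by omega)]
          · intro i hi; rw [Function.update_of_ne (by omega)]
          · intro i hi; rw [Function.update_of_ne (by omega)]
          · rw [Function.update_of_ne (by omega)]; exact hb''
          · simp only [Function.update_of_ne (show o + (c - 1) ≠ o + c by omega)]; exact hb'
          · simp only [Function.update_of_ne (show o + (c - 1) ≠ o + c by omega),
              Function.update_self]
            simp [crossing, lastD, lastH, h7, hr1, hr, hle, hr2]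
      -- The distances agree, so the new line is parallel to the last member and below it; the entry
      -- is removed without being stored.
      · simp [lastD, h7, hr1, hr, hle] at hb''
        refine (Run.of_wp (c := .skip) (show _ from ?_)).mono (by decide) fun s₂ hF h => h
        refine fin (.refl .skip s₁) rfl rfl (by simp) (by simp) (by simp) (by rw [i6, hc]; omega)
          (fun q _ => by rw [i6]) ?_ le_rfl
        rw [i6, hr]
        refine hIpush _ _ _ _ (fun _ _ => rfl) (by rw [hc]; omega) (fun _ _ => rfl) (fun _ _ => rfl)
          (fun _ _ => rfl) (fun i hi => ?_) ?_
        · rw [hc] at hi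
          exact hdist i hi top htopN hp hk1
        · rw [hc]
          exact henv.discard hb (le_antisymm hDle hb'') hb'
      · simp [lastD, BExp.cost, IExp.cost, RExp.cost]; omega
    · simp [belowLast, lastBP, lastH, lastD, h7, hr1, hr, hle, hr2] at hb'
      have hpop := hI.pop hk1 htopN (by rw [hp]; exact hpm) htp (by rw [hp, hc]; exact hb)
        (by rw [hp, ho, hc]; exact hb')
      rw [hp, hc] at hpop
      have hw : popLine.wp B s₁ fun s' => s'.iarr 6 = Function.update (s.iarr 6) p (c - 1) := by
        have e1 : 1 ≤ B := by omega
        have e2 : c ≤ B := by omega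
        have e3 : p ≤ B := by omega
        simp [popLine, i6, h6, hc, e1, e2, e3]
      refine (Run.of_wp hw).mono (by
        have : popLine.time ≤ 20 := by decide
        omega) fun s₂ hF hs₂ => ?_
      have q4 : s₂.iarr 4 = s.iarr 4 := (hF.iarr 4 (by decide)).trans i4
      have qr : s₂.rarr = s.rarr := (funext fun a => hF.rarr a (by simp [popLine])).trans hr
      refine ⟨h.of_frame (hFr hF (by simp [popLine]) (by simp [popLine])
        (by simp [popLine, hullStep, pushLine]) (by simp [popLine])) (by rw [q4]; exact h.le)
        ⟨key, ?_, ?_, ?_⟩, ?_⟩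
      · rw [hNe, q4, qr]; exact htree
      · rw [hNe, hline]; exact hkey
      · rw [hNe, hline, q4, qr, hs₂, htop]; exact hpop
      · rw [hmeas, hullMeasure_eq (T := T) (s := s₂) (key := key) (win := s.iarr 4)
          (by rw [hNe, qr]; exact htree), hNe, hs₂]
        refine Nat.add_lt_add_left ?_ _
        refine Finset.sum_lt_sum (fun q _ => ?_) ⟨p, Finset.mem_range.2 hpm, ?_⟩
        · by_cases hq : q = p
          · rw [hq, Function.update_self, hc]; omega
          · rw [Function.update_of_ne hq]
        · rw [Function.update_self, hc]; omega
  · simp [i6, h6, hc] at hb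
    subst hb
    refine Run.seq (hpush _ (by simp [hpB]) (by decide) ?_) (by omega)
    refine (henv.congr (D' := fun i => Function.update (s.rarr 7) (o + 0) (line top).1 (o + i))
      (H' := fun i => Function.update (s.rarr 8) (o + 0) (line top).2 (o + i))
      (BP' := fun i => Function.update (s.rarr 9) (o + 0) ((RExp.read 2 (.reg 6)).eval s₁) (o + i))
      (by omega) (by omega) (by omega)).push_first (by simp) (by simp) (by simp [hr, h6])

end RealRAM

/-! ### Completed envelopes and the whole precomputation. -/

namespace RealRAM

open ImpreciseTerrain

variable {m : ℕ} {T : ImpreciseTerrain (Fin m)}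

/-- The lines of the neighbors of `p` at their highest elevations. -/
def neighborLines (T : ImpreciseTerrain (Fin m)) (p : Fin m) : Set (ℝ × ℝ) :=
  {l | ∃ w, T.graph.Adj p w ∧ l = (dist (T.pos p) (T.pos w), T.high w)}

theorem neighborLines_pos {p : Fin m} : ∀ l ∈ neighborLines T p, 0 < l.1 := by
  rintro _ ⟨w, hw, rfl⟩
  exact dist_pos_of_adj hw

/-- The terrain and the envelopes of all nodes are in memory. -/
structure HullsReady (T : ImpreciseTerrain (Fin m)) (s : Store) : Prop where
  graph : IsAdjacencyArray T (s.iarr 0) (s.iarr 1)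
  terrain : HoldsTerrain T s
  add_le : ∀ p : Fin m, s.iarr 0 p + s.iarr 6 p ≤ 2 * T.numEdges
  pos : ∀ p w : Fin m, T.graph.Adj p w → 0 < s.iarr 6 p
  env : ∀ p : Fin m, IsEnvelope (neighborLines T p) ∅ (T.low p) (s.iarr 6 p)
    (fun i => s.rarr 7 (s.iarr 0 p + i)) (fun i => s.rarr 8 (s.iarr 0 p + i))
    (fun i => s.rarr 9 (s.iarr 0 p + i))

theorem HullsReady.congr {s s' : Store} (h : HullsReady T s)
    (hi : ∀ a ∈ [0, 1, 6], s'.iarr a = s.iarr a)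
    (hr : ∀ a ∈ [0, 1, 2, 3, 7, 8, 9], s'.rarr a = s.rarr a) : HullsReady T s' := by
  refine ⟨?_, ?_, ?_, ?_, ?_⟩
  · rw [hi 0 (by simp), hi 1 (by simp)]; exact h.graph
  · exact h.terrain.congr (hr 0 (by simp)) (hr 1 (by simp)) (hr 2 (by simp)) (hr 3 (by simp))
  · rw [hi 0 (by simp), hi 6 (by simp)]; exact h.add_le
  · rw [hi 6 (by simp)]; exact h.pos
  · rw [hi 0 (by simp), hi 6 (by simp), hr 7 (by simp), hr 8 (by simp), hr 9 (by simp)]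
    exact h.env

theorem HullsReady.of_frame {c : Cmd} {s s' : Store} (h : HullsReady T s) (hF : Frame c s s')
    (hi : ∀ a ∈ [0, 1, 6], a ∉ c.iarrs) (hr : ∀ a ∈ [0, 1, 2, 3, 7, 8, 9], a ∉ c.rarrs) :
    HullsReady T s' :=
  h.congr (fun a ha => hF.iarr a (hi a ha)) (fun a ha => hF.rarr a (hr a ha))

/-- At the end of the construction, all envelopes are complete. -/
theorem HullState.ready {B : ℕ} {s : Store} (h : HullState T B s)
    (hdone : 0 < 2 * T.numEdges → 0 ≤ s.rarr 6 1) : HullsReady T s := by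
  obtain ⟨key, htree, hkey, hI⟩ := h.tree
  have hpos := fun e => entryLine_pos h.input h.part (e := e)
  have hall : ∀ e < 2 * T.numEdges, key e = 1 := fun e he => by
    refine (hkey e he).resolve_left fun hk => ?_
    have h1 := htree.root_le he
    have h2 := hdone (by omega)
    have h3 := hpos e he
    linarith
  have hlines : ∀ p : Fin m, removedLines (2 * T.numEdges) (s.iarr 5)
      (entryLine T (s.iarr 5) (s.iarr 1) (s.rarr 3)) key p = neighborLines T p := by
    intro p
    ext l
    constructor
    · rintro ⟨e, he, hp, -, rfl⟩
      obtain ⟨w, hw, hadj⟩ := nbr_lt h.input h.part he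
      have : (⟨s.iarr 5 e, h.part.own_lt e he⟩ : Fin m) = p := Fin.ext hp
      rw [this] at hadj
      refine ⟨w, hadj, ?_⟩
      unfold entryLine
      rw [hp, hw, posAt_val, posAt_val, h.input.terrain.high]
    · rintro ⟨w, hw, rfl⟩
      obtain ⟨e, h1, h2, h3⟩ := h.input.graph.exists_eq p w hw
      have he : e < 2 * T.numEdges := h2.trans_le (h.input.graph.off_le_last p.2)
      have hp : s.iarr 5 e = p := by
        have h4 := h.part.off_le e he
        have h5 := h.part.lt_off e he
        have h6 := h.part.own_lt e he
        rcases lt_trichotomy (s.iarr 5 e) p with hlt | heq | hlt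
        · have := h.part.mono (s.iarr 5 e + 1) p hlt p.2.le
          omega
        · exact heq
        · have := h.part.mono (p + 1) (s.iarr 5 e) hlt h6.le
          omega
      refine ⟨e, he, hp, hall e he, ?_⟩
      unfold entryLine
      rw [hp, h3, posAt_val, posAt_val, h.input.terrain.high]
  have henv : ∀ p : Fin m, IsEnvelope (neighborLines T p) ∅ (T.low p) (s.iarr 6 p)
      (fun i => s.rarr 7 (s.iarr 0 p + i)) (fun i => s.rarr 8 (s.iarr 0 p + i))
      (fun i => s.rarr 9 (s.iarr 0 p + i)) := by
    intro p
    have h1 := hI.env p p.2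
    rw [hlines] at h1
    -- If there are no entries at all, the cell with the label of the root means nothing, but then
    -- no node has neighbors and there is nothing to cover.
    have h2 : pendingLine (s.iarr 5) (entryLine T (s.iarr 5) (s.iarr 1) (s.rarr 3)) key
        (s.iarr 4 1) p = ∅ ∨ ∀ w, ¬ T.graph.Adj p w := by
      rcases Nat.eq_zero_or_pos (2 * T.numEdges) with h0 | h0
      · right
        intro w hw
        obtain ⟨e, -, h3, -⟩ := h.input.graph.exists_eq p w hw
        have := h.input.graph.off_le_last (v := p + 1) p.2
        omega
      · left
        ext l
        simp [pendingLine, hall _ (htree.root h0).1]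
    rw [h.input.terrain.low] at h1
    rcases h2 with h2 | h2
    · rwa [h2] at h1
    · exact ⟨h1.mem, h1.start, h1.mono, h1.cover, fun y _ l ⟨w, hw, _⟩ => absurd hw (h2 w)⟩
  refine ⟨h.input.graph, h.input.terrain, fun p => ?_, fun p w hw => ?_, henv⟩
  · exact (hI.add_cnt_le h.part p.2).trans (h.input.graph.off_le_last p.2)
  -- An empty envelope would leave the line of the neighbor `w` uncovered.
  · by_contra h0
    have h0 : s.iarr 6 p = 0 := by omega
    rcases (henv p).last (T.low p) (by rw [if_pos h0]) _ ⟨w, hw, rfl⟩ with ⟨h1, -⟩ | ⟨l, hl, -⟩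
    · omega
    · exact hl.elim

/-- The precomputation. -/
def precompute : Cmd :=
  .seq fill <| .seq build <| .seq (.rset 8 (.const 1)) <|
    .loop (.and (.ilt (.const 0) (.reg 2)) (.rlt (.read 6 (.const 1)) (.const 0))) hullStep

theorem precompute_run {B : ℕ} {s : Store} (h : HoldsInput T s) (hm : m ≤ 2 * T.numEdges)
    (hB : 2 * (2 * T.numEdges) + 2 ≤ B) (hw : ∀ k, s.iarr 4 k ≤ B) (hc : ∀ p, s.iarr 6 p = 0) :
    Run B precompute s
      (4 * T.numEdges * (60 * Nat.size (2 * (2 * T.numEdges)) + 270) + 420 * T.numEdges + 200)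
      fun s' => HullsReady T s' ∧ ∀ k, s'.iarr 4 k ≤ B := by
  refine Run.seq ((fill_run h hm hB hw).mono le_rfl fun s₁ hF₁ ⟨h2, hw₁, hpart, hval⟩ => ?_)
    (show 300 * T.numEdges + 80 + (4 * T.numEdges * (60 * Nat.size (2 * (2 * T.numEdges)) + 270) +
      120 * T.numEdges + 120) ≤ _ by omega)
  refine Run.seq ((build_run (key := fun e => -(entryLine T (s₁.iarr 5) (s.iarr 1) (s.rarr 3) e).1)
    hB h2 hw₁ (fun e he => (hval e he).2) (fun e he => (hval e he).1)).mono le_rfl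
    fun s₂ hF₂ ⟨htree, hw₂⟩ => ?_)
    (show 60 * (2 * T.numEdges) + 60 + (4 * T.numEdges *
      (60 * Nat.size (2 * (2 * T.numEdges)) + 270) + 60) ≤ _ by omega)
  refine Run.seq ((Run.of_wp (c := .rset 8 (.const 1)) (Q := fun s' => s'.rreg 8 = 1)
    (by simp)).mono le_rfl fun s₃ hF₃ h8 => ?_)
    (show 2 + (4 * T.numEdges * (60 * Nat.size (2 * (2 * T.numEdges)) + 270) + 50) ≤ _ by omega)
  have i0 : s₃.iarr 0 = s.iarr 0 := by
    rw [hF₃.iarr 0 (by decide), hF₂.iarr 0 (by decide), hF₁.iarr 0 (by decide)]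
  have i1 : s₃.iarr 1 = s.iarr 1 := by
    rw [hF₃.iarr 1 (by decide), hF₂.iarr 1 (by decide), hF₁.iarr 1 (by decide)]
  have i4 : s₃.iarr 4 = s₂.iarr 4 := hF₃.iarr 4 (by decide)
  have i5 : s₃.iarr 5 = s₁.iarr 5 := by rw [hF₃.iarr 5 (by decide), hF₂.iarr 5 (by decide)]
  have i6 : s₃.iarr 6 = s.iarr 6 := by
    rw [hF₃.iarr 6 (by decide), hF₂.iarr 6 (by decide), hF₁.iarr 6 (by decide)]
  have r : ∀ a, a ≠ 6 → s₃.rarr a = s.rarr a := fun a ha => by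
    rw [hF₃.rarr a (by simp), hF₂.rarr a (by simp [build, pull, ha]),
      hF₁.rarr a (by simp [fill, fillStep, ha])]
  have r6 : s₃.rarr 6 = s₂.rarr 6 := hF₃.rarr 6 (by decide)
  have hin : HoldsInput T s₃ := ⟨by
    rw [hF₃.ireg 0 (by decide), hF₂.ireg 0 (by decide), hF₁.ireg 0 (by decide)]; exact h.count,
    by rw [i0, i1]; exact h.graph, h.terrain.congr (r 0 (by simp)) (r 1 (by simp)) (r 2 (by simp))
      (r 3 (by simp))⟩
  have hp₃ : IsPartition (2 * T.numEdges) m (s₃.iarr 0) (s₃.iarr 5) := by rw [i0, i5]; exact hpart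
  -- Negated distances are negative, so at the beginning no entry bears the mark 1 and the empty
  -- envelopes are correct.
  have hne : ∀ e < 2 * T.numEdges,
      -(entryLine T (s₁.iarr 5) (s.iarr 1) (s.rarr 3) e).1 ≠ 1 := fun e he => by
    have := entryLine_pos hin hp₃ he
    rw [i5, i1, r 3 (by simp)] at this
    linarith
  have hstate : HullState T B s₃ := by
    refine ⟨hin, ?_, h8, by rw [i4]; exact hw₂, hp₃,
      fun e => -(entryLine T (s₁.iarr 5) (s.iarr 1) (s.rarr 3) e).1,
      by rw [i4, r6]; exact htree, fun e _ => Or.inl ?_, fun p hp => ?_, fun p hp => ?_,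
      fun p hp i hi => ?_⟩
    · rw [hF₃.ireg 2 (by decide), hF₂.ireg 2 (by decide)]; exact h2
    · rw [i1, i5, r 3 (by simp)]
    · rw [i6, hc]
      refine ⟨fun i hi => by omega, fun hk => by omega, fun i hi => by omega, fun i hi => by omega,
        fun y _ l hl => ?_⟩
      obtain ⟨e, he, -, h1, -⟩ := hl
      exact absurd h1 (hne e he)
    · rw [i6, hc]; exact Nat.zero_le _
    · rw [i6, hc] at hi; omega
  refine (Run.loop (HullState T B)
    (fun s' => hullMeasure T s' * (60 * Nat.size (2 * (2 * T.numEdges)) + 270)) hstate ?_ ?_).mono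
    ?_ ?_
  · intro s' _ hs
    have := hs.size
    simp; omega
  · rintro s' - hs hb
    simp [hs.size] at hb
    refine ⟨_, (hullStep_run hs hm hB (by omega) hb.2).mono le_rfl fun s'' _ ⟨h1, h2⟩ => ⟨h1, ?_⟩⟩
    have h3 : (BExp.and (.ilt (.const 0) (.reg 2)) (.rlt (.read 6 (.const 1)) (.const 0))).cost ≤ 15 :=
      by decide
    have h4 := Nat.mul_le_mul_right (60 * Nat.size (2 * (2 * T.numEdges)) + 270) (Nat.succ_le_of_lt h2)
    rw [Nat.succ_eq_add_one, add_mul, one_mul] at h4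
    omega
  · have h3 : (BExp.and (.ilt (.const 0) (.reg 2)) (.rlt (.read 6 (.const 1)) (.const 0))).cost ≤ 15 :=
      by decide
    -- Two units for each of the `2 * T.numEdges` entries, and all stacks are empty.
    have h4 : hullMeasure T s₃ ≤ 4 * T.numEdges := by
      have h5 : ∑ p ∈ Finset.range m, s₃.iarr 6 p = 0 :=
        Finset.sum_eq_zero fun p _ => by rw [i6, hc]
      unfold hullMeasure
      rw [h5]
      have := Finset.card_filter_le (Finset.range (2 * T.numEdges))
        (fun e => s₃.rarr 6 (2 * T.numEdges + e) ≠ 1)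
      rw [Finset.card_range] at this
      omega
    exact (Nat.add_le_add_right (Nat.add_le_add (Nat.mul_le_mul_right _ h4) h3) 1).trans (by lia)
  · rintro s' - ⟨hs, hb⟩
    simp [hs.size] at hb
    exact ⟨hs.ready fun h0 => hb (by omega), hs.le⟩

end RealRAM

namespace RealRAM

open ImpreciseTerrain

variable {m : ℕ} {T : ImpreciseTerrain (Fin m)}

/-! ### The query -/

/-- The lines depend on `p` alone: `q` need not be left out, because its own inequality holds
whenever `z ≤ high q`. So a single envelope serves all edges at `p`. The bound `high p` is split off
since the search ignores it; `improves` tests it afterwards. -/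
theorem edgeExpand_eq {p q : Fin m} {z : ℝ} :
    T.edgeExpand p q z = {y | (max z (T.low p) ≤ y ∧
      ∀ l ∈ neighborLines T p, slopeLine l y ≤ slopeLine (dist (T.pos p) (T.pos q), z) y) ∧
        y ≤ T.high p} := by
  ext y
  simp only [edgeExpand, neighborLines, slopeLine, Set.mem_ofPred_eq, max_le_iff]
  constructor
  · rintro ⟨h1, h2, h3, h4⟩
    refine ⟨⟨⟨h2, h1⟩, ?_⟩, h3⟩
    rintro _ ⟨w, hw, rfl⟩
    exact h4 w hw
  · rintro ⟨⟨⟨h2, h1⟩, h4⟩, h3⟩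
    exact ⟨h1, h2, h3, fun r hr => h4 _ ⟨r, hr, rfl⟩⟩

/-- The elevation `rreg 6` is legal for the node `ireg 6` and improves its key. -/
def improves : BExp :=
  .and (.not (.rlt (.read 3 (.reg 6)) (.reg 6))) (.rlt (.reg 6) (.read 6 (.add (.reg 2) (.reg 6))))

/-- Update the key of the neighbor of `ireg 4` in entry `ireg 5` of the adjacency lists, unless it
has been output before. -/
def relaxEdge : Cmd :=
  .seq (.iset 6 (.read 1 (.reg 5))) <|
  .seq (.ite (.ieq (.read 7 (.reg 6)) (.const 0))
    (.seq (.rset 1 (distExp 6 4)) <| .seq search <| .ite improves (setKey 6 6) .skip) .skip)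
    (.iset 5 (.add (.reg 5) (.const 1)))

/-- How the keys may change when the neighbor `p` of `q` is updated. -/
structure IsRelaxed (T : ImpreciseTerrain (Fin m)) (q : Fin m) (z : ℝ) (p : Fin m)
    (key key' : ℕ → ℝ) : Prop where
  of_ne : ∀ u, u ≠ p.val → key' u = key u
  le : key' p ≤ key p
  new : key' p ≠ key p → key' p ∈ T.edgeExpand p q z
  le_of_mem : ∀ y ∈ T.edgeExpand p q z, key' p ≤ y

/-- The search minimizes without the bound `high p`. If the result violates this bound, no legal
elevation exists. The value `rreg 7` that reports failure is above all `high`, so the same test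
rejects it. -/
theorem setKey_search_run {B : ℕ} {s : Store} (h : HullsReady T s) (hm : m ≤ 2 * T.numEdges)
    (hB : 2 * (2 * T.numEdges) + 2 ≤ B) (h2 : s.ireg 2 = m) (hw : ∀ k, s.iarr 4 k ≤ B)
    (hM : ∀ v, T.high v < s.rreg 7) {key : ℕ → ℝ} (hT : IsTree m key (s.rarr 6) (s.iarr 4))
    {p q : Fin m} (h4 : s.ireg 4 = q) (h6 : s.ireg 6 = p) (hadj : T.graph.Adj p q) :
    Run B (.seq (.rset 1 (distExp 6 4)) <| .seq search <| .ite improves (setKey 6 6) .skip) s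
      (140 * Nat.size (2 * (2 * T.numEdges)) + 280) fun s' =>
      (∀ k, s'.iarr 4 k ≤ B) ∧
      ∃ key', IsTree m key' (s'.rarr 6) (s'.iarr 4) ∧ IsRelaxed T q (s.rreg 0) p key key' := by
  have hpB : (p : ℕ) < m := p.2
  have hqB : (q : ℕ) < m := q.2
  have hadd := h.add_le p
  have hz1 : Nat.size (s.iarr 6 p) ≤ Nat.size (2 * (2 * T.numEdges)) :=
    Nat.size_le_size (by omega)
  have hz2 : Nat.size (2 * m) ≤ Nat.size (2 * (2 * T.numEdges)) :=
    Nat.size_le_size (by omega)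
  have hc : improves.cost = 12 := by decide
  refine Run.seq ((Run.of_wp (c := .rset 1 (distExp 6 4))
    (Q := fun s' => s'.rreg 1 = dist (T.pos p) (T.pos q)) ?_).mono
    (show _ ≤ 30 by decide) fun s₁ hF₁ h1 => ?_)
    (show 30 + (140 * Nat.size (2 * (2 * T.numEdges)) + 250) ≤ _ by omega)
  · exact ⟨distExp_ok (by omega) (by omega), by simp [distExp_eval h.terrain h6 h4]⟩
  have i₁ : s₁.iarr = s.iarr := funext fun a => hF₁.iarr a (by simp)
  have r₁ : s₁.rarr = s.rarr := funext fun a => hF₁.rarr a (by simp)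
  have h6₁ : s₁.ireg 6 = p := (hF₁.ireg 6 (by simp)).trans h6
  have h0₁ : s₁.rreg 0 = s.rreg 0 := hF₁.rreg 0 (by simp)
  have h7₁ : s₁.rreg 7 = s.rreg 7 := hF₁.rreg 7 (by simp)
  have hsearch := search_run (B := B) (s := s₁) (lines := neighborLines T p) (by omega)
    (by omega) (by rw [h6₁, i₁]; exact h.pos p q hadj) (by rw [h6₁, i₁]; omega)
    (by rw [h6₁, i₁, r₁, h.terrain.low]; exact h.env p) neighborLines_pos
    (by rw [h1]; exact dist_pos_of_adj hadj)
  rw [h6₁, i₁, r₁, h0₁, h1, h7₁, h.terrain.low] at hsearch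
  refine Run.seq (hsearch.mono le_rfl fun s₂ hF₂ hs => ?_)
    (show 80 * Nat.size (s.iarr 6 p) + 140 + (60 * Nat.size (2 * m) + 100) ≤ _ by omega)
  clear hsearch
  have i₂ : s₂.iarr = s.iarr := (funext fun a => hF₂.iarr a (by
    simp [search, searchInit, bisect, solve])).trans i₁
  have r₂ : s₂.rarr = s.rarr := (funext fun a => hF₂.rarr a (by
    simp [search, searchInit, bisect, solve])).trans r₁
  have h6₂ : s₂.ireg 6 = p := (hF₂.ireg 6 (by decide)).trans h6₁
  have h2₂ : s₂.ireg 2 = m := (hF₂.ireg 2 (by decide)).trans ((hF₁.ireg 2 (by simp)).trans h2)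
  have hleaf := hT.leaf_val p p.2
  have hmem : ∀ y ∈ T.edgeExpand p q (s.rreg 0), s₂.rreg 6 ≤ y := by
    intro y hy
    rw [edgeExpand_eq] at hy
    rcases hs with hs | ⟨-, hs⟩
    · exact hs.2 hy.1
    · exact absurd hy.1 (hs y)
  refine (Run.ite (k := 60 * Nat.size (2 * m) + 70) ?_ (fun hb => ?_) fun hb => ?_).mono
    (by rw [hc]; omega) fun _ _ h => h
  · simp [improves, h6₂, h2₂]; omega
  · simp [improves, h6₂, h2₂, r₂, hleaf, h.terrain.high] at hb
    refine (setKey_run (B := B) (N := m) (key := key) (by omega) h2₂ (by rw [h6₂]; exact p.2)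
      (by rwa [i₂]) (by rwa [i₂, r₂])).mono le_rfl fun s₃ _ ⟨h3, h4⟩ => ⟨h4, _, h3, ?_⟩
    rw [h6₂]
    refine ⟨fun u hu => Function.update_of_ne hu .., ?_, fun _ => ?_, ?_⟩
    · rw [Function.update_self]; exact hb.2.le
    · rw [Function.update_self, edgeExpand_eq]
      rcases hs with hs | ⟨hs, -⟩
      · exact ⟨hs.1, hb.1⟩
      · exact absurd (hs ▸ hb.1) (hM p).not_ge
    · rw [Function.update_self]; exact hmem
  · simp [improves, h6₂, h2₂, r₂, hleaf, h.terrain.high] at hb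
    refine (Run.of_wp (c := .skip) (Q := _) ?_).mono (show 1 ≤ _ by omega) fun _ _ h => h
    refine ⟨by rwa [i₂], key, by rwa [i₂, r₂], fun _ _ => rfl, le_rfl, fun h => absurd rfl h,
      fun y hy => ?_⟩
    have h1 := hmem y hy
    rw [edgeExpand_eq] at hy
    exact (hb (h1.trans hy.2)).trans h1

theorem relaxEdge_run {B : ℕ} {s : Store} (h : HullsReady T s) (hm : m ≤ 2 * T.numEdges)
    (hB : 2 * (2 * T.numEdges) + 2 ≤ B) (h2 : s.ireg 2 = m) (hw : ∀ k, s.iarr 4 k ≤ B)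
    (hM : ∀ v, T.high v < s.rreg 7) {key : ℕ → ℝ} (hT : IsTree m key (s.rarr 6) (s.iarr 4))
    {p q : Fin m} (h4 : s.ireg 4 = q) (h5 : s.ireg 5 < 2 * T.numEdges)
    (hp : s.iarr 1 (s.ireg 5) = p) (hadj : T.graph.Adj p q) (h7 : s.iarr 7 p ≤ B) :
    Run B relaxEdge s (140 * Nat.size (2 * (2 * T.numEdges)) + 300) fun s' =>
      s'.ireg 5 = s.ireg 5 + 1 ∧ (∀ k, s'.iarr 4 k ≤ B) ∧
      ∃ key', IsTree m key' (s'.rarr 6) (s'.iarr 4) ∧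
        (s.iarr 7 p ≠ 0 ∧ key' = key ∨ s.iarr 7 p = 0 ∧ IsRelaxed T q (s.rreg 0) p key key') := by
  have hpB : (p : ℕ) < m := p.2
  have hc : (BExp.ieq (.read 7 (.reg 6)) (.const 0)).cost = 4 := by decide
  refine Run.seq ((Run.of_wp (c := .iset 6 (.read 1 (.reg 5))) (Q := fun s' => s'.ireg 6 = p)
    ?_).mono (show _ ≤ 3 by decide) fun s₁ hF₁ h6 => ?_)
    (show 3 + (140 * Nat.size (2 * (2 * T.numEdges)) + 295) ≤ _ by omega)
  · simp [hp]; omega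
  have i₁ : s₁.iarr = s.iarr := funext fun a => hF₁.iarr a (by simp)
  have r₁ : s₁.rarr = s.rarr := funext fun a => hF₁.rarr a (by simp)
  have g₁ : s₁.rreg = s.rreg := funext fun a => hF₁.rreg a (by simp)
  have hB6 : s₁.ireg 6 ≤ B := by omega
  refine Run.seq ((Run.ite (k := 140 * Nat.size (2 * (2 * T.numEdges)) + 280)
    (Q := fun s' => (∀ k, s'.iarr 4 k ≤ B) ∧ ∃ key', IsTree m key' (s'.rarr 6) (s'.iarr 4) ∧
      (s.iarr 7 p ≠ 0 ∧ key' = key ∨ s.iarr 7 p = 0 ∧ IsRelaxed T q (s.rreg 0) p key key'))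
    ?_ (fun hb => ?_) fun hb => ?_).mono le_rfl fun s₂ hF₂ ⟨hw₂, hk₂⟩ => ?_)
    (show _ + 5 ≤ _ by rw [hc]; omega)
  · simp [h6, i₁]; omega
  · simp [h6, i₁] at hb
    refine (setKey_search_run (h.of_frame hF₁ (by simp) (by simp)) hm hB
      ((hF₁.ireg 2 (by simp)).trans h2) (by rwa [i₁]) (by rwa [g₁]) (key := key) (by rwa [i₁, r₁])
      ((hF₁.ireg 4 (by simp)).trans h4) h6 hadj).mono le_rfl fun s' _ ⟨h1, key', h2, h3⟩ => ?_
    rw [g₁] at h3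
    exact ⟨h1, key', h2, Or.inr ⟨hb, h3⟩⟩
  · simp [h6, i₁] at hb
    refine (Run.of_wp (c := .skip) (Q := _) ?_).mono (show 1 ≤ _ by omega) fun _ _ h => h
    exact ⟨by rwa [i₁], key, by rwa [i₁, r₁], Or.inl ⟨hb, rfl⟩⟩
  · have h5₂ : s₂.ireg 5 = s.ireg 5 := by rw [hF₂.ireg 5 (by decide), hF₁.ireg 5 (by simp)]
    refine (Run.of_wp ?_).mono (show _ ≤ 5 by decide) fun _ _ h => h
    simp [h5₂]
    exact ⟨by omega, hw₂, hk₂⟩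

/-- Update the keys of all neighbors of `ireg 4`. -/
def relaxNode : Cmd :=
  .seq (.iset 5 (.read 0 (.reg 4)))
    (.loop (.ilt (.reg 5) (.read 0 (.add (.reg 4) (.const 1)))) relaxEdge)

theorem relaxNode_run {B : ℕ} {s : Store} (h : HullsReady T s) (hm : m ≤ 2 * T.numEdges)
    (hB : 2 * (2 * T.numEdges) + 2 ≤ B) (h2 : s.ireg 2 = m) (hw : ∀ k, s.iarr 4 k ≤ B)
    (hM : ∀ v, T.high v < s.rreg 7) {key : ℕ → ℝ} (hT : IsTree m key (s.rarr 6) (s.iarr 4))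
    {q : Fin m} (h4 : s.ireg 4 = q) (h7 : ∀ v : Fin m, s.iarr 7 v ≤ B) :
    Run B relaxNode s ((140 * Nat.size (2 * (2 * T.numEdges)) + 310) *
      (s.iarr 0 (q + 1) - s.iarr 0 q) + 20) fun s' => (∀ k, s'.iarr 4 k ≤ B) ∧
      ∃ key', IsTree m key' (s'.rarr 6) (s'.iarr 4) ∧
        (∀ u : Fin m, s.iarr 7 u ≠ 0 → key' u = key u) ∧ (∀ u : Fin m, key' u ≤ key u) ∧
        (∀ u : Fin m, key' u ≠ key u → T.graph.Adj u q ∧ key' u ∈ T.edgeExpand u q (s.rreg 0)) ∧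
        ∀ u : Fin m, T.graph.Adj u q → s.iarr 7 u = 0 → ∀ y ∈ T.edgeExpand u q (s.rreg 0),
          key' u ≤ y := by
  have hqB : (q : ℕ) < m := q.2
  have ho1 : s.iarr 0 q ≤ s.iarr 0 (q + 1) := h.graph.off_le q q.2
  have ho2 : s.iarr 0 (q + 1) ≤ 2 * T.numEdges := h.graph.off_le_last (v := q + 1) q.2
  have hc : (BExp.ilt (.reg 5) (.read 0 (.add (.reg 4) (.const 1)))).cost = 6 := by decide
  generalize hK : 140 * Nat.size (2 * (2 * T.numEdges)) + 310 = K
  refine Run.seq ((Run.of_wp (c := .iset 5 (.read 0 (.reg 4)))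
    (Q := fun s' => s'.ireg 5 = s.iarr 0 q) ?_).mono (show _ ≤ 3 by decide) fun s₁ hF₁ h5 => ?_)
    (show 3 + (K * (s.iarr 0 (q + 1) - s.iarr 0 q) + 6 + 1) ≤ _ by omega)
  · simp [h4]; omega
  have i₁ : s₁.iarr = s.iarr := funext fun a => hF₁.iarr a (by simp)
  have r₁ : s₁.rarr = s.rarr := funext fun a => hF₁.rarr a (by simp)
  have g₁ : s₁.rreg = s.rreg := funext fun a => hF₁.rreg a (by simp)
  have frame : ∀ s', Frame relaxEdge s₁ s' →
      HullsReady T s' ∧ s'.ireg 2 = m ∧ s'.ireg 4 = q ∧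
      s'.iarr 0 = s.iarr 0 ∧ s'.iarr 1 = s.iarr 1 ∧ s'.iarr 7 = s.iarr 7 ∧
      s'.rreg 0 = s.rreg 0 ∧ s'.rreg 7 = s.rreg 7 := fun s' hF =>
    ⟨(h.of_frame hF₁ (by simp) (by simp)).of_frame hF (by decide) (by decide),
      (hF.ireg 2 (by decide)).trans ((hF₁.ireg 2 (by simp)).trans h2),
      (hF.ireg 4 (by decide)).trans ((hF₁.ireg 4 (by simp)).trans h4),
      by rw [hF.iarr 0 (by decide), i₁], by rw [hF.iarr 1 (by decide), i₁],
      by rw [hF.iarr 7 (by decide), i₁], by rw [hF.rreg 0 (by decide), g₁],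
      by rw [hF.rreg 7 (by decide), g₁]⟩
  refine (Run.loop (fun s' => s.iarr 0 q ≤ s'.ireg 5 ∧ s'.ireg 5 ≤ s.iarr 0 (q + 1) ∧
      (∀ k, s'.iarr 4 k ≤ B) ∧ ∃ key', IsTree m key' (s'.rarr 6) (s'.iarr 4) ∧
        (∀ u : Fin m, s.iarr 7 u ≠ 0 → key' u = key u) ∧ (∀ u : Fin m, key' u ≤ key u) ∧
        (∀ u : Fin m, key' u ≠ key u → T.graph.Adj u q ∧ key' u ∈ T.edgeExpand u q (s.rreg 0)) ∧
        ∀ e, s.iarr 0 q ≤ e → e < s'.ireg 5 → ∀ u : Fin m, s.iarr 1 e = u → s.iarr 7 u = 0 →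
          ∀ y ∈ T.edgeExpand u q (s.rreg 0), key' u ≤ y)
    (fun s' => K * (s.iarr 0 (q + 1) - s'.ireg 5)) ?_ ?_ ?_).mono ?_ ?_
  · refine ⟨h5.ge, by omega, by rwa [i₁], key, by rwa [i₁, r₁], fun _ _ => rfl, fun _ => le_rfl,
      fun u hu => absurd rfl hu, fun e h1 h3 => by omega⟩
  · rintro s' hF ⟨h1, h3, -⟩
    obtain ⟨-, -, e4, e0, -⟩ := frame s' hF
    simp [e4, e0]; omega
  · rintro s' hF ⟨h1, h3, hw', key', hT', k1, k2, k3, k4⟩ hb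
    obtain ⟨eR, e2, e4, e0, e1, e7, f0, f7⟩ := frame s' hF
    simp [e4, e0] at hb
    obtain ⟨p, hp, hadj⟩ := h.graph.adj q _ h1 hb
    refine ⟨140 * Nat.size (2 * (2 * T.numEdges)) + 300, (relaxEdge_run eR hm hB e2 hw' (by rwa [f7])
      hT' e4 (by omega) (by rwa [e1]) hadj.symm (by rw [e7]; exact h7 p)).mono le_rfl
      fun s'' _ ⟨h5'', hw'', key'', hT'', hcase⟩ => ⟨⟨by omega, by omega, hw'', key'', hT'', ?_⟩, ?_⟩⟩
    · rw [e7, f0] at hcase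
      rcases hcase with ⟨hne, rfl⟩ | ⟨heq, hR⟩
      -- A neighbor that has been output is skipped; nothing is claimed about its key.
      · refine ⟨k1, k2, k3, fun e he1 he2 u hu hu7 => ?_⟩
        refine k4 e he1 (lt_of_le_of_ne (by omega) ?_) u hu hu7
        rintro rfl
        rw [hp] at hu
        exact hne (by rwa [hu])
      · have hval : ∀ u : Fin m, u ≠ p → key'' u = key' u := fun u hu =>
          hR.of_ne u fun e => hu (Fin.ext e)
        have hle : ∀ u : Fin m, key'' u ≤ key' u := fun u => by
          by_cases hu : u = p
          · rw [hu]; exact hR.le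
          · exact (hval u hu).le
        refine ⟨fun u hu => ?_, fun u => (hle u).trans (k2 u), fun u hu => ?_,
          fun e he1 he2 u hu hu7 y hy => ?_⟩
        · rw [hval u (by rintro rfl; exact hu heq)]; exact k1 u hu
        · by_cases hup : u = p
          · subst hup
            refine ⟨hadj.symm, ?_⟩
            by_cases hu' : key'' u = key' u
            · rw [hu'] at hu ⊢; exact (k3 u hu).2
            · exact hR.new hu'
          · rw [hval u hup] at hu ⊢; exact k3 u hu
        · by_cases hee : e = s'.ireg 5
          · rw [hee, hp] at hu
            obtain rfl := Fin.ext hu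
            exact hR.le_of_mem y hy
          · exact (hle u).trans (k4 e he1 (by omega) u hu hu7 y hy)
    · rw [hc, h5'', show s.iarr 0 (q + 1) - s'.ireg 5 = (s.iarr 0 (q + 1) - (s'.ireg 5 + 1)) + 1
        by omega, mul_add, mul_one]
      omega
  · rw [hc, h5]
  · rintro s' hF ⟨⟨h1, h3, hw', key', hT', k1, k2, k3, k4⟩, hb⟩
    obtain ⟨-, -, e4, e0, -⟩ := frame s' ⟨hF.1, hF.2, hF.3, hF.4⟩
    simp [e4, e0] at hb
    refine ⟨hw', key', hT', k1, k2, k3, fun u hu => ?_⟩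
    obtain ⟨e, he1, he2, he3⟩ := h.graph.exists_eq q u hu.symm
    exact k4 e he1 (by omega) u he3

end RealRAM

/-! ### The main loop of the query. -/

namespace ImpreciseTerrain.SearchInv

variable {V : Type} {T : ImpreciseTerrain V} {Q : Finset V} {M : ℝ} {key : V → ℝ}
  {L : List (V × ℝ)}

theorem nodup [Finite V] (hS : SearchInv T Q M key L) : (L.map Prod.fst).Nodup := by
  obtain ⟨Rbar, h⟩ := T.exists_isCanonicalRealization (Q : Set V)
  obtain ⟨k, S, hr⟩ := hS.run
  exact (hr.inv h).nodup

end ImpreciseTerrain.SearchInv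

namespace RealRAM

open ImpreciseTerrain

variable {m : ℕ} {T : ImpreciseTerrain (Fin m)} {Q : Finset (Fin m)}

/-- The state of the main loop: the sequence `L` has been output, and the tournament holds the
keys of all nodes. -/
structure QueryState (T : ImpreciseTerrain (Fin m)) (Q : Finset (Fin m)) (B : ℕ) (s : Store)
    (L : List (Fin m × ℝ)) (key : ℕ → ℝ) : Prop where
  ready : HullsReady T s
  size : s.ireg 2 = m
  le : ∀ k, s.iarr 4 k ≤ B
  high_lt : ∀ v, T.high v < s.rreg 7
  tree : IsTree m key (s.rarr 6) (s.iarr 4)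
  inv : SearchInv T Q (s.rreg 7) (fun v => key v) L
  output : outputSequence s = L.map fun x => (x.1.val, x.2)
  realization : ∀ x ∈ L, s.rarr 5 x.1 = x.2
  realization_high : ∀ v, v ∉ L.map Prod.fst → s.rarr 5 v = T.high v
  flag_mem : ∀ v ∈ L.map Prod.fst, s.iarr 7 v = 1
  flag_not_mem : ∀ v, v ∉ L.map Prod.fst → s.iarr 7 v = 0

theorem QueryState.length {B : ℕ} {s : Store} {L : List (Fin m × ℝ)} {key : ℕ → ℝ}
    (h : QueryState T Q B s L key) : s.ireg 0 = L.length := by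
  have := congrArg List.length h.output
  simpa [outputSequence] using this

theorem outputSequence_succ {s s' : Store} {L : List (Fin m × ℝ)} {v : Fin m} {z : ℝ}
    (h : outputSequence s = L.map fun x => (x.1.val, x.2)) (h0 : s'.ireg 0 = s.ireg 0 + 1)
    (h3 : s'.iarr 3 = Function.update (s.iarr 3) (s.ireg 0) v)
    (h4 : s'.rarr 4 = Function.update (s.rarr 4) (s.ireg 0) z) :
    outputSequence s' = (L ++ [(v, z)]).map fun x => (x.1.val, x.2) := by
  rw [List.map_append, ← h]
  unfold outputSequence
  rw [h0, List.range_succ, List.map_append, h3, h4]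
  congr 1
  · refine List.map_congr_left fun i hi => ?_
    have : i ≠ s.ireg 0 := (List.mem_range.1 hi).ne
    rw [Function.update_of_ne this, Function.update_of_ne this]
  · simp

/-- Output the winner of the tournament. -/
def outputWinner : Cmd :=
  .seq (.iset 4 (.read 4 (.const 1))) <|
  .seq (.rset 0 (.read 6 (.const 1))) <|
  .seq (.iwrite 3 (.reg 0) (.reg 4)) <|
  .seq (.rwrite 4 (.reg 0) (.reg 0)) <|
  .seq (.iset 0 (.add (.reg 0) (.const 1))) <|
  .seq (.rwrite 5 (.reg 4) (.reg 0))
    (.iwrite 7 (.reg 4) (.const 1))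

theorem outputWinner_run {B : ℕ} {s : Store} (hB : 1 ≤ B) (h0 : s.ireg 0 + 1 ≤ B)
    (hw : s.iarr 4 1 ≤ B) :
    Run B outputWinner s 30 fun s' => s'.ireg 4 = s.iarr 4 1 ∧ s'.rreg 0 = s.rarr 6 1 ∧
      s'.iarr 3 = Function.update (s.iarr 3) (s.ireg 0) (s.iarr 4 1) ∧
      s'.rarr 4 = Function.update (s.rarr 4) (s.ireg 0) (s.rarr 6 1) ∧
      s'.ireg 0 = s.ireg 0 + 1 ∧
      s'.rarr 5 = Function.update (s.rarr 5) (s.iarr 4 1) (s.rarr 6 1) ∧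
      s'.iarr 7 = Function.update (s.iarr 7) (s.iarr 4 1) 1 := by
  refine (Run.of_wp ?_).mono (by decide) fun _ _ h => h
  have e1 : s.ireg 0 < B := h0
  simp [outputWinner, hB, e1, e1.le, hw]

/-- Output the node of minimum key and update the keys of its neighbors. -/
def queryStep : Cmd := .seq outputWinner <| .seq (setKey 4 7) relaxNode

theorem queryStep_run {B : ℕ} {s : Store} {L : List (Fin m × ℝ)} {key : ℕ → ℝ}
    (h : QueryState T Q B s L key) (hm : m ≤ 2 * T.numEdges)
    (hB : 2 * (2 * T.numEdges) + 2 ≤ B) {v : Fin m} (hv : s.iarr 4 1 = v)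
    (hk : key v < s.rreg 7) (hmin : ∀ w : Fin m, key v ≤ key w) :
    Run B queryStep s ((140 * Nat.size (2 * (2 * T.numEdges)) + 310) *
      (s.iarr 0 (v + 1) - s.iarr 0 v) + (60 * Nat.size (2 * (2 * T.numEdges)) + 120)) fun s' =>
      s'.iarr 0 = s.iarr 0 ∧ s'.iarr 7 = Function.update (s.iarr 7) v 1 ∧
        ∃ key', QueryState T Q B s' (L ++ [(v, key v)]) key' := by
  have hvB : (v : ℕ) < m := v.2
  have hvL : v ∉ L.map Prod.fst := fun hvL => hk.ne (h.inv.done v hvL)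
  -- The outputs and the new node `v` are all distinct, so the output index stays within the word
  -- bound.
  have hlen : L.length < m := by
    have h1 := List.Nodup.length_le_card (l := v :: L.map Prod.fst)
      (List.nodup_cons.2 ⟨hvL, h.inv.nodup⟩)
    simpa using h1
  have hz2 : Nat.size (2 * m) ≤ Nat.size (2 * (2 * T.numEdges)) :=
    Nat.size_le_size (by omega)
  have hroot : s.rarr 6 1 = key v := by rw [(h.tree.root (by omega)).2, hv]
  have hlen' := h.length
  refine Run.seq ((outputWinner_run (B := B) (s := s) (by omega) (by omega) (by omega)).mono le_rfl
    fun s₁ hF₁ ⟨a4, b0, a3, b4, a0, b5, a7⟩ => ?_) (show 30 + ((60 * Nat.size (2 * m) + 70) +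
      ((140 * Nat.size (2 * (2 * T.numEdges)) + 310) * (s.iarr 0 (v + 1) - s.iarr 0 v) + 20)) ≤ _
      by omega)
  rw [hv] at a4 a3 b5 a7
  rw [hroot] at b0 b4 b5
  have ready₁ : HullsReady T s₁ := h.ready.of_frame hF₁ (by decide) (by decide)
  have size₁ : s₁.ireg 2 = m := (hF₁.ireg 2 (by decide)).trans h.size
  have hM₁ : s₁.rreg 7 = s.rreg 7 := hF₁.rreg 7 (by decide)
  refine Run.seq ((setKey_run (B := B) (N := m) (r := 4) (y := 7) (key := key) (by omega) size₁
    (by omega) (by rw [hF₁.iarr 4 (by decide)]; exact h.le)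
    (by rw [hF₁.iarr 4 (by decide), hF₁.rarr 6 (by decide)]; exact h.tree)).mono le_rfl
    fun s₂ hF₂ ⟨tree₂, le₂⟩ => ?_) le_rfl
  rw [a4, hM₁] at tree₂
  have ready₂ : HullsReady T s₂ := ready₁.of_frame hF₂ (by decide) (by decide)
  have e0 : s₂.iarr 0 = s.iarr 0 := by rw [hF₂.iarr 0 (by decide), hF₁.iarr 0 (by decide)]
  have e7 : s₂.iarr 7 = Function.update (s.iarr 7) v 1 := by rw [hF₂.iarr 7 (by decide), a7]
  have m7 : s₂.rreg 7 = s.rreg 7 := by rw [hF₂.rreg 7 (by decide), hM₁]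
  have z0 : s₂.rreg 0 = key v := by rw [hF₂.rreg 0 (by decide), b0]
  have hmem : ∀ u, u ∈ (L ++ [(v, key v)]).map Prod.fst ↔ u ∈ L.map Prod.fst ∨ u = v := fun u => by
    rw [List.map_append, List.mem_append, List.map_singleton, List.mem_singleton]
  have flag : ∀ u : Fin m, s₂.iarr 7 u = if u ∈ (L ++ [(v, key v)]).map Prod.fst then 1 else 0 := by
    intro u
    rw [e7]
    by_cases huv : u = v
    · rw [huv, Function.update_self, if_pos ((hmem v).2 (Or.inr rfl))]
    · rw [Function.update_of_ne fun e => huv (Fin.ext e)]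
      by_cases huL : u ∈ L.map Prod.fst
      · rw [if_pos ((hmem u).2 (Or.inl huL)), h.flag_mem u huL]
      · rw [if_neg fun hu => ((hmem u).1 hu).elim huL huv, h.flag_not_mem u huL]
  have hrelax := relaxNode_run (B := B) ready₂ hm hB ((hF₂.ireg 2 (by decide)).trans size₁) le₂
    (by rw [m7]; exact h.high_lt) tree₂ (q := v) ((hF₂.ireg 4 (by decide)).trans a4)
    (fun u => by rw [flag]; split_ifs <;> omega)
  rw [e0, z0] at hrelax
  refine hrelax.mono le_rfl fun s₃ hF₃ ⟨le₃, key', tree₃, k1, k2, k3, k4⟩ => ?_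
  clear hrelax
  have m7₃ : s₃.rreg 7 = s.rreg 7 := by rw [hF₃.rreg 7 (by decide), m7]
  have b5₃ : s₃.rarr 5 = Function.update (s.rarr 5) v (key v) := by
    rw [hF₃.rarr 5 (by decide), hF₂.rarr 5 (by decide), b5]
  have upd : ∀ u : Fin m, u ≠ v → Function.update key v (s.rreg 7) u = key u := fun u hu =>
    Function.update_of_ne (fun e => hu (Fin.ext e)) ..
  -- The node is flagged before its neighbors are updated, so its key stays at the sentinel `rreg
  -- 7`.
  have hvM : key' v = s.rreg 7 := by
    rw [k1 v (by rw [flag, if_pos ((hmem v).2 (Or.inr rfl))]; omega), Function.update_self]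
  refine ⟨by rw [hF₃.iarr 0 (by decide), e0], by rw [hF₃.iarr 7 (by decide), e7], key', ?_⟩
  refine ⟨ready₂.of_frame hF₃ (by decide) (by decide), ?_, le₃, by rw [m7₃]; exact h.high_lt, tree₃,
    ?_, ?_, fun x hx => ?_, fun u hu => ?_, fun u hu => ?_, fun u hu => ?_⟩
  · rw [hF₃.ireg 2 (by decide), hF₂.ireg 2 (by decide), size₁]
  · rw [m7₃]
    refine h.inv.step hk hmin hvM (fun u hu => ?_) (fun u hu => ?_) (fun u hu hne => ?_)
      fun u hu huL y hy => ?_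
    · have huv : u ≠ v := by rintro rfl; exact hvL hu
      show key' u = _
      rw [k1 u (by rw [flag, if_pos ((hmem u).2 (Or.inl hu))]; omega), upd u huv]
      exact h.inv.done u hu
    · exact (k2 u).trans (upd u hu).le
    · refine k3 u ?_
      rw [upd u hu]; exact hne
    · refine k4 u hu ?_ y hy
      rw [flag, if_neg fun hu' => ?_]
      rcases (hmem u).1 hu' with h' | rfl
      · exact huL h'
      · exact hu.ne rfl
  · refine outputSequence_succ h.output ?_ ?_ ?_
    · rw [hF₃.ireg 0 (by decide), hF₂.ireg 0 (by decide), a0]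
    · rw [hF₃.iarr 3 (by decide), hF₂.iarr 3 (by decide), a3]
    · rw [hF₃.rarr 4 (by decide), hF₂.rarr 4 (by decide), b4]
  · rw [b5₃]
    rcases List.mem_append.1 hx with hx | hx
    · rw [Function.update_of_ne, h.realization x hx]
      intro e
      exact hvL (Fin.ext e ▸ List.mem_map_of_mem hx)
    · rw [List.mem_singleton.1 hx, Function.update_self]
  · rw [hmem, not_or] at hu
    rw [b5₃, Function.update_of_ne fun e => hu.2 (Fin.ext e), h.realization_high u hu.1]
  · rw [hF₃.iarr 7 (by decide), flag, if_pos hu]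
  · rw [hF₃.iarr 7 (by decide), flag, if_neg hu]

/-- The main loop of the query. -/
def queryLoop : Cmd :=
  .loop (.and (.ilt (.const 0) (.reg 2)) (.rlt (.read 6 (.const 1)) (.reg 7))) queryStep

theorem queryLoop_run {B : ℕ} {s : Store} {L : List (Fin m × ℝ)} {key : ℕ → ℝ}
    (h : QueryState T Q B s L key) (hm : m ≤ 2 * T.numEdges)
    (hB : 2 * (2 * T.numEdges) + 2 ≤ B) :
    Run B queryLoop s (2 * T.numEdges * (200 * Nat.size (2 * (2 * T.numEdges)) + 460) + 10)
      fun s' => ∃ L', T.PotentialWSOutputs Q L' ∧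
        outputSequence s' = (L'.map fun x => (x.1.val, x.2)) ∧
        T.IsCanonicalRealization ↑Q (outputRealization m s') := by
  have hc : (BExp.and (.ilt (.const 0) (.reg 2)) (.rlt (.read 6 (.const 1)) (.reg 7))).cost = 8 := by
    decide
  generalize hz : Nat.size (2 * (2 * T.numEdges)) = z
  -- A node that has not been output holds the cost of its own output step: a tournament update, and
  -- a search with a possible update for each adjacency entry. As `m ≤ 2 * T.numEdges`, the sum is
  -- at most `2 * T.numEdges * (200 * z + 440)`.
  let f : (ℕ → ℕ) → ℕ → ℕ := fun flag v => if flag v = 0 then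
    (140 * z + 310) * (s.iarr 0 (v + 1) - s.iarr 0 v) + (60 * z + 130) else 0
  refine (Run.loop (fun s' => s'.iarr 0 = s.iarr 0 ∧ ∃ L key, QueryState T Q B s' L key)
    (fun s' => ∑ v ∈ Finset.range m, f (s'.iarr 7) v) ⟨rfl, L, key, h⟩ ?_ ?_).mono ?_ ?_
  · rintro s' - ⟨-, L, key, h⟩
    have := h.size
    simp; omega
  · rintro s' - ⟨e0, L, key, h⟩ hb
    simp [h.size] at hb
    obtain ⟨hroot, hval⟩ := h.tree.root hb.1
    have hstep := queryStep_run h hm hB (v := ⟨_, hroot⟩) rfl (by rw [← hval]; exact hb.2)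
      fun w => by simp only [← hval]; exact h.tree.root_le w.2
    refine ⟨_, hstep.mono le_rfl fun s'' _ ⟨e0', e7, key', h'⟩ =>
      ⟨⟨e0'.trans e0, _, key', h'⟩, ?_⟩⟩
    have hvL : (⟨_, hroot⟩ : Fin m) ∉ L.map Prod.fst := fun hvL =>
      (hval ▸ hb.2).ne (h.inv.done _ hvL)
    have hflag := h.flag_not_mem _ hvL
    simp only at hflag e7
    have hmem := Finset.mem_range.2 hroot
    rw [← Finset.sum_erase_add _ _ hmem, ← Finset.sum_erase_add _ _ hmem, hc, e0, hz]
    have h1 : ∑ v ∈ (Finset.range m).erase (s'.iarr 4 1), f (s''.iarr 7) v =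
        ∑ v ∈ (Finset.range m).erase (s'.iarr 4 1), f (s'.iarr 7) v :=
      Finset.sum_congr rfl fun v hv => by
        simp only [f, e7, Function.update_of_ne (Finset.ne_of_mem_erase hv)]
    rw [h1]
    simp only [f, e7, Function.update_self, hflag, if_true]
    simp only [one_ne_zero, if_false]
    omega
  · have h1 : ∑ v ∈ Finset.range m, f (s.iarr 7) v ≤ ∑ v ∈ Finset.range m,
        ((140 * z + 310) * (s.iarr 0 (v + 1) - s.iarr 0 v) + (60 * z + 130)) :=
      Finset.sum_le_sum fun v _ => by simp only [f]; split_ifs <;> omega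
    have h2 : ∀ k ≤ m, ∑ v ∈ Finset.range k, (s.iarr 0 (v + 1) - s.iarr 0 v) = s.iarr 0 k := by
      intro k
      induction k with
      | zero => simp [h.ready.graph.off_zero]
      | succ k ih =>
        intro hk
        rw [Finset.sum_range_succ, ih (by omega)]
        have := h.ready.graph.off_le k (by omega)
        omega
    rw [Finset.sum_add_distrib, ← Finset.mul_sum, h2 m le_rfl, h.ready.graph.off_last,
      Finset.sum_const, Finset.card_range, smul_eq_mul] at h1
    have h3 := Nat.mul_le_mul_right (60 * z + 130) hm
    rw [hc]
    linarith
  · rintro s' - ⟨⟨-, L, key, h⟩, hb⟩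
    simp [h.size] at hb
    have hL := h.inv.finish h.high_lt fun v => by
      have hv : (v : ℕ) < m := v.2
      exact (hb (by omega)).trans (h.tree.root_le hv)
    exact ⟨L, hL, h.output, potentialWSOutputs_isCanonicalRealization hL h.realization
      h.realization_high⟩

end RealRAM

/-! ### Initialization of a query. -/

namespace RealRAM

open ImpreciseTerrain

variable {m : ℕ} {T : ImpreciseTerrain (Fin m)} {Q : Finset (Fin m)}

/-- Set up the realization of highest elevations in the real array 5, and a number above all
elevations in `rreg 7`. -/
def initHigh : Cmd :=
  .seq (.seq (.iset 2 (.reg 0)) (.seq (.iset 4 (.const 0)) (.rset 7 (.const 0))))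
    (.loop (.ilt (.reg 4) (.reg 2))
      (.seq (.rwrite 5 (.reg 4) (.read 3 (.reg 4))) <|
        .seq (.ite (.rlt (.read 3 (.reg 4)) (.reg 7)) .skip
          (.rset 7 (.add (.read 3 (.reg 4)) (.const 1))))
          (.iset 4 (.add (.reg 4) (.const 1)))))

theorem initHigh_run {B : ℕ} {s : Store} (hB : 1 ≤ B) (h0 : s.ireg 0 ≤ B) :
    Run B initHigh s (40 * s.ireg 0 + 20) fun s' => s'.ireg 2 = s.ireg 0 ∧
      ∀ v < s.ireg 0, s'.rarr 5 v = s.rarr 3 v ∧ s.rarr 3 v < s'.rreg 7 := by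
  generalize hN : s.ireg 0 = N at *
  refine Run.wp_seq (k := 40 * N + 10) ?_ (by simp [Cmd.time, IExp.cost, RExp.cost]; omega)
  simp [hN, h0]
  refine (Run.loop (fun s' => s'.ireg 4 ≤ N ∧ ∀ v < s'.ireg 4, s'.rarr 5 v = s.rarr 3 v ∧
    s.rarr 3 v < s'.rreg 7) (fun s' => 40 * (N - s'.ireg 4)) ?_ ?_ ?_).mono ?_ ?_
  · simp
  · rintro s' hF ⟨h4, -⟩
    have h2 : s'.ireg 2 = N := by rw [hF.ireg 2 (by decide)]; simp
    simp [h2]; omega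
  · rintro s' hF ⟨h4, hI⟩ hb
    have h2 : s'.ireg 2 = N := by rw [hF.ireg 2 (by decide)]; simp
    have h3 : s'.rarr 3 = s.rarr 3 := by rw [hF.rarr 3 (by decide)]
    simp [h2] at hb
    refine ⟨30, (Run.of_wp (Q := fun s'' => s''.ireg 4 = s'.ireg 4 + 1 ∧
      s''.rarr 5 = Function.update (s'.rarr 5) (s'.ireg 4) (s.rarr 3 (s'.ireg 4)) ∧
      s.rarr 3 (s'.ireg 4) < s''.rreg 7 ∧ s'.rreg 7 ≤ s''.rreg 7) ?_).mono (by decide)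
      fun s'' _ ⟨k1, k2, k3, k4⟩ => ⟨⟨by omega, fun v hv => ?_⟩, ?_⟩⟩
    · have e1 : s'.ireg 4 < B := by omega
      simp +contextual [h3, hB, e1, e1.le]
      intro h
      linarith
    · rw [k2]
      by_cases hv' : v = s'.ireg 4
      · rw [hv', Function.update_self]; exact ⟨rfl, k3⟩
      · rw [Function.update_of_ne hv']
        obtain ⟨h5, h6⟩ := hI v (by omega)
        exact ⟨h5, h6.trans_le k4⟩
    · rw [k1]; simp [BExp.cost, IExp.cost]; omega
  · simp [BExp.cost, IExp.cost]
  · rintro s' hF ⟨⟨h4, hI⟩, hb⟩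
    have h2 : s'.ireg 2 = N := by rw [hF.ireg 2 (by decide)]; simp
    simp [h2] at hb
    exact ⟨h2, fun v hv => hI v (by omega)⟩

/-- Initialize the leaves of the tournament with the key `rreg 7`. -/
def initLeaves : Cmd :=
  .seq (.iset 4 (.const 0))
    (.loop (.ilt (.reg 4) (.reg 2))
      (.seq (.rwrite 6 (.add (.reg 2) (.reg 4)) (.reg 7)) <|
        .seq (.iwrite 4 (.add (.reg 2) (.reg 4)) (.reg 4)) (.iset 4 (.add (.reg 4) (.const 1)))))

theorem initLeaves_run {B N : ℕ} {s : Store} (hB : 2 * N + 2 ≤ B) (h2 : s.ireg 2 = N)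
    (hw : ∀ k, s.iarr 4 k ≤ B) :
    Run B initLeaves s (40 * N + 20) fun s' => (∀ k, s'.iarr 4 k ≤ B) ∧
      ∀ v < N, s'.rarr 6 (N + v) = s.rreg 7 ∧ s'.iarr 4 (N + v) = v := by
  refine Run.wp_seq (k := 40 * N + 10) ?_ (by simp [Cmd.time, IExp.cost]; omega)
  simp
  refine (Run.loop (fun s' => s'.ireg 4 ≤ N ∧ (∀ k, s'.iarr 4 k ≤ B) ∧ ∀ v < s'.ireg 4,
    s'.rarr 6 (N + v) = s.rreg 7 ∧ s'.iarr 4 (N + v) = v)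
    (fun s' => 40 * (N - s'.ireg 4)) ?_ ?_ ?_).mono ?_ ?_
  · simp [hw]
  · rintro s' hF ⟨h4, -⟩
    have h2 : s'.ireg 2 = N := by rw [hF.ireg 2 (by decide)]; simpa
    simp [h2]; omega
  · rintro s' hF ⟨h4, hw', hI⟩ hb
    have h2 : s'.ireg 2 = N := by rw [hF.ireg 2 (by decide)]; simpa
    have h7 : s'.rreg 7 = s.rreg 7 := by rw [hF.rreg 7 (by decide)]
    simp [h2] at hb
    refine ⟨30, (Run.of_wp (Q := fun s'' => s''.ireg 4 = s'.ireg 4 + 1 ∧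
      s''.rarr 6 = Function.update (s'.rarr 6) (N + s'.ireg 4) (s.rreg 7) ∧
      s''.iarr 4 = Function.update (s'.iarr 4) (N + s'.ireg 4) (s'.ireg 4)) ?_).mono (by decide)
      fun s'' _ ⟨k1, k2, k3⟩ => ⟨⟨by omega, fun k => ?_, fun v hv => ?_⟩, ?_⟩⟩
    · have e1 : s'.ireg 4 < B := by omega
      have e2 : N + s'.ireg 4 ≤ B := by omega
      have e3 : N ≤ B := by omega
      have e4 : 1 ≤ B := by omega
      simp [h2, h7, e1, e1.le, e2, e3, e4]
    · rw [k3]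
      by_cases hk : k = N + s'.ireg 4
      · rw [hk, Function.update_self]; omega
      · rw [Function.update_of_ne hk]; exact hw' k
    · rw [k2, k3]
      by_cases hv' : v = s'.ireg 4
      · rw [hv', Function.update_self, Function.update_self]; exact ⟨rfl, rfl⟩
      · rw [Function.update_of_ne (by omega), Function.update_of_ne (by omega)]
        exact hI v (by omega)
    · rw [k1]; simp [BExp.cost, IExp.cost]; omega
  · simp [BExp.cost, IExp.cost]
  · rintro s' hF ⟨⟨h4, hw', hI⟩, hb⟩
    have h2 : s'.ireg 2 = N := by rw [hF.ireg 2 (by decide)]; simpa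
    simp [h2] at hb
    exact ⟨hw', fun v hv => hI v (by omega)⟩

/-- Enter the lowest elevations of the members of the query set into the tournament. -/
def initSources : Cmd :=
  .seq (.iset 4 (.const 0))
    (.loop (.ilt (.reg 4) (.reg 1))
      (.seq (.rwrite 6 (.add (.reg 2) (.read 2 (.reg 4))) (.read 2 (.read 2 (.reg 4))))
        (.iset 4 (.add (.reg 4) (.const 1)))))

theorem initSources_run {B N : ℕ} {s : Store} (hB : 2 * N + 2 ≤ B) (h2 : s.ireg 2 = N)
    (h1 : s.ireg 1 ≤ N) (hl : ∀ j < s.ireg 1, s.iarr 2 j < N) :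
    Run B initSources s (40 * N + 20) fun s' =>
      ∀ v < N, ((∃ j < s.ireg 1, s.iarr 2 j = v) → s'.rarr 6 (N + v) = s.rarr 2 v) ∧
        ((¬ ∃ j < s.ireg 1, s.iarr 2 j = v) → s'.rarr 6 (N + v) = s.rarr 6 (N + v)) := by
  refine Run.wp_seq (k := 40 * N + 10) ?_ (by simp [Cmd.time, IExp.cost]; omega)
  simp only [Cmd.wp, IExp.Ok, IExp.eval, Nat.zero_le, true_and]
  refine (Run.loop (fun s' => s'.ireg 4 ≤ s.ireg 1 ∧
    ∀ v < N, ((∃ j < s'.ireg 4, s.iarr 2 j = v) → s'.rarr 6 (N + v) = s.rarr 2 v) ∧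
        ((¬ ∃ j < s'.ireg 4, s.iarr 2 j = v) → s'.rarr 6 (N + v) = s.rarr 6 (N + v)))
    (fun s' => 40 * (s.ireg 1 - s'.ireg 4)) ?_ ?_ ?_).mono ?_ ?_
  · simp
  · rintro s' hF ⟨h4, -⟩
    have h1 : s'.ireg 1 = s.ireg 1 := by rw [hF.ireg 1 (by decide)]; simp
    simp [h1]; omega
  · rintro s' hF ⟨h4, hI⟩ hb
    have h1 : s'.ireg 1 = s.ireg 1 := by rw [hF.ireg 1 (by decide)]; simp
    have h2 : s'.ireg 2 = N := by rw [hF.ireg 2 (by decide)]; simpa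
    have a2 : s'.iarr 2 = s.iarr 2 := by rw [hF.iarr 2 (by decide)]
    have b2 : s'.rarr 2 = s.rarr 2 := by rw [hF.rarr 2 (by decide)]
    simp [h1] at hb
    have hlt := hl _ hb
    refine ⟨30, (Run.of_wp (Q := fun s'' => s''.ireg 4 = s'.ireg 4 + 1 ∧
      s''.rarr 6 = Function.update (s'.rarr 6) (N + s.iarr 2 (s'.ireg 4))
        (s.rarr 2 (s.iarr 2 (s'.ireg 4)))) ?_).mono (by decide)
      fun s'' _ ⟨k1, k2⟩ => ⟨⟨by omega, fun v hv => ?_⟩, ?_⟩⟩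
    · have e1 : s'.ireg 4 < B := by omega
      have e2 : N + s.iarr 2 (s'.ireg 4) ≤ B := by omega
      have e3 : N ≤ B := by omega
      have e4 : 1 ≤ B := by omega
      have e5 : s.iarr 2 (s'.ireg 4) ≤ B := by omega
      simp [h2, a2, b2, e1, e1.le, e2, e3, e4, e5]
    · rw [k2, k1]
      obtain ⟨hI1, hI2⟩ := hI v hv
      by_cases hv' : v = s.iarr 2 (s'.ireg 4)
      · rw [← hv', Function.update_self]
        exact ⟨fun _ => rfl, fun hn => absurd ⟨_, Nat.lt_succ_self _, hv'.symm⟩ hn⟩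
      · rw [Function.update_of_ne (by omega)]
        refine ⟨fun ⟨j, hj, e⟩ => hI1 ⟨j, lt_of_le_of_ne (by omega) ?_, e⟩,
          fun hn => hI2 fun ⟨j, hj, e⟩ => hn ⟨j, by omega, e⟩⟩
        rintro rfl
        exact hv' e.symm
    · rw [k1]; simp [BExp.cost, IExp.cost]; omega
  · simp [BExp.cost, IExp.cost]; omega
  · rintro s' hF ⟨⟨h4, hI⟩, hb⟩
    have h1 : s'.ireg 1 = s.ireg 1 := by rw [hF.ireg 1 (by decide)]; simp
    simp [h1] at hb
    rwa [show s'.ireg 4 = s.ireg 1 by omega] at hI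

/-- The query. -/
def answer : Cmd :=
  .seq initHigh <| .seq initLeaves <| .seq initSources <| .seq build <|
    .seq (.iset 0 (.const 0)) queryLoop

theorem answer_run {B : ℕ} {s : Store} (h : HullsReady T s) (h0 : s.ireg 0 = m)
    (hm : m ≤ 2 * T.numEdges) (hB : 2 * (2 * T.numEdges) + 2 ≤ B) (hw : ∀ k, s.iarr 4 k ≤ B)
    (h7 : ∀ v, s.iarr 7 v = 0) {l : List (Fin m)} (hl : l.Nodup) (hQ : l.toFinset = Q)
    (h1 : s.ireg 1 = l.length) (h2 : ∀ j (hj : j < l.length), s.iarr 2 j = l[j]) :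
    Run B answer s
      (2 * T.numEdges * (200 * Nat.size (2 * (2 * T.numEdges)) + 460) + 360 * T.numEdges + 140)
      fun s' => ∃ L', T.PotentialWSOutputs Q L' ∧
        outputSequence s' = (L'.map fun x => (x.1.val, x.2)) ∧
        T.IsCanonicalRealization ↑Q (outputRealization m s') := by
  have hlen : l.length ≤ m := by simpa using hl.length_le_card
  generalize hz : 2 * T.numEdges * (200 * Nat.size (2 * (2 * T.numEdges)) + 460) = z
  refine Run.seq ((initHigh_run (B := B) (s := s) (by omega) (by omega)).mono le_rfl
    fun s₁ hF₁ ⟨size₁, high₁⟩ => ?_)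
    (show 40 * s.ireg 0 + 20 + (140 * m + 112 + z) ≤ _ by omega)
  rw [h0] at size₁ high₁
  refine Run.seq ((initLeaves_run (B := B) (N := m) (s := s₁) (by omega) size₁
    (by rwa [hF₁.iarr 4 (by decide)])).mono le_rfl fun s₂ hF₂ ⟨le₂, leaves₂⟩ => ?_)
    (show 40 * m + 20 + (100 * m + 92 + z) ≤ _ by omega)
  have size₂ : s₂.ireg 2 = m := (hF₂.ireg 2 (by decide)).trans size₁
  have c1 : s₂.ireg 1 = l.length := by rw [hF₂.ireg 1 (by decide), hF₁.ireg 1 (by decide), h1]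
  have c2 : s₂.iarr 2 = s.iarr 2 := by rw [hF₂.iarr 2 (by decide), hF₁.iarr 2 (by decide)]
  have low₂ : s₂.rarr 2 = s.rarr 2 := by rw [hF₂.rarr 2 (by decide), hF₁.rarr 2 (by decide)]
  have hmem : ∀ v : Fin m, (∃ j < s₂.ireg 1, s₂.iarr 2 j = v) ↔ v ∈ Q := by
    intro v
    rw [c1, c2, ← hQ, List.mem_toFinset, List.mem_iff_getElem]
    constructor
    · rintro ⟨j, hj, e⟩
      exact ⟨j, hj, Fin.ext ((h2 j hj).symm.trans e)⟩
    · rintro ⟨j, hj, rfl⟩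
      exact ⟨j, hj, h2 j hj⟩
  refine Run.seq ((initSources_run (B := B) (N := m) (s := s₂) (by omega) size₂ (by omega)
    (fun j hj => by rw [c2, h2 j (by omega)]; exact Fin.is_lt _)).mono le_rfl
    fun s₃ hF₃ sources₃ => ?_) (show 40 * m + 20 + (60 * m + 72 + z) ≤ _ by omega)
  have le₃ : ∀ k, s₃.iarr 4 k ≤ B := by rwa [hF₃.iarr 4 (by decide)]
  have size₃ : s₃.ireg 2 = m := (hF₃.ireg 2 (by decide)).trans size₂
  refine Run.seq ((build_run (B := B) (N := m) (s := s₃) (key := fun v => s₃.rarr 6 (m + v))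
    (by omega) size₃ le₃ (fun _ _ => rfl)
    (fun v hv => by rw [hF₃.iarr 4 (by decide)]; exact (leaves₂ v hv).2)).mono le_rfl
    fun s₄ hF₄ ⟨tree₄, le₄⟩ => ?_) (show 60 * m + 60 + (12 + z) ≤ _ by omega)
  have ready₄ : HullsReady T s₄ := (((h.of_frame hF₁ (by decide) (by decide)).of_frame hF₂
    (by decide) (by decide)).of_frame hF₃ (by decide) (by decide)).of_frame hF₄ (by decide)
    (by decide)
  -- Register 0, until now the number of nodes, becomes the length of the output sequence.
  refine Run.wp_seq (k := z + 10) ⟨Nat.zero_le _, ?_⟩ (by simp [Cmd.time, IExp.cost]; omega)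
  have m7 : s₄.rreg 7 = s₁.rreg 7 := by
    rw [hF₄.rreg 7 (by decide), hF₃.rreg 7 (by decide), hF₂.rreg 7 (by decide)]
  have hkey : ∀ v : Fin m, (v ∈ Q → s₃.rarr 6 (m + v) = T.low v) ∧
      (v ∉ Q → s₃.rarr 6 (m + v) = s₄.rreg 7) := by
    intro v
    obtain ⟨k1, k2⟩ := sources₃ v v.2
    rw [hmem, low₂, h.terrain.low] at k1
    rw [hmem, (leaves₂ v v.2).1, ← m7] at k2
    exact ⟨k1, k2⟩
  have b5 : s₄.rarr 5 = s₁.rarr 5 := by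
    rw [hF₄.rarr 5 (by decide), hF₃.rarr 5 (by decide), hF₂.rarr 5 (by decide)]
  have a7 : s₄.iarr 7 = s.iarr 7 := by
    rw [hF₄.iarr 7 (by decide), hF₃.iarr 7 (by decide), hF₂.iarr 7 (by decide),
      hF₁.iarr 7 (by decide)]
  refine (queryLoop_run (Q := Q) (L := []) (key := fun v => s₃.rarr 6 (m + v)) ?_ hm hB).mono
    (by rw [hz]) fun _ _ h => h
  refine ⟨ready₄.congr (fun _ _ => rfl) (fun _ _ => rfl), ?_, le₄, fun v => ?_, tree₄,
    SearchInv.init (fun v hv => (hkey v).1 hv) (fun v hv => (hkey v).2 hv), by simp [outputSequence],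
    by simp, fun v _ => ?_, by simp, fun v _ => ?_⟩
  · simp [hF₄.ireg 2 (by decide), size₃]
  · rw [m7, ← h.terrain.high]; exact (high₁ v v.2).2
  · rw [b5, ← h.terrain.high]; exact (high₁ v v.2).1
  · rw [a7, h7]

end RealRAM

/-! ### From binary digits to logarithms. -/

namespace RealRAM

open ImpreciseTerrain

/-- For `n ≥ 2` this is `log n ≥ log 2 > 1 / 2`; the summand 1 takes care of `n = 1`, where the
logarithm vanishes. -/
theorem nat_le_mul_log (n : ℕ) : (n : ℝ) ≤ 2 * (n * Real.log n) + 1 := by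
  rcases Nat.lt_or_ge n 2 with h | h
  · interval_cases n <;> simp
  · have h2 : (1 : ℝ) / 2 ≤ Real.log n := by
      have h1 := Real.log_two_gt_d9
      have h3 : Real.log 2 ≤ Real.log n := Real.log_le_log (by norm_num) (by exact_mod_cast h)
      linarith
    have := mul_le_mul_of_nonneg_left h2 (Nat.cast_nonneg (α := ℝ) n)
    linarith

/-- If `n` has `k + 1` binary digits, then `2 ^ k ≤ n` and `4 * n` has `k + 3` digits; `log 2 > 1 /
2` turns this into at most `2 * log n + 3` digits. -/
theorem mul_size_le_mul_log (n : ℕ) :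
    (n : ℝ) * Nat.size (2 * (2 * n)) ≤ 8 * (n * Real.log n) + 3 := by
  rcases Nat.eq_zero_or_pos n with rfl | h
  · simp
  have h1 : (Nat.size (2 * (2 * n)) : ℝ) ≤ 2 * Real.log n + 3 := by
    have hn : (0 : ℝ) < n := by exact_mod_cast h
    have h1 := Nat.size_pos.2 h
    have h2 : 2 ^ (Nat.size n - 1) ≤ n := Nat.lt_size.1 (by omega)
    have h3 : Nat.size (2 * (2 * n)) ≤ Nat.size n - 1 + 3 := by
      refine Nat.size_le.2 ?_
      have h4 := Nat.lt_size_self n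
      have h5 : 2 ^ (Nat.size n - 1 + 3) = 4 * 2 ^ Nat.size n := by
        rw [show Nat.size n - 1 + 3 = Nat.size n + 2 by omega, pow_add]; ring
      omega
    have h4 : ((Nat.size n - 1 : ℕ) : ℝ) * Real.log 2 ≤ Real.log n := by
      rw [← Real.log_pow]
      exact Real.log_le_log (by positivity) (by exact_mod_cast h2)
    have h5 := Real.log_two_gt_d9
    have h6 : (Nat.size (2 * (2 * n)) : ℝ) ≤ (Nat.size n - 1 : ℕ) + 3 := by exact_mod_cast h3
    have h7 : ((Nat.size n - 1 : ℕ) : ℝ) * (1 / 2) ≤ ((Nat.size n - 1 : ℕ) : ℝ) * Real.log 2 :=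
      mul_le_mul_of_nonneg_left (by linarith) (Nat.cast_nonneg _)
    linarith
  have h2 := mul_le_mul_of_nonneg_left h1 (Nat.cast_nonneg (α := ℝ) n)
  have h3 := nat_le_mul_log n
  linarith

end RealRAM

/-! ### The theorem. -/

theorem ImpreciseTerrain.potentialWS_correct (m : ℕ) (T : ImpreciseTerrain (Fin m))
    (Q : Finset (Fin m)) :
    ∃ Rbar : Fin m → ℝ,
      T.IsCanonicalRealization ↑Q Rbar ∧
      T.watershed Rbar ↑Q = T.potentialWatershed ↑Q ∧
      (∀ k S L, T.PWSRun Q k S L → k ≤ Q.card + 2 * T.numEdges) ∧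
      (∃ L, T.PotentialWSOutputs Q L) ∧
      ∀ L, T.PotentialWSOutputs Q L →
        (L.map Prod.fst).Nodup ∧
        {p | p ∈ L.map Prod.fst} = T.potentialWatershed ↑Q ∧
        ∀ x ∈ L, x.2 = Rbar x.1 := by
  obtain ⟨Rbar, h⟩ := T.exists_isCanonicalRealization (Q : Set (Fin m))
  exact ⟨Rbar, h, h.watershed_eq, fun k S L hr => PWSRun.le h hr, exists_potentialWSOutputs h,
    fun L hL => potentialWSOutputs_spec h hL⟩

theorem mainTheorem2 :
    -- correctness of the algorithm
    (∀ (m : ℕ) (T : ImpreciseTerrain (Fin m)) (Q : Finset (Fin m)),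
      ∃ Rbar : Fin m → ℝ,
        T.IsCanonicalRealization ↑Q Rbar ∧
        T.watershed Rbar ↑Q = T.potentialWatershed ↑Q ∧
        (∀ k S L, T.PWSRun Q k S L → k ≤ Q.card + 2 * T.numEdges) ∧
        (∃ L, T.PotentialWSOutputs Q L) ∧
        ∀ L, T.PotentialWSOutputs Q L →
          (L.map Prod.fst).Nodup ∧
          {p | p ∈ L.map Prod.fst} = T.potentialWatershed ↑Q ∧
          ∀ x ∈ L, x.2 = Rbar x.1) ∧
    -- running time and space of the algorithm
    ∃ (pre query : RealRAM.Cmd) (C : ℕ),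
      ∀ (m : ℕ) (T : ImpreciseTerrain (Fin m)) (adj : Fin m → List (Fin m)),
        (∀ v, ∃ w, T.graph.Adj v w) →
        RealRAM.IsAdjacencyLists T adj →
        ∃ (t₁ : ℕ) (s₁ : RealRAM.Store),
          RealRAM.Exec (C * (T.numEdges + 1)) pre (RealRAM.inputStore T adj) t₁ s₁ ∧
          (t₁ : ℝ) ≤ C * (T.numEdges * Real.log T.numEdges + 1) ∧
          ∀ (Q : Finset (Fin m)) (l : List (Fin m)), l.Nodup → l.toFinset = Q →
            ∃ (t₂ : ℕ) (s₂ : RealRAM.Store),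
              RealRAM.Exec (C * (T.numEdges + 1)) query (RealRAM.loadQuery l s₁) t₂ s₂ ∧
              (t₂ : ℝ) ≤ C * (T.numEdges * Real.log T.numEdges + 1) ∧
              (∃ L, T.PotentialWSOutputs Q L ∧
                RealRAM.outputSequence s₂ = L.map fun x => (x.1.val, x.2)) ∧
              T.IsCanonicalRealization ↑Q (RealRAM.outputRealization m s₂) := by

  -- The query is the more expensive program. With `X = n * log n`, the two logarithmic lemmas bound
  -- its time by `400 * (8 * X + 3) + 1280 * (2 * X + 1) + 140`, well below `10000 * (X + 1)`.
  refine ⟨ImpreciseTerrain.potentialWS_correct, RealRAM.precompute, RealRAM.answer, 10000,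
    fun m T adj hT hadj => ?_⟩
  have hgraph := RealRAM.isAdjacencyArray_inputStore T hadj
  have hm := hgraph.le_two_mul_numEdges hT
  have hn := RealRAM.nat_le_mul_log T.numEdges
  have hsize := RealRAM.mul_size_le_mul_log T.numEdges
  have hin : RealRAM.HoldsInput T (RealRAM.inputStore T adj) :=
    ⟨rfl, hgraph, RealRAM.holdsTerrain_inputStore T adj⟩
  -- The frame is kept because the query relies on register 0 and on the zero flags in array 7,
  -- which the precomputation does not touch.
  obtain ⟨t₁, s₁, hpre, ht₁, ⟨hready, hw⟩, hF⟩ := (RealRAM.precompute_run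
    (B := 10000 * (T.numEdges + 1)) hin hm (by omega)
    (fun k => by simp [RealRAM.inputStore]) (fun p => by simp [RealRAM.inputStore])).mono le_rfl
    fun s' hF h => (⟨h, hF⟩ : _ ∧ RealRAM.Frame _ _ s')
  have ht₁' := (Nat.cast_le (α := ℝ)).2 ht₁
  push_cast at ht₁'
  refine ⟨t₁, s₁, hpre, by push_cast; linarith, fun Q l hl hQ => ?_⟩
  obtain ⟨t₂, s₂, hquery, ht₂, L, hL, hout, hR⟩ := RealRAM.answer_run
    (B := 10000 * (T.numEdges + 1)) (s := RealRAM.loadQuery l s₁) (Q := Q) (l := l)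
    (hready.congr (fun a ha => Function.update_of_ne (by rintro rfl; simp at ha) ..)
      fun _ _ => rfl)
    (by simpa [RealRAM.loadQuery, RealRAM.inputStore] using hF.ireg 0 (by decide)) hm (by omega)
    (by simpa [RealRAM.loadQuery] using hw)
    (fun v => by
      simp [RealRAM.loadQuery, hF.iarr 7 (by decide), RealRAM.inputStore])
    hl hQ (by simp [RealRAM.loadQuery])
    (fun j hj => by simp [RealRAM.loadQuery, hj])
  have ht₂' := (Nat.cast_le (α := ℝ)).2 ht₂
  push_cast at ht₂'
  exact ⟨t₂, s₂, hquery, by push_cast; linarith, ⟨L, hL, hout⟩, hR⟩
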